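/- Theorem (lower estimate for the Lyapunov exponent $\gamma_p$). Let $a:\mathbb Z^d\to[0,\infty)$ satisfy $a(z)=a(-z)$, $\sum_{z}a(z)=1$, $a(0)=0$ and $a(z)>0$ for $|z|=1$, and let $\mathcal L f(x)=\sum_{z\ne0}a(z)\,(f(x+z)-f(x))$. Let $b\in\ell^1(\mathbb Z^d)$ be real-valued, let $w(\cdot,z)$, $z\in\mathbb Z^d$, be independent standard Brownian motions with respect to a filtration, and put $W(t,x)=\sum_{z}b(x-z)w(t,z)$ and $B(x)=\sum_z b(x-z)b(-z)$, so that $\langle W(t,x)W(s,y)\rangle=\min(t,s)\,B(x-y)$. For $\varkappa>0$ let $u=u_\varkappa$ be the solution of the parabolic Anderson problem $\partial_t u=\varkappa\mathcal L u+\dot W u$, $u(0,\cdot)\equiv1$, in the Itô sense $$u(t,x)=1+\int_0^t\varkappa\mathcal L u(s,x)\,ds+\int_0^t u(s,x)\,dW(s,x),$$ i.e. $u$ is adapted, continuous in $t$ for each $x$, satisfies this equation almost surely for all $t\ge 0$, $x\in\mathbb Z^d$, and $\sup_{t\le T}\sum_x\mu(x)\langle u(t,x)^2\rangle<\infty$ for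 all $T$ and some summable weight $\mu>0$ on $\mathbb Z^d$ with $a*\mu\le C\mu$ for a constant $C$. Then for every integer $p\ge2$ the moments $\langle u_\varkappa(t,0)^p\rangle$ are finite and positive for all $t\ge 0$, the Lyapunov exponents $$\gamma_p(\varkappa)=\lim_{t\to\infty}\frac{\ln\langle u_\varkappa(t,0)^p\rangle}{t}$$ exist (as finite limits), and, writing $\gamma_p=\gamma_p(\varkappa)$, $$\frac{\gamma_p}{p-1}>\gamma_2\!\left(\frac{\varkappa}{p-1}\right)+\frac{B(0)(p-2)}{2}-2\varkappa d .$$ -/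

import Mathlib

open MeasureTheory ProbabilityTheory Filter
open scoped NNReal ENNReal Topology

noncomputable section

namespace Anderson

/-- The lattice `ℤ^d`. -/
abbrev Lattice (d : ℕ) : Type := Fin d → ℤ

/-- The jump distribution of the underlying random walk: a symmetric probability distribution on
`ℤ^d` without mass at the origin, charging all the nearest neighbours of the origin. -/
structure IsJumpKernel {d : ℕ} (a : Lattice d → ℝ) : Prop where
  nonneg : ∀ z, 0 ≤ a z
  symm : ∀ z, a (-z) = a z
  hasSum_one : HasSum a 1
  zero : a 0 = 0
  pos_of_unit : ∀ z : Lattice d, ∑ i, |z i| = 1 → 0 < a z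

/-- The non-local Laplacian `(ℒ f)(x) = ∑_{z ≠ 0} a(z) (f(x + z) - f(x))`
(the term `z = 0` vanishes). -/
def nonlocalLaplacian {d : ℕ} (a f : Lattice d → ℝ) (x : Lattice d) : ℝ :=
  ∑' z, a z * (f (x + z) - f x)

/-- The spatial correlation function `B(x) = ∑_z b(x - z) b(-z)`. -/
def corr {d : ℕ} (b : Lattice d → ℝ) (x : Lattice d) : ℝ :=
  ∑' z, b (x - z) * b (-z)

section Noise

variable {Ω : Type*} {mΩ : MeasurableSpace Ω} {d : ℕ}

/-- `w z`, `z ∈ ℤ^d`, are independent standard Brownian motions with respect to the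
filtration `ℱ`: they are adapted, and their increments after time `s` are (jointly in `z`)
independent of `ℱ s`. -/
structure IsBrownianFamily (P : Measure Ω) (ℱ : Filtration ℝ≥0 mΩ)
    (w : Lattice d → ℝ≥0 → Ω → ℝ) : Prop where
  isBrownian : ∀ z, IsBrownianReal (w z) P
  iIndep : iIndepFun (fun z ω t => w z t ω) P
  adapted : ∀ z, Adapted ℱ (w z)
  indep_increments : ∀ s t : ℝ≥0, s ≤ t →
    Indep (MeasurableSpace.comap (fun ω z => w z t ω - w z s ω) MeasurableSpace.pi) (ℱ s) P

/-- The spatially correlated Wiener process `W(t, x) = ∑_z b(x - z) w(t, z)`; the series converges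
absolutely almost surely when `b` is summable. -/
def corrWiener (b : Lattice d → ℝ) (w : Lattice d → ℝ≥0 → Ω → ℝ) (x : Lattice d)
    (t : ℝ≥0) (ω : Ω) : ℝ :=
  ∑' z, b (x - z) * w z t ω

/-- The left-endpoint (non-anticipating) Riemann sum
`∑_{k < n} X(k t / n) (W((k + 1) t / n) - W(k t / n))`. -/
def itoSum (X W : ℝ≥0 → Ω → ℝ) (t : ℝ≥0) (n : ℕ) (ω : Ω) : ℝ :=
  ∑ k ∈ Finset.range n,
    X ((k : ℝ≥0) / n * t) ω * (W (((k : ℝ≥0) + 1) / n * t) ω - W ((k : ℝ≥0) / n * t) ω)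

/-- `I` is the Itô integral `∫_0^t X dW`. This is used only when `X` is adapted with almost surely
continuous paths and `W` is a multiple of a Brownian motion for the same filtration; for such
processes the Itô integral is the limit in probability of the left-endpoint Riemann sums. -/
def IsItoIntegral (P : Measure Ω) (X W : ℝ≥0 → Ω → ℝ) (t : ℝ≥0) (I : Ω → ℝ) : Prop :=
  TendstoInMeasure P (fun n => itoSum X W t n) atTop I

/-- A weight `μ` on `ℤ^d` which is positive, summable, and for which `ℒ` is bounded on the
weighted Hilbert space `L²(ℤ^d, μ)` because `a * μ ≤ C μ`. -/
structure IsAdmissibleWeight (a μ : Lattice d → ℝ) : Prop where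
  pos : ∀ x, 0 < μ x
  summable : Summable μ
  conv_le : ∃ C : ℝ, ∀ x, ∑' z, a z * μ (x - z) ≤ C * μ x

/-- `u` is a solution of the parabolic Anderson problem
`∂u/∂t = ϰ ℒ u + ξ_t(x) u`, `u(0, x) = 1`, in the Itô sense in a weighted Hilbert space:
`u` is adapted and continuous in time, its norm in `L²(P; L²(ℤ^d, μ))` is bounded on bounded time
intervals for some admissible weight `μ`, and
`u(t, x) = 1 + ∫_0^t ϰ ℒ u(s, x) ds + ∫_0^t u(s, x) dW(s, x)`. -/
structure IsSolution (a b : Lattice d → ℝ) (ϰ : ℝ) (P : Measure Ω) (ℱ : Filtration ℝ≥0 mΩ)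
    (w : Lattice d → ℝ≥0 → Ω → ℝ) (u : ℝ≥0 → Lattice d → Ω → ℝ) : Prop where
  adapted : ∀ x, Adapted ℱ (fun t => u t x)
  continuous_paths : ∀ x, ∀ᵐ ω ∂P, Continuous (fun t => u t x ω)
  bounded : ∃ μ : Lattice d → ℝ, IsAdmissibleWeight a μ ∧
    ∀ T : ℝ≥0, ∃ K : ℝ≥0, ∀ t ≤ T,
      ∑' x, ENNReal.ofReal (μ x) * ∫⁻ ω, ‖u t x ω‖ₑ ^ 2 ∂P ≤ K
  equation : ∀ (t : ℝ≥0) (x : Lattice d),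
    IsItoIntegral P (fun s => u s x) (corrWiener b w x) t
      (fun ω => u t x ω - 1 -
        ∫ s in (0 : ℝ)..t, ϰ * nonlocalLaplacian a (fun y => u s.toNNReal y ω) x)

/-- `γ` is the `p`-th Lyapunov exponent of the field `u`: the moments `⟨u(t, 0)^p⟩` are finite and
positive, and `γ = lim_{t → ∞} ln ⟨u(t, 0)^p⟩ / t`. -/
structure HasLyapunovExponent (P : Measure Ω) (u : ℝ≥0 → Lattice d → Ω → ℝ) (p : ℕ)
    (γ : ℝ) : Prop where
  integrable : ∀ t, Integrable (fun ω => u t 0 ω ^ p) P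
  pos : ∀ t, 0 < ∫ ω, u t 0 ω ^ p ∂P
  tendsto : Tendsto (fun t : ℝ≥0 => Real.log (∫ ω, u t 0 ω ^ p ∂P) / t) atTop (𝓝 γ)

end Noise

end Anderson

end

/-! Approximate `u` by the exponential Euler scheme U_{k+1}(x) = exp(ΔW_k(x) - h B(0)/2) ((1 +
hϰℒ)U_k)(x), which stays nonnegative. Its noise increments are Gaussian and independent of the past,
so its p-point moments are exactly the iterates of a transfer operator for p independent walkers:
each walker takes one step of the kernel of 1 + hϰℒ, and the configuration is weighted by exp(h
∑_{i<j} B(x_i - x_j)) (`lintegral_prod_scheme`). All moment estimates are proved for these iterates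
and passed to the limit h → 0 (`IsSolution.tendsto_discreteMoment`).

Lower bound. Put q = p - 1 and hold q of the q + 1 walkers at the origin. Holding costs a factor 1 -
hϰ per walker and step, hence exp(-qϰt) in the limit; pairs of held walkers contribute q(q-1)B(0)/2;
the free walker evolves under ϰℒ + qB. The second moment for diffusivity ϰ/q at time qt is governed
by the difference of two walkers, which after the time change evolves under 2ϰℒ + qB up to time t:
same potential, twice the diffusion. Halving the diffusion can only increase the value at the
origin. Indeed B and the initial function 1 are positive definite, and multiplication by exp(rB)
with r ≥ 0, the operator 1 + τℒ (0 ≤ τ ≤ 1/2) and the operator -τℒ all preserve positive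
definiteness. So the difference of the two evolutions is positive definite, and nonnegative at 0
(`iterate_double_avg_le`). Altogether γ_{q+1} ≥ -qϰ + q(q-1)B(0)/2 + qγ_2(ϰ/q). Dividing by q gives
the claim with -ϰ in place of -2ϰd, and strictness follows from d ≥ 1 and ϰ > 0.

Existence of the exponents. By Hölder and translation invariance a p-point moment is at most the
moment with all points at 0 (`discreteMoment_le_zero`). This makes the moments submultiplicative in
time, and Fekete's lemma applies.

Convergence of the scheme. The Itô integral is given only as a limit in probability of Riemann sums,
so the isometry and the orthogonality to the past are proved for Riemann sums and the resulting
bounds are transferred by Fatou (`energy_le_of_tendstoInMeasure`). In the weighted mean square norm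
one step maps an error ε to at most (1 + ch)ε + c'h², so the error at a fixed time is O(h). Uniform
bounds for all moments of the scheme turn mean square convergence into convergence of all moments.
-/

noncomputable section

namespace Anderson

/-! ### Transfer operators -/

section Transfer

variable {G : Type*} [AddCommGroup G]

/-- The averaging operator `F ↦ ∑_z K(z) F(· + z)`. -/
def avg (K F : G → ℝ≥0∞) (x : G) : ℝ≥0∞ := ∑' z, K z * F (x + z)

/-- The transfer operator `F ↦ E · ∑_z K(z) F(· + z)`. -/
def transfer (E K F : G → ℝ≥0∞) (x : G) : ℝ≥0∞ := E x * avg K F x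

/-- The iterates of the transfer operator applied to the constant function `1`. -/
def transferIter (E K : G → ℝ≥0∞) (n : ℕ) : G → ℝ≥0∞ := (transfer E K)^[n] (fun _ => 1)

lemma transferIter_zero (E K : G → ℝ≥0∞) : transferIter E K 0 = fun _ => 1 := rfl

lemma transferIter_succ (E K : G → ℝ≥0∞) (n : ℕ) :
    transferIter E K (n + 1) = transfer E K (transferIter E K n) := by
  simp only [transferIter, Function.iterate_succ_apply']

lemma avg_mono {K F F' : G → ℝ≥0∞} (h : ∀ x, F x ≤ F' x) (x : G) : avg K F x ≤ avg K F' x :=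
  ENNReal.tsum_le_tsum fun z => by gcongr; exact h _

lemma avg_const_mul (K F : G → ℝ≥0∞) (c : ℝ≥0∞) (x : G) :
    avg K (fun y => c * F y) x = c * avg K F x := by
  simp only [avg, ← ENNReal.tsum_mul_left]
  exact tsum_congr fun z => by ring

lemma avg_const {K : G → ℝ≥0∞} (hK : ∑' z, K z = 1) (c : ℝ≥0∞) (x : G) :
    avg K (fun _ => c) x = c := by
  simp [avg, ENNReal.tsum_mul_right, hK]

lemma transferIter_le_pow {E K : G → ℝ≥0∞} (hK : ∑' z, K z = 1) {c : ℝ≥0∞} (hE : ∀ x, E x ≤ c)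
    (n : ℕ) (x : G) : transferIter E K n x ≤ c ^ n := by
  induction n generalizing x with
  | zero => simp [transferIter_zero]
  | succ n ih =>
    rw [transferIter_succ, transfer, pow_succ']
    exact mul_le_mul' (hE x) ((avg_mono ih x).trans (avg_const hK _ x).le)

lemma pow_le_transferIter {E K : G → ℝ≥0∞} (hK : ∑' z, K z = 1) {c : ℝ≥0∞} (hE : ∀ x, c ≤ E x)
    (n : ℕ) (x : G) : c ^ n ≤ transferIter E K n x := by
  induction n generalizing x with
  | zero => simp [transferIter_zero]
  | succ n ih =>
    rw [transferIter_succ, transfer, pow_succ']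
    exact mul_le_mul' (hE x) ((avg_const hK _ x).ge.trans (avg_mono ih x))

/-- The operator is monotone and homogeneous, so the inner `m` iterates may be replaced by their
upper bound and the constant pulled out. This is the source of submultiplicativity in time. -/
lemma transferIter_add_le {E K : G → ℝ≥0∞} {m : ℕ} {c : ℝ≥0∞}
    (hc : ∀ x, transferIter E K m x ≤ c) (n : ℕ) (x : G) :
    transferIter E K (n + m) x ≤ c * transferIter E K n x := by
  induction n generalizing x with
  | zero => simpa [transferIter_zero] using hc x
  | succ n ih =>
    rw [add_right_comm, transferIter_succ, transferIter_succ, transfer, transfer, mul_left_comm c]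
    exact mul_le_mul' le_rfl ((avg_mono ih x).trans (avg_const_mul _ _ _ _).le)

lemma transferIter_add_right {E K : G → ℝ≥0∞} {c : G} (hE : ∀ x, E (x + c) = E x) (n : ℕ) (x : G) :
    transferIter E K n (x + c) = transferIter E K n x := by
  induction n generalizing x with
  | zero => simp [transferIter_zero]
  | succ n ih =>
    simp only [transferIter_succ, transfer, hE, avg]
    congr 1
    refine tsum_congr fun z => ?_
    rw [add_right_comm, ih]

end Transfer

/-! ### Product kernels and the one-step kernel. -/

lemma hasSum_of_eq {α : Type*} {f g : α → ℝ} {r s : ℝ} (h : HasSum f r) (hfg : ∀ i, f i = g i)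
    (hrs : r = s) : HasSum g s := by
  rw [← hrs, ← funext hfg]
  exact h

lemma ennreal_prod_tsum {α : Type*} {n : ℕ} (f : Fin n → α → ℝ≥0∞) :
    ∏ i, ∑' z, f i z = ∑' z : Fin n → α, ∏ i, f i (z i) := by
  induction n with
  | zero => simp
  | succ n ih =>
    rw [Fin.prod_univ_succ, ih, ← (Fin.consEquiv (fun _ : Fin (n + 1) => α)).tsum_eq,
      ENNReal.tsum_prod', ← ENNReal.tsum_mul_right]
    refine tsum_congr fun y => ?_
    rw [← ENNReal.tsum_mul_left]
    refine tsum_congr fun z => ?_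
    simp [Fin.prod_univ_succ, Fin.consEquiv]

/-- The product kernel on `p`-tuples. -/
def powKernel {α : Type*} (K : α → ℝ≥0∞) (p : ℕ) (z : Fin p → α) : ℝ≥0∞ := ∏ i, K (z i)

lemma tsum_powKernel {α : Type*} {K : α → ℝ≥0∞} (hK : ∑' z, K z = 1) (p : ℕ) :
    ∑' z, powKernel K p z = 1 := by
  simp only [powKernel]
  rw [← ennreal_prod_tsum (fun _ : Fin p => K)]
  simp [hK]

variable {d : ℕ}

/-- The kernel of `1 + τ ℒ`. -/
def stepKernel (a : Lattice d → ℝ) (τ : ℝ) (z : Lattice d) : ℝ :=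
  (if z = 0 then 1 - τ else 0) + τ * a z

lemma stepKernel_nonneg {a : Lattice d → ℝ} (ha : IsJumpKernel a) {τ : ℝ} (h0 : 0 ≤ τ)
    (h1 : τ ≤ 1) (z : Lattice d) : 0 ≤ stepKernel a τ z := by
  have := mul_nonneg h0 (ha.nonneg z)
  unfold stepKernel
  split_ifs <;> linarith

lemma stepKernel_zero {a : Lattice d → ℝ} (ha : IsJumpKernel a) (τ : ℝ) :
    stepKernel a τ 0 = 1 - τ := by
  simp [stepKernel, ha.zero]

lemma stepKernel_neg {a : Lattice d → ℝ} (ha : IsJumpKernel a) (τ : ℝ) (z : Lattice d) :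
    stepKernel a τ (-z) = stepKernel a τ z := by
  simp [stepKernel, ha.symm]

lemma hasSum_stepKernel {a : Lattice d → ℝ} (ha : IsJumpKernel a) (τ : ℝ) :
    HasSum (stepKernel a τ) 1 := by
  have := (hasSum_ite_eq (0 : Lattice d) (1 - τ)).add (ha.hasSum_one.mul_left τ)
  rw [mul_one, sub_add_cancel] at this
  exact this

/-- The kernel of `1 + τ ℒ`, with values in `[0, ∞]`. -/
def stepKernelE (a : Lattice d → ℝ) (τ : ℝ) (z : Lattice d) : ℝ≥0∞ :=
  ENNReal.ofReal (stepKernel a τ z)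

lemma tsum_stepKernelE {a : Lattice d → ℝ} (ha : IsJumpKernel a) {τ : ℝ} (h0 : 0 ≤ τ)
    (h1 : τ ≤ 1) : ∑' z, stepKernelE a τ z = 1 := by
  simp only [stepKernelE]
  rw [← ENNReal.ofReal_tsum_of_nonneg (stepKernel_nonneg ha h0 h1) (hasSum_stepKernel ha τ).summable,
    (hasSum_stepKernel ha τ).tsum_eq, ENNReal.ofReal_one]

/-! ### The correlation function -/

lemma summable_mul_shift {b c : Lattice d → ℝ} (hb : Summable fun z => |b z|)
    (hc : Summable fun z => |c z|) (x y : Lattice d) :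
    Summable fun z => b (x - z) * c (y - z) := by
  have h1 : Summable fun z => |b (x - z)| := by
    exact (Equiv.subLeft x).summable_iff.mpr hb
  obtain ⟨M, hM⟩ : ∃ M, ∀ z, |c z| ≤ M := by
    refine ⟨∑' z, |c z|, fun z => hc.le_tsum z fun _ _ => abs_nonneg _⟩
  refine Summable.of_norm_bounded (h1.mul_right M) fun z => ?_
  rw [Real.norm_eq_abs, abs_mul]
  exact mul_le_mul_of_nonneg_left (hM _) (abs_nonneg _)

lemma hasSum_corr {b : Lattice d → ℝ} (hb : Summable fun z => |b z|) (x y : Lattice d) :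
    HasSum (fun z => b (x - z) * b (y - z)) (corr b (x - y)) := by
  have h := summable_mul_shift hb hb (x - y) 0
  have h2 := h.hasSum
  rw [← (Equiv.subRight y).hasSum_iff] at h2
  convert h2 using 1
  · ext z
    simp only [Function.comp, Equiv.subRight_apply]
    congr 2 <;> abel_nf
  · simp [corr]

lemma corr_neg {b : Lattice d → ℝ} (hb : Summable fun z => |b z|) (x : Lattice d) :
    corr b (-x) = corr b x := by
  have h1 := hasSum_corr hb 0 x
  have h2 := hasSum_corr hb x 0
  rw [zero_sub] at h1
  rw [sub_zero] at h2
  refine h1.unique ?_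
  simpa [mul_comm] using h2

/-- Both families b(x - z)² and b(-z)² sum to B(0); expand the squares (b(x - z) ± b(-z))² ≥ 0. -/
lemma abs_corr_le {b : Lattice d → ℝ} (hb : Summable fun z => |b z|) (x : Lattice d) :
    |corr b x| ≤ corr b 0 := by
  have h1 := hasSum_corr hb x 0
  have h2 := hasSum_corr hb x x
  have h3 := hasSum_corr hb 0 0
  simp only [sub_self, sub_zero, zero_sub] at h1 h2 h3
  rw [abs_le]
  constructor
  · have := ((h2.add h3).add (h1.mul_left 2)).nonneg fun z => by
      nlinarith [sq_nonneg (b (x - z) + b (-z))]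
    linarith
  · have := ((h2.add h3).sub (h1.mul_left 2)).nonneg fun z => by
      nlinarith [sq_nonneg (b (x - z) - b (-z))]
    linarith

lemma corr_zero_nonneg (b : Lattice d → ℝ) : 0 ≤ corr b 0 :=
  tsum_nonneg fun z => by simpa using mul_self_nonneg _

/-- The potential `∑_{i < j} B(x_i - x_j)` of the `p`-particle problem. -/
def potential (B : Lattice d → ℝ) {p : ℕ} (x : Fin p → Lattice d) : ℝ :=
  (∑ i, ∑ j, B (x i - x j) - p * B 0) / 2

lemma potential_add_const (B : Lattice d → ℝ) {p : ℕ} (x : Fin p → Lattice d) (c : Lattice d) :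
    potential B (x + fun _ => c) = potential B x := by
  simp [potential]

lemma abs_potential_le {b : Lattice d → ℝ} (hb : Summable fun z => |b z|) {p : ℕ}
    (x : Fin p → Lattice d) : |potential (corr b) x| ≤ (p * p + p) / 2 * corr b 0 := by
  have h : |∑ i, ∑ j, corr b (x i - x j)| ≤ p * p * corr b 0 := by
    refine (Finset.abs_sum_le_sum_abs _ _).trans ?_
    calc ∑ i, |∑ j, corr b (x i - x j)| ≤ ∑ _i : Fin p, p * corr b 0 := by
          refine Finset.sum_le_sum fun i _ => (Finset.abs_sum_le_sum_abs _ _).trans ?_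
          calc ∑ j, |corr b (x i - x j)| ≤ ∑ _j : Fin p, corr b 0 :=
                Finset.sum_le_sum fun j _ => abs_corr_le hb _
            _ = p * corr b 0 := by simp
      _ = p * p * corr b 0 := by simp; ring
  have h0 := mul_nonneg (Nat.cast_nonneg (α := ℝ) p) (corr_zero_nonneg b)
  rw [abs_le] at h ⊢
  unfold potential
  constructor <;> linarith [h.1, h.2]

/-- There are `p` pairs joining the walker at `x` to one at the origin, and p(p-1)/2 pairs at the
origin. -/
lemma potential_single {b : Lattice d → ℝ} (hb : Summable fun z => |b z|) (p : ℕ)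
    (x : Lattice d) :
    potential (corr b) (Pi.single (0 : Fin (p + 1)) x : Fin (p + 1) → Lattice d) =
      p * corr b x + p * (p - 1) / 2 * corr b 0 := by
  simp only [potential, Fin.sum_univ_succ, Pi.single_eq_same, sub_self, ne_eq, Fin.succ_ne_zero,
    not_false_eq_true, Pi.single_eq_of_ne, sub_zero, zero_sub, corr_neg hb]
  simp
  ring

/-! ### The `p`-particle operator -/

/-- The weight `exp(h ∑_{i < j} B(x_i - x_j))`. -/
def pointWeight (b : Lattice d → ℝ) (p : ℕ) (h : ℝ) (x : Fin p → Lattice d) : ℝ≥0∞ :=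
  ENNReal.ofReal (Real.exp (h * potential (corr b) x))

/-- The discrete `p`-point moment function. -/
def discreteMoment (a b : Lattice d → ℝ) (ϰ : ℝ) (p : ℕ) (h : ℝ) (n : ℕ) :
    (Fin p → Lattice d) → ℝ≥0∞ :=
  transferIter (pointWeight b p h) (powKernel (stepKernelE a (h * ϰ)) p) n

/-- Among all joint jumps keep only those in which walker 0 alone moves; the other `p` walkers stay
put with weight `K 0` each. -/
lemma avg_powKernel_single_ge (K : Lattice d → ℝ≥0∞) (p : ℕ) (F : (Fin (p + 1) → Lattice d) → ℝ≥0∞)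
    (x : Lattice d) :
    K 0 ^ p * avg K (fun y => F (Pi.single 0 y)) x ≤
      avg (powKernel K (p + 1)) F (Pi.single 0 x) := by
  have hinj : Function.Injective (fun z : Lattice d => (Pi.single 0 z : Fin (p + 1) → Lattice d)) :=
    Pi.single_injective (M := fun _ : Fin (p + 1) => Lattice d) 0
  refine le_trans (le_of_eq ?_) (ENNReal.tsum_comp_le_tsum_of_injective hinj _)
  rw [avg, ← ENNReal.tsum_mul_left]
  refine tsum_congr fun z => ?_
  rw [← Pi.single_add]
  simp [powKernel, Fin.prod_univ_succ]
  ring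

/-- Holding `p` of the `p + 1` walkers at the origin in every step leaves a one-walker problem in
the potential pB, times a factor per step from holding and from the mutual interaction of the held
walkers. -/
lemma discreteMoment_single_ge {a b : Lattice d → ℝ} (ha : IsJumpKernel a)
    (hb : Summable fun z => |b z|) {ϰ h : ℝ} (h1 : h * ϰ ≤ 1) (p n : ℕ)
    (x : Lattice d) :
    ENNReal.ofReal ((1 - h * ϰ) ^ p * Real.exp (h * (p * (p - 1) / 2 * corr b 0))) ^ n *
      transferIter (fun y => ENNReal.ofReal (Real.exp (h * (p * corr b y))))
        (stepKernelE a (h * ϰ)) n x ≤ discreteMoment a b ϰ (p + 1) h n (Pi.single 0 x) := by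
  set c := ENNReal.ofReal ((1 - h * ϰ) ^ p * Real.exp (h * (p * (p - 1) / 2 * corr b 0))) with hc
  set T := transferIter (fun y => ENNReal.ofReal (Real.exp (h * (p * corr b y))))
        (stepKernelE a (h * ϰ)) with hT
  unfold discreteMoment
  induction n generalizing x with
  | zero => simp [hT, transferIter_zero]
  | succ n ih =>
    rw [transferIter_succ, hT, transferIter_succ, ← hT, transfer, transfer]
    calc c ^ (n + 1) * (ENNReal.ofReal (Real.exp (h * (p * corr b x))) *
          avg (stepKernelE a (h * ϰ)) (T n) x)
        = (c * ENNReal.ofReal (Real.exp (h * (p * corr b x)))) *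
          avg (stepKernelE a (h * ϰ)) (fun y => c ^ n * T n y) x := by
          rw [avg_const_mul]; ring
      _ ≤ (pointWeight b (p + 1) h (Pi.single 0 x) * (stepKernelE a (h * ϰ) 0) ^ p) *
          avg (stepKernelE a (h * ϰ)) (fun y => transferIter (pointWeight b (p + 1) h)
            (powKernel (stepKernelE a (h * ϰ)) (p + 1)) n (Pi.single 0 y)) x := by
          refine mul_le_mul' (le_of_eq ?_) (avg_mono ih x)
          rw [hc, pointWeight, stepKernelE, stepKernel_zero ha, potential_single hb,
            ENNReal.ofReal_mul (pow_nonneg (by linarith) _),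
            ← ENNReal.ofReal_pow (by linarith), mul_add, Real.exp_add,
            ENNReal.ofReal_mul (Real.exp_pos _).le]
          ring
      _ ≤ _ := by
          rw [mul_assoc]
          gcongr
          exact avg_powKernel_single_ge _ _ _ _

/-- The difference of two independent walkers with symmetric jumps is a single walker making two
jumps. -/
lemma avg_avg_of_pair {K : Lattice d → ℝ≥0∞} (hK : ∀ z, K (-z) = K z) (f : Lattice d → ℝ≥0∞)
    (x : Fin 2 → Lattice d) :
    avg (powKernel K 2) (fun y => f (y 0 - y 1)) x = avg K (avg K f) (x 0 - x 1) := by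
  simp only [avg]
  rw [← (finTwoArrowEquiv (Lattice d)).symm.tsum_eq, ENNReal.tsum_prod']
  refine tsum_congr fun z => ?_
  rw [← ENNReal.tsum_mul_left, ← (Equiv.neg (Lattice d)).tsum_eq]
  refine tsum_congr fun y => ?_
  simp [powKernel, hK]
  rw [mul_assoc]
  congr 3
  abel

lemma potential_two {b : Lattice d → ℝ} (hb : Summable fun z => |b z|) (x : Fin 2 → Lattice d) :
    potential (corr b) x = corr b (x 0 - x 1) := by
  have : corr b (x 1 - x 0) = corr b (x 0 - x 1) := by rw [← corr_neg hb, neg_sub]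
  simp [potential, Fin.sum_univ_two, this]
  ring

lemma discreteMoment_two {a b : Lattice d → ℝ} (ha : IsJumpKernel a)
    (hb : Summable fun z => |b z|) (ϰ h : ℝ) (n : ℕ) (x : Fin 2 → Lattice d) :
    discreteMoment a b ϰ 2 h n x =
      (fun F y => ENNReal.ofReal (Real.exp (h * corr b y)) *
        avg (stepKernelE a (h * ϰ)) (avg (stepKernelE a (h * ϰ)) F) y)^[n] (fun _ => 1)
        (x 0 - x 1) := by
  unfold discreteMoment
  induction n generalizing x with
  | zero => rfl
  | succ n ih =>
    rw [Function.iterate_succ_apply', transferIter_succ, transfer, pointWeight, potential_two hb,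
      ← avg_avg_of_pair (fun z => by rw [stepKernelE, stepKernel_neg ha, stepKernelE])]
    congr 2
    exact funext ih

/-! ### Positive definite functions -/

/-- Positive definite functions on the lattice. -/
def IsPosDef (f : Lattice d → ℝ) : Prop :=
  ∀ (ι : Type) [Fintype ι] (x : ι → Lattice d) (c : ι → ℝ),
    0 ≤ ∑ i, ∑ j, c i * c j * f (x i - x j)

lemma IsPosDef.apply_zero_nonneg {f : Lattice d → ℝ} (hf : IsPosDef f) : 0 ≤ f 0 := by
  simpa using hf Unit (fun _ => 0) (fun _ => 1)

lemma isPosDef_one : IsPosDef (fun _ : Lattice d => 1) := by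
  intro ι _ x c
  simp only [mul_one, ← Finset.sum_mul_sum]
  exact mul_self_nonneg _

lemma isPosDef_zero : IsPosDef (fun _ : Lattice d => 0) := by
  intro ι _ x c
  simp

lemma isPosDef_of_hasSum {α : Type*} {f : α → Lattice d → ℝ} {F : Lattice d → ℝ}
    (hf : ∀ i, IsPosDef (f i)) (hF : ∀ x, HasSum (fun i => f i x) (F x)) : IsPosDef F := by
  intro ι _ x c
  have : HasSum (fun k => ∑ i, ∑ j, c i * c j * f k (x i - x j))
      (∑ i, ∑ j, c i * c j * F (x i - x j)) :=
    hasSum_sum fun i _ => hasSum_sum fun j _ => (hF _).mul_left _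
  exact this.nonneg fun k => hf k ι x c

lemma IsPosDef.add {f g : Lattice d → ℝ} (hf : IsPosDef f) (hg : IsPosDef g) :
    IsPosDef (fun x => f x + g x) := by
  intro ι _ x c
  have := add_nonneg (hf ι x c) (hg ι x c)
  simpa [mul_add, Finset.sum_add_distrib] using this

lemma IsPosDef.const_mul {f : Lattice d → ℝ} (hf : IsPosDef f) {r : ℝ} (hr : 0 ≤ r) :
    IsPosDef (fun x => r * f x) := by
  intro ι _ x c
  have := mul_nonneg hr (hf ι x c)
  simp only [Finset.mul_sum] at this
  refine this.trans_eq (Finset.sum_congr rfl fun i _ => Finset.sum_congr rfl fun j _ => ?_)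
  ring

/-- Test `f` on the doubled family of points x_i and x_i + z with coefficients c_i and εc_i. On the
Fourier side this is multiplication by 2 + 2ε cos(θ·z) ≥ 0 for ε = ±1. -/
lemma IsPosDef.two_mul_add_shift {f : Lattice d → ℝ} (hf : IsPosDef f) (z : Lattice d) {ε : ℝ}
    (hε : ε * ε = 1) : IsPosDef (fun x => 2 * f x + ε * (f (x + z) + f (x - z))) := by
  intro ι _ x c
  have := hf (ι ⊕ ι) (Sum.elim x fun i => x i + z) (Sum.elim c fun i => ε * c i)
  simp only [Fintype.sum_sum_type, Sum.elim_inl, Sum.elim_inr, add_sub_add_right_eq_sub,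
    ← Finset.sum_add_distrib] at this
  convert this using 4 with i _ j _
  rw [show x i + z - x j = x i - x j + z by abel, show x i - (x j + z) = x i - x j - z by abel]
  linear_combination (-(c i * c j * f (x i - x j))) * hε

/-- Schur's product argument: the matrix B(x_i - x_j) is a sum over z of the rank-one matrices b(x_i
- z) b(x_j - z), and each of these is absorbed into the coefficients. -/
lemma IsPosDef.corr_mul {b f : Lattice d → ℝ} (hb : Summable fun z => |b z|) (hf : IsPosDef f) :
    IsPosDef (fun x => corr b x * f x) := by
  intro ι _ x c
  have : HasSum (fun z => ∑ i, ∑ j, (c i * b (x i - z)) * (c j * b (x j - z)) * f (x i - x j))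
      (∑ i, ∑ j, c i * c j * (corr b (x i - x j) * f (x i - x j))) := by
    refine hasSum_sum fun i _ => hasSum_sum fun j _ => ?_
    exact hasSum_of_eq ((hasSum_corr hb (x i) (x j)).mul_left (c i * c j * f (x i - x j)))
      (fun z => by ring) (by ring)
  exact this.nonneg fun z => hf ι x fun i => c i * b (x i - z)

/-- Expand the exponential; every term of the series is a nonnegative multiple of an iterated
product with B. -/
lemma IsPosDef.exp_corr_mul {b f : Lattice d → ℝ} (hb : Summable fun z => |b z|)
    (hf : IsPosDef f) {r : ℝ} (hr : 0 ≤ r) :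
    IsPosDef (fun x => Real.exp (r * corr b x) * f x) := by
  have hpow : ∀ n : ℕ, IsPosDef (fun x => (r * corr b x) ^ n * f x) := by
    intro n
    induction n with
    | zero => simpa using hf
    | succ n ih =>
      convert (ih.corr_mul hb).const_mul hr using 2
      ring
  refine isPosDef_of_hasSum (f := fun (n : ℕ) x => (n.factorial : ℝ)⁻¹ * ((r * corr b x) ^ n * f x))
    (fun n => (hpow n).const_mul (by positivity)) fun x => ?_
  have := (NormedSpace.expSeries_div_hasSum_exp (r * corr b x)).mul_right (f x)
  rw [← Real.exp_eq_exp_ℝ] at this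
  exact hasSum_of_eq this (fun n => by ring) rfl

/-- The operator `1 + τ ℒ` on bounded functions. -/
def stepAvg (a : Lattice d → ℝ) (τ : ℝ) (f : Lattice d → ℝ) (x : Lattice d) : ℝ :=
  ∑' z, stepKernel a τ z * f (x + z)

lemma summable_mul_of_bounded {k f : Lattice d → ℝ} (hk : Summable k) (hk0 : ∀ z, 0 ≤ k z) {M : ℝ}
    (hf : ∀ x, |f x| ≤ M) (g : Lattice d → Lattice d) : Summable fun z => k z * f (g z) := by
  refine Summable.of_norm_bounded (hk.mul_right M) fun z => ?_
  rw [norm_mul, Real.norm_eq_abs, Real.norm_eq_abs, abs_of_nonneg (hk0 z)]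
  exact mul_le_mul_of_nonneg_left (hf _) (hk0 z)

lemma abs_stepAvg_le {a : Lattice d → ℝ} (ha : IsJumpKernel a) {τ : ℝ} (h0 : 0 ≤ τ)
    (h1 : τ ≤ 1) {f : Lattice d → ℝ} {M : ℝ} (hf : ∀ x, |f x| ≤ M) (x : Lattice d) :
    |stepAvg a τ f x| ≤ M := by
  have hK := hasSum_stepKernel ha τ
  have := tsum_of_norm_bounded (hK.mul_right M) (f := fun z => stepKernel a τ z * f (x + z))
    fun z => by
      rw [norm_mul, Real.norm_eq_abs, Real.norm_eq_abs, abs_of_nonneg (stepKernel_nonneg ha h0 h1 z)]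
      exact mul_le_mul_of_nonneg_left (hf _) (stepKernel_nonneg ha h0 h1 z)
  simpa [stepAvg] using this

/-- Symmetry of `a` allows averaging the shifts by z and -z, so that f ± a * f becomes a nonnegative
combination of the functions in `IsPosDef.two_mul_add_shift`. -/
lemma hasSum_symm_shift {a : Lattice d → ℝ} (ha : IsJumpKernel a) {f : Lattice d → ℝ} {M : ℝ}
    (hf : ∀ x, |f x| ≤ M) (ε : ℝ) (x : Lattice d) :
    HasSum (fun z => a z / 2 * (2 * f x + ε * (f (x + z) + f (x - z))))
      (f x + ε * ∑' z, a z * f (x + z)) := by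
  have h1 := (summable_mul_of_bounded ha.hasSum_one.summable ha.nonneg hf (fun z => x + z)).hasSum
  have h2 : HasSum (fun z => a z * f (x - z)) (∑' z, a z * f (x + z)) := by
    rw [← (Equiv.neg (Lattice d)).hasSum_iff]
    simpa [Function.comp_def, ha.symm] using h1
  exact hasSum_of_eq ((ha.hasSum_one.mul_right (f x)).add (((h1.add h2).mul_left (ε / 2))))
    (fun z => by ring) (by ring)

lemma stepAvg_eq {a : Lattice d → ℝ} (ha : IsJumpKernel a) {f : Lattice d → ℝ} {M : ℝ}
    (hf : ∀ x, |f x| ≤ M) (τ : ℝ) (x : Lattice d) :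
    stepAvg a τ f x = (1 - τ) * f x + τ * ∑' z, a z * f (x + z) := by
  have h1 := (summable_mul_of_bounded ha.hasSum_one.summable ha.nonneg hf (fun z => x + z)).hasSum
  have h2 := (hasSum_ite_eq (0 : Lattice d) ((1 - τ) * f x)).add (h1.mul_left τ)
  rw [stepAvg, ← h2.tsum_eq]
  refine tsum_congr fun z => ?_
  by_cases hz : z = 0
  · simp [hz, stepKernel]; ring
  · simp [hz, stepKernel]; ring

/-- With A the averaging over `a`, 1 + τℒ = (1 - 2τ) + τ(1 + A); both summands preserve positive
definiteness once τ ≤ 1/2. -/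
lemma IsPosDef.stepAvg {a f : Lattice d → ℝ} (ha : IsJumpKernel a) {M : ℝ}
    (hf : ∀ x, |f x| ≤ M) (hpd : IsPosDef f) {τ : ℝ} (h0 : 0 ≤ τ) (h1 : τ ≤ 1 / 2) :
    IsPosDef (stepAvg a τ f) := by
  have h := isPosDef_of_hasSum
    (fun z => (hpd.two_mul_add_shift z (ε := 1) (by norm_num)).const_mul
      (r := a z / 2) (by have := ha.nonneg z; positivity))
    (hasSum_symm_shift ha hf 1)
  convert (hpd.const_mul (r := 1 - 2 * τ) (by linarith)).add (h.const_mul h0) using 1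
  ext x
  rw [stepAvg_eq ha hf]
  ring

/-- Here the operator is -τℒ = τ(1 - A), handled by the sign ε = -1. -/
lemma IsPosDef.sub_stepAvg {a f : Lattice d → ℝ} (ha : IsJumpKernel a) {M : ℝ}
    (hf : ∀ x, |f x| ≤ M) (hpd : IsPosDef f) {τ : ℝ} (h0 : 0 ≤ τ) :
    IsPosDef (fun x => f x - Anderson.stepAvg a τ f x) := by
  have h := isPosDef_of_hasSum
    (fun z => (hpd.two_mul_add_shift z (ε := -1) (by norm_num)).const_mul
      (r := a z / 2) (by have := ha.nonneg z; positivity))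
    (hasSum_symm_shift ha hf (-1))
  convert h.const_mul h0 using 1
  ext x
  rw [stepAvg_eq ha hf]
  ring

lemma stepAvg_sub {a f g : Lattice d → ℝ} (ha : IsJumpKernel a) {M N : ℝ}
    (hf : ∀ x, |f x| ≤ M) (hg : ∀ x, |g x| ≤ N) (τ : ℝ) (x : Lattice d) :
    stepAvg a τ (fun y => f y - g y) x = stepAvg a τ f x - stepAvg a τ g x := by
  have hfg : ∀ x, |f x - g x| ≤ M + N := fun x =>
    (abs_sub _ _).trans (add_le_add (hf x) (hg x))
  rw [stepAvg_eq ha hf, stepAvg_eq ha hg, stepAvg_eq ha hfg]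
  have h1 := summable_mul_of_bounded ha.hasSum_one.summable ha.nonneg hf (fun z => x + z)
  have h2 := summable_mul_of_bounded ha.hasSum_one.summable ha.nonneg hg (fun z => x + z)
  simp only [mul_sub, h1.tsum_sub h2]
  ring

lemma ofReal_stepAvg {a f : Lattice d → ℝ} (ha : IsJumpKernel a) {τ : ℝ} (h0 : 0 ≤ τ)
    (h1 : τ ≤ 1) {M : ℝ} (hf : ∀ x, |f x| ≤ M) (hf0 : ∀ x, 0 ≤ f x) (x : Lattice d) :
    avg (stepKernelE a τ) (fun y => ENNReal.ofReal (f y)) x =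
      ENNReal.ofReal (stepAvg a τ f x) := by
  have hK := stepKernel_nonneg ha h0 h1
  rw [stepAvg, ENNReal.ofReal_tsum_of_nonneg (fun z => mul_nonneg (hK z) (hf0 _))
    (summable_mul_of_bounded (hasSum_stepKernel ha τ).summable hK hf (fun z => x + z))]
  simp only [avg, stepKernelE]
  exact tsum_congr fun z => (ENNReal.ofReal_mul (hK z)).symm

lemma stepAvg_nonneg {a f : Lattice d → ℝ} (ha : IsJumpKernel a) {τ : ℝ} (h0 : 0 ≤ τ)
    (h1 : τ ≤ 1) (hf0 : ∀ x, 0 ≤ f x) (x : Lattice d) : 0 ≤ stepAvg a τ f x :=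
  tsum_nonneg fun z => mul_nonneg (stepKernel_nonneg ha h0 h1 z) (hf0 _)

/-- Let f and g be the iterates with one and two averagings S per step. Then Sf - SSg = S(f - g) +
(1 - S)Sg, so positive definiteness of g and of f - g propagates together. A positive definite
function is nonnegative at 0, which is where the comparison is read off. -/
lemma iterate_double_avg_le {a b : Lattice d → ℝ} (ha : IsJumpKernel a)
    (hb : Summable fun z => |b z|) {τ r : ℝ} (h0 : 0 ≤ τ) (h1 : τ ≤ 1 / 2) (hr : 0 ≤ r) (n : ℕ) :
    (fun F y => ENNReal.ofReal (Real.exp (r * corr b y)) *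
        avg (stepKernelE a τ) (avg (stepKernelE a τ) F) y)^[n] (fun _ => 1) 0 ≤
      transferIter (fun y => ENNReal.ofReal (Real.exp (r * corr b y))) (stepKernelE a τ) n 0 := by
  have h1' : τ ≤ 1 := by linarith
  set C := Real.exp (r * corr b 0) with hC
  have hw : ∀ x, Real.exp (r * corr b x) ≤ C := fun x =>
    Real.exp_le_exp.mpr (mul_le_mul_of_nonneg_left ((le_abs_self _).trans (abs_corr_le hb x)) hr)
  have hbd : ∀ {f : Lattice d → ℝ} {M : ℝ}, 0 ≤ M → (∀ x, |f x| ≤ M) →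
      ∀ x, |Real.exp (r * corr b x) * f x| ≤ C * M := by
    intro f M _ hf x
    rw [abs_mul, abs_of_pos (Real.exp_pos _)]
    exact mul_le_mul (hw x) (hf x) (abs_nonneg _) (Real.exp_pos _).le
  have key : ∀ n : ℕ, ∃ f g : Lattice d → ℝ, ∃ M : ℝ, 0 ≤ M ∧ (∀ x, |f x| ≤ M) ∧
      (∀ x, |g x| ≤ M) ∧ (∀ x, 0 ≤ f x) ∧ (∀ x, 0 ≤ g x) ∧ IsPosDef g ∧
      IsPosDef (fun x => f x - g x) ∧
      (transferIter (fun y => ENNReal.ofReal (Real.exp (r * corr b y))) (stepKernelE a τ) n =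
        fun x => ENNReal.ofReal (f x)) ∧
      ((fun F y => ENNReal.ofReal (Real.exp (r * corr b y)) *
        avg (stepKernelE a τ) (avg (stepKernelE a τ) F) y)^[n] (fun _ => 1) =
        fun x => ENNReal.ofReal (g x)) := by
    intro n
    induction n with
    | zero =>
      refine ⟨fun _ => 1, fun _ => 1, 1, by simp, by simp, by simp, by simp, by simp,
        isPosDef_one, ?_, ?_, ?_⟩
      · simpa using isPosDef_zero
      · simp [transferIter_zero]
      · simp
    | succ n ih =>
      obtain ⟨f, g, M, hM, hf, hg, hf0, hg0, hgp, hfgp, hfe, hge⟩ := ih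
      have hSf := abs_stepAvg_le ha h0 h1' hf
      have hSg := abs_stepAvg_le ha h0 h1' hg
      have hSSg := abs_stepAvg_le ha h0 h1' hSg
      have hSg0 := stepAvg_nonneg ha h0 h1' hg0
      have hgS := hgp.stepAvg ha hg h0 h1
      refine ⟨fun x => Real.exp (r * corr b x) * stepAvg a τ f x,
        fun x => Real.exp (r * corr b x) * stepAvg a τ (stepAvg a τ g) x, C * M,
        by positivity, hbd hM hSf, hbd hM hSSg, ?_, ?_, ?_, ?_, ?_, ?_⟩
      · exact fun x => mul_nonneg (Real.exp_pos _).le (stepAvg_nonneg ha h0 h1' hf0 x)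
      · exact fun x => mul_nonneg (Real.exp_pos _).le (stepAvg_nonneg ha h0 h1' hSg0 x)
      · exact (hgS.stepAvg ha hSg h0 h1).exp_corr_mul hb hr
      · have e1 := hfgp.stepAvg ha (fun x => (abs_sub _ _).trans (add_le_add (hf x) (hg x))) h0 h1
        convert (e1.add (hgS.sub_stepAvg ha hSg h0)).exp_corr_mul hb hr using 1
        ext x
        rw [stepAvg_sub ha hf hg]
        ring
      · rw [transferIter_succ, hfe]
        ext x
        rw [transfer, ofReal_stepAvg ha h0 h1' hf hf0, ENNReal.ofReal_mul (Real.exp_pos _).le]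
      · rw [Function.iterate_succ_apply', hge]
        ext x
        simp only
        rw [funext (ofReal_stepAvg ha h0 h1' hg hg0), ofReal_stepAvg ha h0 h1' hSg hSg0,
          ENNReal.ofReal_mul (Real.exp_pos _).le]
  obtain ⟨f, g, M, hM, hf, hg, hf0, hg0, hgp, hfgp, hfe, hge⟩ := key n
  rw [hfe, hge]
  exact ENNReal.ofReal_le_ofReal (by linarith [hfgp.apply_zero_nonneg])

/-- Comparison of the discrete `(p + 1)`-st moment with the second moment for the diffusivity
`ϰ / p` and the time step `p h`. -/
lemma discreteMoment_ge {a b : Lattice d → ℝ} (ha : IsJumpKernel a)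
    (hb : Summable fun z => |b z|) {ϰ h : ℝ} (hϰ : 0 ≤ ϰ) (hh : 0 ≤ h) (h1 : h * ϰ ≤ 1 / 2)
    {p : ℕ} (hp : p ≠ 0) (n : ℕ) :
    ENNReal.ofReal ((1 - h * ϰ) ^ p * Real.exp (h * (p * (p - 1) / 2 * corr b 0))) ^ n *
      discreteMoment a b (ϰ / p) 2 (p * h) n 0 ≤ discreteMoment a b ϰ (p + 1) h n 0 := by
  have hp' : (p : ℝ) ≠ 0 := by exact_mod_cast hp
  have e := discreteMoment_single_ge ha hb (ϰ := ϰ) (h := h) (by linarith) p n 0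
  rw [Pi.single_zero] at e
  refine le_trans ?_ e
  gcongr
  -- The time step p h and the diffusivity ϰ/p give the same one-step kernel as h and ϰ, and the
  -- weight exp(p h B) is the one seen by the free walker.
  rw [discreteMoment_two ha hb, show (p * h * (ϰ / p) : ℝ) = h * ϰ by field_simp]
  have e2 := iterate_double_avg_le ha hb (r := p * h) (mul_nonneg hh hϰ) h1 (by positivity) n
  simp only [show ∀ y, p * h * corr b y = h * (p * corr b y) from fun y => by ring] at e2 ⊢
  simpa using e2

/-! ### Gaussian series -/

section GaussianSeries

variable {Ω : Type*} {mΩ : MeasurableSpace Ω} {P : Measure Ω}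

lemma summable_of_tsum_enorm_ne_top {α : Type*} {f : α → ℝ} (h : ∑' i, ‖f i‖ₑ ≠ ∞) :
    Summable f := by
  refine Summable.of_norm ?_
  have := ENNReal.summable_toReal h
  simpa using this

lemma ae_summable_of_tsum_lintegral_ne_top {α : Type*} [Countable α] {f : α → Ω → ℝ}
    (hf : ∀ i, AEMeasurable (f i) P) (h : ∑' i, ∫⁻ ω, ‖f i ω‖ₑ ∂P ≠ ∞) :
    ∀ᵐ ω ∂P, Summable fun i => f i ω := by
  rw [← lintegral_tsum fun i => (hf i).enorm] at h
  filter_upwards [ae_lt_top' (AEMeasurable.tsum fun i => (hf i).enorm) h] with ω hω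
  exact summable_of_tsum_enorm_ne_top hω.ne

set_option linter.unusedSectionVars false

variable [IsProbabilityMeasure P] {α : Type*} [Countable α] {g : α → Ω → ℝ} {v : ℝ≥0}

lemma ae_summable_mul_gaussian (hlaw : ∀ z, HasLaw (g z) (gaussianReal 0 v) P) {c : α → ℝ}
    (hc : Summable fun z => |c z|) : ∀ᵐ ω ∂P, Summable fun z => c z * g z ω := by
  refine ae_summable_of_tsum_lintegral_ne_top
    (fun z => (hlaw z).aemeasurable.const_mul _) ?_
  have h1 : ∀ z, ∫⁻ ω, ‖c z * g z ω‖ₑ ∂P = ‖c z‖ₑ * ∫⁻ y, ‖y‖ₑ ∂(gaussianReal 0 v) := by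
    intro z
    simp only [enorm_mul]
    rw [lintegral_const_mul' _ _ enorm_ne_top,
      (hlaw z).lintegral_comp (f := fun y : ℝ => ‖y‖ₑ) (by fun_prop)]
  simp only [h1]
  rw [ENNReal.tsum_mul_right]
  refine ENNReal.mul_ne_top ?_ ?_
  · have : Summable fun z => ‖c z‖ := hc
    simpa only [ofReal_norm] using this.tsum_ofReal_ne_top
  · have := (memLp_id_gaussianReal (μ := 0) (v := v) 1).integrable (by simp)
    exact this.2.ne

/-- Compute characteristic functions of the finite partial sums by independence and pass to the
limit by dominated convergence; countability of the index set makes the filter of finite subsets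
countably generated. -/
lemma hasLaw_tsum_gaussian (hg : iIndepFun g P)
    (hlaw : ∀ z, HasLaw (g z) (gaussianReal 0 v) P) {c : α → ℝ} (hc : Summable fun z => |c z|)
    {σ : ℝ≥0} (hσ : HasSum (fun z => c z ^ 2) σ) :
    HasLaw (fun ω => ∑' z, c z * g z ω) (gaussianReal 0 (v * σ)) P := by
  have hsum := ae_summable_mul_gaussian hlaw hc
  have hm : AEMeasurable (fun ω => ∑' z, c z * g z ω) P :=
    AEMeasurable.tsum fun z => (hlaw z).aemeasurable.const_mul _
  refine ⟨hm, ?_⟩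
  have : IsProbabilityMeasure (P.map fun ω => ∑' z, c z * g z ω) :=
    Measure.isProbabilityMeasure_map hm
  refine Measure.ext_of_charFun (funext fun t => ?_)
  have h1 : Tendsto (fun s : Finset α => charFun (P.map fun ω => ∑ z ∈ s, c z * g z ω) t) atTop
      (𝓝 (charFun (P.map fun ω => ∑' z, c z * g z ω) t)) := by
    have e : ∀ f : Ω → ℝ, AEMeasurable f P →
        charFun (P.map f) t = ∫ ω, Complex.exp (t * f ω * Complex.I) ∂P := by
      intro f hf
      rw [charFun_apply_real, integral_map hf (by fun_prop)]
    rw [e _ hm]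
    have hms : ∀ s : Finset α, AEMeasurable (fun ω => ∑ z ∈ s, c z * g z ω) P := fun s =>
      Finset.aemeasurable_fun_sum s fun z _ => (hlaw z).aemeasurable.const_mul _
    simp only [e _ (hms _)]
    refine tendsto_integral_filter_of_dominated_convergence (fun _ => 1) ?_ ?_ ?_ ?_
    · refine Eventually.of_forall fun s => AEMeasurable.aestronglyMeasurable ?_
      have := hms s
      fun_prop
    · refine Eventually.of_forall fun s => Eventually.of_forall fun ω => ?_
      rw [← Complex.ofReal_mul, Complex.norm_exp_ofReal_mul_I]
    · exact integrable_const _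
    · filter_upwards [hsum] with ω hω
      have h2 : Tendsto (fun s : Finset α => ∑ z ∈ s, c z * g z ω) atTop
        (𝓝 (∑' z, c z * g z ω)) := hω.hasSum
      have h3 : Continuous fun y : ℝ => Complex.exp (t * y * Complex.I) := by fun_prop
      exact (h3.tendsto _).comp h2
  have h2 : ∀ s : Finset α, charFun (P.map fun ω => ∑ z ∈ s, c z * g z ω) t =
      Complex.exp (-((v * ∑ z ∈ s, c z ^ 2 : ℝ) * t ^ 2 / 2 : ℂ)) := by
    intro s
    have hind : iIndepFun (fun z ω => c z * g z ω) P :=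
      hg.comp (fun z y => c z * y) fun z => by fun_prop
    rw [iIndepFun.charFun_map_fun_finsetSum_eq_prod (X := fun z ω => c z * g z ω)
      (fun z _ => (hlaw z).aemeasurable.const_mul _) (hind.restrict _), Finset.prod_apply]
    have : ∀ z, charFun (P.map fun ω => c z * g z ω) t =
        Complex.exp (-((v * c z ^ 2 : ℝ) * t ^ 2 / 2 : ℂ)) := by
      intro z
      rw [(gaussianReal_const_mul (hlaw z) (c z)).map_eq, charFun_gaussianReal]
      congr 1
      simp
      left
      ring
    simp only [this]
    rw [← Complex.exp_sum]
    congr 1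
    push_cast
    rw [Finset.sum_neg_distrib, Finset.mul_sum, Finset.sum_mul, Finset.sum_div]
  refine tendsto_nhds_unique h1 ?_
  simp only [h2]
  rw [charFun_gaussianReal]
  have h3 : Tendsto (fun s : Finset α => ∑ z ∈ s, c z ^ 2) atTop (𝓝 (σ : ℝ)) := hσ
  have h4 : Continuous fun y : ℝ => Complex.exp (-((v * y : ℝ) * t ^ 2 / 2 : ℂ)) := by fun_prop
  have h5 : Complex.exp (t * (0 : ℝ) * Complex.I - ((v * σ : ℝ≥0) : ℝ) * t ^ 2 / 2) =
      Complex.exp (-((v * σ : ℝ) * t ^ 2 / 2 : ℂ)) := by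
    push_cast
    congr 1
    ring
  rw [h5]
  exact (h4.tendsto _).comp h3

end GaussianSeries

/-! ### Exponential moments of a centered Gaussian. -/

section GaussianMoments

set_option linter.unusedSectionVars false

variable {Ω : Type*} {mΩ : MeasurableSpace Ω} {P : Measure Ω} [IsProbabilityMeasure P]
  {X : Ω → ℝ} {v : ℝ≥0}

lemma lintegral_ofReal_exp_gaussian (hX : HasLaw X (gaussianReal 0 v) P) (c : ℝ) :
    ∫⁻ ω, ENNReal.ofReal (Real.exp (X ω - c)) ∂P = ENNReal.ofReal (Real.exp (v / 2 - c)) := by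
  have h := mgf_gaussianReal hX.map_eq 1
  have hint : Integrable (fun ω => Real.exp (1 * X ω)) P := by
    by_contra hn
    rw [mgf_undef hn] at h
    exact (Real.exp_pos _).ne h
  simp only [mgf, one_mul] at h hint
  rw [← ofReal_integral_eq_lintegral_ofReal]
  · simp only [Real.exp_sub, integral_div, h]
    simp
  · simp only [Real.exp_sub]
    exact hint.div_const _
  · exact Eventually.of_forall fun ω => (Real.exp_pos _).le

lemma memLp_gaussian (hX : HasLaw X (gaussianReal 0 v) P) (p : ℝ≥0) : MemLp X p P := by
  have := memLp_id_gaussianReal (μ := 0) (v := v) p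
  rw [← hX.map_eq] at this
  simpa using (memLp_map_measure_iff (by fun_prop) hX.aemeasurable).mp this

lemma integral_gaussian (hX : HasLaw X (gaussianReal 0 v) P) : ∫ ω, X ω ∂P = 0 := by
  rw [hX.integral_eq, integral_id_gaussianReal]

lemma integral_sq_gaussian (hX : HasLaw X (gaussianReal 0 v) P) : ∫ ω, X ω ^ 2 ∂P = v := by
  have h1 := hX.variance_eq
  rw [variance_id_gaussianReal, variance_eq_integral hX.aemeasurable] at h1
  simpa [integral_gaussian hX] using h1

lemma integrable_exp_gaussian (hX : HasLaw X (gaussianReal 0 v) P) (t : ℝ) :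
    Integrable (fun ω => Real.exp (t * X ω)) P := by
  have := integrable_exp_mul_gaussianReal (μ := 0) (v := v) t
  rw [← hX.map_eq] at this
  exact (integrable_map_measure (by fun_prop) hX.aemeasurable).mp this

/-- This is the derivative at 1 of the moment generating function exp(v t²/2). -/
lemma integral_mul_exp_gaussian (hX : HasLaw X (gaussianReal 0 v) P) :
    Integrable (fun ω => X ω * Real.exp (X ω)) P ∧
      ∫ ω, X ω * Real.exp (X ω) ∂P = v * Real.exp (v / 2) := by
  have huniv : integrableExpSet X P = Set.univ := by
    ext t; simpa [integrableExpSet] using integrable_exp_gaussian hX t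
  have hint : (1 : ℝ) ∈ interior (integrableExpSet X P) := by simp [huniv]
  constructor
  · simpa using integrable_pow_mul_exp_of_mem_interior_integrableExpSet hint 1
  · have h1 := deriv_mgf hint
    have h2 : mgf X P = fun t => Real.exp (v * t ^ 2 / 2) := by
      ext t; rw [mgf_gaussianReal hX.map_eq]; simp
    have h3 : HasDerivAt (fun t : ℝ => Real.exp (v * t ^ 2 / 2))
        (Real.exp (v * 1 ^ 2 / 2) * (v * (2 * 1 ^ 1) / 2)) 1 := by
      have := ((((hasDerivAt_pow 2 (1 : ℝ))).const_mul (v : ℝ)).div_const 2).exp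
      simpa using this
    rw [h2, h3.deriv] at h1
    simp only [one_mul] at h1
    rw [← h1]
    simp
    ring

/-- The second moment of `exp(X - v/2) - 1 - X` for a centered Gaussian `X` of variance `v ≤ 1`. -/
lemma integral_exp_remainder_sq (hX : HasLaw X (gaussianReal 0 v) P) (hv : v ≤ 1) :
    Integrable (fun ω => (Real.exp (X ω - v / 2) - 1 - X ω) ^ 2) P ∧
      ∫ ω, (Real.exp (X ω - v / 2) - 1 - X ω) ^ 2 ∂P ≤ (v : ℝ) ^ 2 := by
  obtain ⟨i1, e1⟩ := integral_mul_exp_gaussian hX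
  have i2 := integrable_exp_gaussian hX 2
  have i3 := integrable_exp_gaussian hX 1
  have i4 : Integrable X P := (memLp_gaussian hX 1).integrable (by simp)
  have i5 : Integrable (fun ω => X ω ^ 2) P := (memLp_gaussian hX 2).integrable_sq
  have e2 := mgf_gaussianReal hX.map_eq 2
  have e3 := mgf_gaussianReal hX.map_eq 1
  have e4 := integral_gaussian hX
  have e5 := integral_sq_gaussian hX
  simp only [mgf, one_mul] at e2 e3 i3
  have key : ∀ ω, (Real.exp (X ω - v / 2) - 1 - X ω) ^ 2 =
      Real.exp (-v) * Real.exp (2 * X ω) + 1 + X ω ^ 2 -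
        2 * Real.exp (-v / 2) * Real.exp (X ω) -
        2 * Real.exp (-v / 2) * (X ω * Real.exp (X ω)) + 2 * X ω := by
    intro ω
    have h1 : Real.exp (X ω - v / 2) = Real.exp (-v / 2) * Real.exp (X ω) := by
      rw [← Real.exp_add]; ring_nf
    have h2 : Real.exp (-v) * Real.exp (2 * X ω) =
        (Real.exp (-v / 2) * Real.exp (X ω)) ^ 2 := by
      rw [← Real.exp_add, ← Real.exp_add, ← Real.exp_nat_mul]; push_cast; ring_nf
    rw [h1, h2]; ring
  have j1 : Integrable (fun ω => Real.exp (-v) * Real.exp (2 * X ω) + 1) P :=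
    (i2.const_mul _).add (integrable_const _)
  have j2 := j1.add i5
  have j3 := j2.sub (i3.const_mul (2 * Real.exp (-v / 2)))
  have j4 := j3.sub (i1.const_mul (2 * Real.exp (-v / 2)))
  have j5 := j4.add (i4.const_mul 2)
  -- The exact value is e^v - 1 - v, which is at most v² for v ≤ 1. The second-order size is what
  -- makes the remainder negligible beside the noise.
  have e : ∫ ω, (Real.exp (X ω - v / 2) - 1 - X ω) ^ 2 ∂P = Real.exp v - 1 - v := by
    have e0 := integral_add' j4 (i4.const_mul 2)
    rw [integral_sub' j3 (i1.const_mul _), integral_sub' j2 (i3.const_mul _),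
      integral_add' j1 i5, integral_add (i2.const_mul _) (integrable_const _)] at e0
    simp only [key]
    refine e0.trans ?_
    simp only [integral_const_mul, e1, e2, e3, e4, e5, integral_const, probReal_univ]
    have h1 : Real.exp (-v) * Real.exp (0 * 2 + v * 2 ^ 2 / 2) = Real.exp v := by
      rw [← Real.exp_add]; ring_nf
    have h2 : Real.exp (-v / 2) * Real.exp (v / 2) = 1 := by
      rw [← Real.exp_add]; ring_nf; simp
    have h3 : Real.exp (0 * 1 + v * 1 ^ 2 / 2) = Real.exp (v / 2) := by ring_nf
    rw [h1, h3]
    simp only [smul_eq_mul]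
    linear_combination (-2 - 2 * (v : ℝ)) * h2
  refine ⟨by simp only [key]; exact j5, ?_⟩
  rw [e]
  have hv' : |(v : ℝ)| ≤ 1 := by rw [abs_of_nonneg (NNReal.coe_nonneg v)]; exact_mod_cast hv
  exact (le_abs_self _).trans (Real.abs_exp_sub_one_sub_id_le hv')

end GaussianMoments

/-! ### The noise increments -/

section Noise

set_option linter.unusedSectionVars false

variable {Ω : Type*} {mΩ : MeasurableSpace Ω} {d : ℕ} {P : Measure Ω} [IsProbabilityMeasure P]
  {ℱ : Filtration ℝ≥0 mΩ} {w : Lattice d → ℝ≥0 → Ω → ℝ} {b : Lattice d → ℝ}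

/-- The increment of the correlated Wiener process over `[s, t]`. -/
def noise (b : Lattice d → ℝ) (w : Lattice d → ℝ≥0 → Ω → ℝ) (s t : ℝ≥0) (x : Lattice d)
    (ω : Ω) : ℝ :=
  ∑' z, b (x - z) * (w z t ω - w z s ω)

lemma summable_abs_shift (hb : Summable fun z => |b z|) (x : Lattice d) :
    Summable fun z => |b (x - z)| :=
  (Equiv.subLeft x).summable_iff.mpr hb

lemma IsBrownianFamily.hasLaw_increment (hw : IsBrownianFamily P ℱ w) {s t : ℝ≥0} (hst : s ≤ t)
    (z : Lattice d) : HasLaw (fun ω => w z t ω - w z s ω) (gaussianReal 0 (t - s)) P := by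
  have h := (hw.isBrownian z).toIsPreBrownianReal.hasLaw_sub t s
  have e : nndist t.1 s.1 = t - s := by
    ext
    rw [coe_nndist, Real.dist_eq, NNReal.coe_sub hst]
    exact abs_of_nonneg (sub_nonneg.mpr (by exact_mod_cast hst))
  rwa [e] at h

lemma IsBrownianFamily.iIndep_increment (hw : IsBrownianFamily P ℱ w) (s t : ℝ≥0) :
    iIndepFun (fun z ω => w z t ω - w z s ω) P :=
  hw.iIndep.comp (fun _ f => f t - f s) fun _ => by fun_prop

lemma ae_summable_noise (hw : IsBrownianFamily P ℱ w) (hb : Summable fun z => |b z|) {s t : ℝ≥0}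
    (hst : s ≤ t) (x : Lattice d) :
    ∀ᵐ ω ∂P, Summable fun z => b (x - z) * (w z t ω - w z s ω) :=
  ae_summable_mul_gaussian (hw.hasLaw_increment hst) (summable_abs_shift hb x)

lemma ae_summable_corrWiener (hw : IsBrownianFamily P ℱ w) (hb : Summable fun z => |b z|)
    (t : ℝ≥0) (x : Lattice d) : ∀ᵐ ω ∂P, Summable fun z => b (x - z) * w z t ω :=
  ae_summable_mul_gaussian (fun z => (hw.isBrownian z).toIsPreBrownianReal.hasLaw_eval t)
    (summable_abs_shift hb x)

/-- Splitting the series requires both series to converge, hence only an almost sure identity. -/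
lemma ae_corrWiener_sub (hw : IsBrownianFamily P ℱ w) (hb : Summable fun z => |b z|)
    (s t : ℝ≥0) (x : Lattice d) :
    ∀ᵐ ω ∂P, corrWiener b w x t ω - corrWiener b w x s ω = noise b w s t x ω := by
  filter_upwards [ae_summable_corrWiener hw hb t x, ae_summable_corrWiener hw hb s x] with ω h1 h2
  simp only [corrWiener, noise, mul_sub, h1.tsum_sub h2]

lemma measurable_noise_filtration (hw : IsBrownianFamily P ℱ w) {s t : ℝ≥0} (hst : s ≤ t)
    (x : Lattice d) : Measurable[ℱ t] (noise b w s t x) := by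
  have h : ∀ z, Measurable[ℱ t] fun ω => b (x - z) * (w z t ω - w z s ω) := fun z =>
    ((hw.adapted z t).sub ((hw.adapted z s).mono (ℱ.mono hst) le_rfl)).const_mul _
  exact @Measurable.tsum _ _ _ (ℱ t) _ _ _ _ _ _ _ _ _ _ _ _ h

/-- The `σ`-algebra generated by the noise increments over `[s, t]`. -/
@[reducible] def noiseSigma (b : Lattice d → ℝ) (w : Lattice d → ℝ≥0 → Ω → ℝ) (s t : ℝ≥0) :
    MeasurableSpace Ω :=
  MeasurableSpace.comap (fun ω x => noise b w s t x ω) MeasurableSpace.pi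

lemma measurable_noise_noiseSigma (b : Lattice d → ℝ) (w : Lattice d → ℝ≥0 → Ω → ℝ) (s t : ℝ≥0)
    (x : Lattice d) : Measurable[noiseSigma b w s t] (noise b w s t x) :=
  (measurable_pi_apply x).comp (comap_measurable fun ω x => noise b w s t x ω)

lemma noiseSigma_le (hw : IsBrownianFamily P ℱ w) {s t : ℝ≥0} (hst : s ≤ t) :
    noiseSigma b w s t ≤ mΩ := by
  rw [noiseSigma, ← measurable_iff_comap_le]
  exact measurable_pi_lambda _ fun x =>
    (measurable_noise_filtration hw hst x).mono (ℱ.le _) le_rfl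

/-- `noise` is everywhere, and not only almost surely, a measurable function of the increments after
`s`, so independence is inherited without completing the filtration. -/
lemma indep_noise (hw : IsBrownianFamily P ℱ w) {s t : ℝ≥0} (hst : s ≤ t) :
    Indep (noiseSigma b w s t) (ℱ s) P := by
  refine indep_of_indep_of_le_left (hw.indep_increments s t hst) ?_
  have : (fun ω x => noise b w s t x ω) =
      (fun f x => ∑' z, b (x - z) * f z : (Lattice d → ℝ) → Lattice d → ℝ) ∘
        (fun ω z => w z t ω - w z s ω) := rfl
  rw [noiseSigma, this, ← MeasurableSpace.comap_comp]
  refine MeasurableSpace.comap_mono ?_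
  rw [← measurable_iff_comap_le]
  exact measurable_pi_lambda _ fun x => Measurable.tsum fun z =>
    (measurable_pi_apply z).const_mul _

/-- The double sum equals ∑_z (∑_i b(x_i - z))², the variance of ∑_i W(1, x_i). -/
lemma sum_corr_nonneg (hb : Summable fun z => |b z|) {ι : Type*} [Fintype ι]
    (x : ι → Lattice d) : 0 ≤ ∑ i, ∑ j, corr b (x i - x j) ∧
    HasSum (fun z => (∑ i, b (x i - z)) ^ 2) (∑ i, ∑ j, corr b (x i - x j)) := by
  have h : HasSum (fun z => (∑ i, b (x i - z)) ^ 2) (∑ i, ∑ j, corr b (x i - x j)) := by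
    simp only [sq, Finset.sum_mul_sum]
    exact hasSum_sum fun i _ => hasSum_sum fun j _ => hasSum_corr hb _ _
  exact ⟨h.nonneg fun z => sq_nonneg _, h⟩

/-- Interchanging the sums gives a single Gaussian series with coefficients ∑_i b(x_i - z). -/
lemma hasLaw_sum_noise (hw : IsBrownianFamily P ℱ w) (hb : Summable fun z => |b z|) {s t : ℝ≥0}
    (hst : s ≤ t) {ι : Type*} [Fintype ι] (x : ι → Lattice d) :
    HasLaw (fun ω => ∑ i, noise b w s t (x i) ω)
      (gaussianReal 0 ((t - s) * (∑ i, ∑ j, corr b (x i - x j)).toNNReal)) P := by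
  obtain ⟨h0, h1⟩ := sum_corr_nonneg hb x
  have hc : Summable fun z => |∑ i, b (x i - z)| := by
    refine Summable.of_nonneg_of_le (fun _ => abs_nonneg _)
      (fun z => Finset.abs_sum_le_sum_abs _ _) ?_
    exact summable_sum fun i _ => summable_abs_shift hb (x i)
  have hσ : HasSum (fun z => (∑ i, b (x i - z)) ^ 2)
      ((∑ i, ∑ j, corr b (x i - x j)).toNNReal : ℝ) := by
    rwa [Real.coe_toNNReal _ h0]
  refine (hasLaw_tsum_gaussian (hw.iIndep_increment s t) (hw.hasLaw_increment hst) hc hσ).congr ?_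
  have : ∀ᵐ ω ∂P, ∀ i, Summable fun z => b (x i - z) * (w z t ω - w z s ω) :=
    ae_all_iff.mpr fun i => ae_summable_noise hw hb hst (x i)
  filter_upwards [this] with ω hω
  simp only [noise, Finset.sum_mul]
  rw [Summable.tsum_finsetSum fun i _ => hω i]

lemma hasLaw_noise (hw : IsBrownianFamily P ℱ w) (hb : Summable fun z => |b z|) {s t : ℝ≥0}
    (hst : s ≤ t) (x : Lattice d) :
    HasLaw (noise b w s t x) (gaussianReal 0 ((t - s) * (corr b 0).toNNReal)) P := by
  simpa using hasLaw_sum_noise hw hb hst (fun _ : Unit => x)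

/-- The exponent is Gaussian with variance h ∑_{i,j} B(x_i - x_j). Half of it, less the compensators
p h B(0)/2, is h ∑_{i<j} B(x_i - x_j): the compensation removes exactly the diagonal. -/
lemma lintegral_prod_exp_noise (hw : IsBrownianFamily P ℱ w) (hb : Summable fun z => |b z|)
    {s t : ℝ≥0} (hst : s ≤ t) {p : ℕ} (x : Fin p → Lattice d) :
    ∫⁻ ω, ∏ i, ENNReal.ofReal
        (Real.exp (noise b w s t (x i) ω - (t - s : ℝ≥0) * corr b 0 / 2)) ∂P =
      pointWeight b p (t - s : ℝ≥0) x := by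
  have h := lintegral_ofReal_exp_gaussian (hasLaw_sum_noise hw hb hst x)
    (p * ((t - s : ℝ≥0) * corr b 0 / 2))
  rw [pointWeight]
  convert h using 2
  · ext ω
    rw [← ENNReal.ofReal_prod_of_nonneg fun i _ => (Real.exp_pos _).le, ← Real.exp_sum]
    simp
  · congr 1
    rw [NNReal.coe_mul, Real.coe_toNNReal _ (sum_corr_nonneg hb x).1, potential]
    ring

end Noise

/-! ### The positive Euler scheme -/

section Scheme

set_option linter.unusedSectionVars false

variable {Ω : Type*} {mΩ : MeasurableSpace Ω} {d : ℕ} {P : Measure Ω} [IsProbabilityMeasure P]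
  {ℱ : Filtration ℝ≥0 mΩ} {w : Lattice d → ℝ≥0 → Ω → ℝ} {a b : Lattice d → ℝ}

/-- The grid point `k h`. -/
def grid (h : ℝ≥0) (k : ℕ) : ℝ≥0 := k * h

lemma grid_mono (h : ℝ≥0) : Monotone (grid h) := fun i j hij => by
  unfold grid
  gcongr

lemma grid_succ_sub (h : ℝ≥0) (k : ℕ) : grid h (k + 1) - grid h k = h := by
  simp [grid, add_mul]

/-- The Euler scheme `U_{k+1}(x) = exp(ΔW_k(x) - h B(0) / 2) ((1 + h ϰ ℒ) U_k)(x)`. -/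
def scheme (a b : Lattice d → ℝ) (ϰ : ℝ) (w : Lattice d → ℝ≥0 → Ω → ℝ) (h : ℝ≥0) :
    ℕ → Lattice d → Ω → ℝ≥0∞
  | 0 => fun _ _ => 1
  | k + 1 => fun x ω =>
      ENNReal.ofReal (Real.exp (noise b w (grid h k) (grid h (k + 1)) x ω - h * corr b 0 / 2)) *
        avg (stepKernelE a (h * ϰ)) (fun y => scheme a b ϰ w h k y ω) x

lemma measurable_avg {m : MeasurableSpace Ω} (K : Lattice d → ℝ≥0∞) {F : Lattice d → Ω → ℝ≥0∞}
    (hF : ∀ x, Measurable (F x)) (x : Lattice d) : Measurable fun ω => avg K (fun y => F y ω) x :=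
  Measurable.tsum fun _ => (hF _).const_mul _

lemma measurable_scheme_filtration (hw : IsBrownianFamily P ℱ w) (ϰ : ℝ) (h : ℝ≥0) (k : ℕ)
    (x : Lattice d) : Measurable[ℱ (grid h k)] (scheme a b ϰ w h k x) := by
  induction k generalizing x with
  | zero => exact measurable_const
  | succ k ih =>
    have h1 := measurable_noise_filtration (b := b) hw (grid_mono h k.le_succ) x
    have h2 : Measurable[ℱ (grid h (k + 1))] fun ω =>
        avg (stepKernelE a (h * ϰ)) (fun y => scheme a b ϰ w h k y ω) x :=
      measurable_avg _ (fun y => (ih y).mono (ℱ.mono (grid_mono h k.le_succ)) le_rfl) x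
    exact ((h1.sub_const _).exp.ennreal_ofReal).mul h2

lemma measurable_scheme (hw : IsBrownianFamily P ℱ w) (ϰ : ℝ) (h : ℝ≥0) (k : ℕ)
    (x : Lattice d) : Measurable (scheme a b ϰ w h k x) :=
  (measurable_scheme_filtration hw ϰ h k x).mono (ℱ.le _) le_rfl

/-- The new noise is independent of ℱ at time k h, so the expectation factors: the exponentials give
`pointWeight`, and the product of averages is an average over tuples for `powKernel`. Thus the
moments obey a closed linear recursion. -/
lemma lintegral_prod_scheme (hw : IsBrownianFamily P ℱ w) (hb : Summable fun z => |b z|) (ϰ : ℝ)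
    (h : ℝ≥0) (k : ℕ) {p : ℕ} (x : Fin p → Lattice d) :
    ∫⁻ ω, ∏ i, scheme a b ϰ w h k (x i) ω ∂P = discreteMoment a b ϰ p h k x := by
  induction k generalizing x with
  | zero => simp [scheme, discreteMoment, transferIter_zero]
  | succ k ih =>
    have hle := grid_mono h k.le_succ
    rw [discreteMoment, transferIter_succ, transfer, ← discreteMoment]
    have hm : ∀ x, Measurable[ℱ (grid h k)] fun ω =>
        avg (stepKernelE a (h * ϰ)) (fun y => scheme a b ϰ w h k y ω) x := fun x =>
      measurable_avg _ (fun y => measurable_scheme_filtration hw ϰ h k y) x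
    have hm2 : Measurable[ℱ (grid h k)] fun ω =>
        ∏ i, avg (stepKernelE a (h * ϰ)) (fun y => scheme a b ϰ w h k y ω) (x i) :=
      Finset.measurable_fun_prod _ fun i _ => hm (x i)
    have hn : Measurable[noiseSigma b w (grid h k) (grid h (k + 1))] fun ω =>
        ∏ i, ENNReal.ofReal
          (Real.exp (noise b w (grid h k) (grid h (k + 1)) (x i) ω - h * corr b 0 / 2)) :=
      Finset.measurable_fun_prod _ fun i _ =>
        (((measurable_noise_noiseSigma b w _ _ (x i)).sub_const _).exp).ennreal_ofReal
    simp only [scheme, Finset.prod_mul_distrib]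
    rw [lintegral_mul_eq_lintegral_mul_lintegral_of_independent_measurableSpace
      (noiseSigma_le hw hle) (ℱ.le _) (indep_noise hw hle) hn hm2]
    congr 1
    · have := lintegral_prod_exp_noise hw hb hle x
      rwa [grid_succ_sub] at this
    · simp only [avg]
      simp only [ennreal_prod_tsum, Finset.prod_mul_distrib]
      rw [lintegral_tsum]
      · refine tsum_congr fun z => ?_
        rw [lintegral_const_mul _
          (Finset.measurable_fun_prod _ fun i _ => measurable_scheme hw ϰ h k _)]
        rw [← ih (x + z)]
        rfl
      · exact fun z => ((Finset.measurable_fun_prod _ fun i _ =>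
          measurable_scheme hw ϰ h k _).const_mul _).aemeasurable

/-- The potential depends only on differences, so the diagonal moment does not depend on the site.
-/
lemma lintegral_scheme_pow (hw : IsBrownianFamily P ℱ w) (hb : Summable fun z => |b z|) (ϰ : ℝ)
    (h : ℝ≥0) (k p : ℕ) (x : Lattice d) :
    ∫⁻ ω, scheme a b ϰ w h k x ω ^ p ∂P = discreteMoment a b ϰ p h k 0 := by
  have h1 := lintegral_prod_scheme (a := a) hw hb ϰ h k (fun _ : Fin p => x)
  have h2 : discreteMoment a b ϰ p h k (fun _ : Fin p => x) = discreteMoment a b ϰ p h k 0 := by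
    have := transferIter_add_right (E := pointWeight b p h)
      (K := powKernel (stepKernelE a (h * ϰ)) p) (c := fun _ => x)
      (fun y => by rw [pointWeight, potential_add_const, pointWeight]) k 0
    simpa [discreteMoment] using this
  rw [← h2, ← h1]
  simp

/-- Hölder with `p` exponents equal to `p` bounds the mixed moment by a geometric mean of diagonal
moments, all of which coincide. -/
lemma discreteMoment_le_zero (hw : IsBrownianFamily P ℱ w) (hb : Summable fun z => |b z|) (ϰ : ℝ)
    (h : ℝ≥0) (k : ℕ) {p : ℕ} (hp : p ≠ 0) (x : Fin p → Lattice d) :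
    discreteMoment a b ϰ p h k x ≤ discreteMoment a b ϰ p h k 0 := by
  have hp' : (p : ℝ) ≠ 0 := by exact_mod_cast hp
  rw [← lintegral_prod_scheme hw hb]
  have := ENNReal.lintegral_prod_norm_pow_le (μ := P) (Finset.univ : Finset (Fin p))
    (f := fun i ω => scheme a b ϰ w h k (x i) ω ^ p) (p := fun _ => (p : ℝ)⁻¹)
    (fun i _ => ((measurable_scheme hw ϰ h k _).pow_const p).aemeasurable)
    (by simp [hp']) (fun i _ => by positivity)
  simp only [lintegral_scheme_pow hw hb, Finset.prod_const, Finset.card_univ,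
    Fintype.card_fin] at this
  simp only [← ENNReal.rpow_natCast, ← ENNReal.rpow_mul] at this
  simpa [hp'] using this

lemma discreteMoment_add_le (hw : IsBrownianFamily P ℱ w) (hb : Summable fun z => |b z|) (ϰ : ℝ)
    (h : ℝ≥0) {p : ℕ} (hp : p ≠ 0) (m n : ℕ) :
    discreteMoment a b ϰ p h (m + n) 0 ≤
      discreteMoment a b ϰ p h m 0 * discreteMoment a b ϰ p h n 0 := by
  rw [mul_comm]
  exact transferIter_add_le (discreteMoment_le_zero hw hb ϰ h n hp) m 0

end Scheme

/-! ### A priori exponential bounds for the discrete moments. -/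

section Bounds

variable {d : ℕ} {a b : Lattice d → ℝ}

/-- A bound for the potential of the `p`-particle problem. -/
def momentRate (b : Lattice d → ℝ) (p : ℕ) : ℝ := (p * p + p) / 2 * corr b 0

lemma momentRate_nonneg (b : Lattice d → ℝ) (p : ℕ) : 0 ≤ momentRate b p :=
  mul_nonneg (by positivity) (corr_zero_nonneg b)

lemma discreteMoment_le (ha : IsJumpKernel a) (hb : Summable fun z => |b z|) {ϰ h : ℝ}
    (hϰ : 0 ≤ ϰ) (hh : 0 ≤ h) (h1 : h * ϰ ≤ 1) (p n : ℕ) (x : Fin p → Lattice d) :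
    discreteMoment a b ϰ p h n x ≤ ENNReal.ofReal (Real.exp (n * h * momentRate b p)) := by
  refine (transferIter_le_pow
    (tsum_powKernel (tsum_stepKernelE ha (mul_nonneg hh hϰ) h1) p)
    (c := ENNReal.ofReal (Real.exp (h * momentRate b p))) (fun y => ?_) n x).trans_eq ?_
  · refine ENNReal.ofReal_le_ofReal (Real.exp_le_exp.mpr ?_)
    exact mul_le_mul_of_nonneg_left ((le_abs_self _).trans (abs_potential_le hb y)) hh
  · rw [← ENNReal.ofReal_pow (Real.exp_pos _).le, ← Real.exp_nat_mul, mul_assoc]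

lemma le_discreteMoment (ha : IsJumpKernel a) (hb : Summable fun z => |b z|) {ϰ h : ℝ}
    (hϰ : 0 ≤ ϰ) (hh : 0 ≤ h) (h1 : h * ϰ ≤ 1) (p n : ℕ) (x : Fin p → Lattice d) :
    ENNReal.ofReal (Real.exp (-(n * h * momentRate b p))) ≤ discreteMoment a b ϰ p h n x := by
  refine le_trans (le_of_eq ?_) (pow_le_transferIter
    (tsum_powKernel (tsum_stepKernelE ha (mul_nonneg hh hϰ) h1) p)
    (c := ENNReal.ofReal (Real.exp (-(h * momentRate b p)))) (fun y => ?_) n x)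
  · rw [← ENNReal.ofReal_pow (Real.exp_pos _).le, ← Real.exp_nat_mul]
    congr 2
    ring
  · refine ENNReal.ofReal_le_ofReal (Real.exp_le_exp.mpr ?_)
    rw [← mul_neg]
    refine mul_le_mul_of_nonneg_left ?_ hh
    have := abs_potential_le hb y
    rw [abs_le] at this
    exact this.1

end Bounds

/-! ### Weighted second moments -/

section Energy

set_option linter.unusedSectionVars false

lemma sq_lintegral_le {α : Type*} {mα : MeasurableSpace α} (ρ : Measure α) {g : α → ℝ≥0∞}
    (hg : AEMeasurable g ρ) : (∫⁻ x, g x ∂ρ) ^ 2 ≤ ρ Set.univ * ∫⁻ x, g x ^ 2 ∂ρ := by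
  have h := ENNReal.lintegral_mul_le_Lp_mul_Lq ρ Real.HolderConjugate.two_two
    (aemeasurable_const (b := (1 : ℝ≥0∞))) hg
  simp only [Pi.mul_apply, one_mul, ENNReal.one_rpow, lintegral_const] at h
  calc (∫⁻ x, g x ∂ρ) ^ 2 ≤ _ := pow_le_pow_left₀ (zero_le) h 2
    _ = _ := by
      simp only [mul_pow, ← ENNReal.rpow_mul_natCast]
      norm_num

variable {d : ℕ} {Ω : Type*} {mΩ : MeasurableSpace Ω} {P : Measure Ω} {a μ : Lattice d → ℝ}

lemma sq_avg_le {K : Lattice d → ℝ≥0∞} (hK : ∑' z, K z = 1) (F : Lattice d → ℝ≥0∞)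
    (x : Lattice d) : avg K F x ^ 2 ≤ avg K (fun y => F y ^ 2) x := by
  -- Cauchy–Schwarz for the probability measure on the lattice with density `K`.
  have h := sq_lintegral_le (Measure.count.withDensity K) (g := fun z => F (x + z))
    (Measurable.of_discrete.aemeasurable)
  rw [lintegral_withDensity_eq_lintegral_mul _ Measurable.of_discrete Measurable.of_discrete,
    lintegral_withDensity_eq_lintegral_mul _ Measurable.of_discrete Measurable.of_discrete,
    withDensity_apply _ MeasurableSet.univ, Measure.restrict_univ, lintegral_count,
    lintegral_count, lintegral_count, hK, one_mul] at h
  exact h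

/-- The weighted second moment `∑_x μ(x) ⟨f(x)²⟩`. -/
def energy (μ : Lattice d → ℝ) (P : Measure Ω) (f : Lattice d → Ω → ℝ) : ℝ≥0∞ :=
  ∑' x, ENNReal.ofReal (μ x) * ∫⁻ ω, ‖f x ω‖ₑ ^ 2 ∂P

lemma energy_congr {f g : Lattice d → Ω → ℝ} (h : ∀ x, f x =ᵐ[P] g x) :
    energy μ P f = energy μ P g := by
  refine tsum_congr fun x => ?_
  congr 1
  refine lintegral_congr_ae ?_
  filter_upwards [h x] with ω hω
  rw [hω]

lemma energy_le_of_le {f g : Lattice d → Ω → ℝ} {c : ℝ≥0∞}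
    (h : ∀ x, ∫⁻ ω, ‖f x ω‖ₑ ^ 2 ∂P ≤ c * ∫⁻ ω, ‖g x ω‖ₑ ^ 2 ∂P) :
    energy μ P f ≤ c * energy μ P g := by
  rw [energy, energy, ← ENNReal.tsum_mul_left]
  refine ENNReal.tsum_le_tsum fun x => ?_
  rw [mul_left_comm]
  gcongr
  exact h x

lemma energy_sub_comm (f g : Lattice d → Ω → ℝ) :
    energy μ P (fun x ω => f x ω - g x ω) = energy μ P (fun x ω => g x ω - f x ω) := by
  simp only [energy, enorm_sub_rev]

/-- Young's inequality for the cross term. The parameter is 1 where constants do not matter, and the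
time step where the first term must keep a coefficient 1 + O(h). -/
lemma enorm_add_sq_le (s : ℝ≥0) (hs : s ≠ 0) (y z : ℝ) :
    ‖y + z‖ₑ ^ 2 ≤ (1 + s : ℝ≥0) * ‖y‖ₑ ^ 2 + (1 + s⁻¹ : ℝ≥0) * ‖z‖ₑ ^ 2 := by
  have hs' : 0 < (s : ℝ) := by positivity
  have h : ‖y + z‖₊ ^ 2 ≤ (1 + s) * ‖y‖₊ ^ 2 + (1 + s⁻¹) * ‖z‖₊ ^ 2 := by
    rw [← NNReal.coe_le_coe]
    push_cast
    simp only [Real.norm_eq_abs, sq_abs]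
    have : 0 ≤ (s : ℝ)⁻¹ * (s * y - z) ^ 2 := by positivity
    have e : (s : ℝ)⁻¹ * (s * y - z) ^ 2 = s * y ^ 2 - 2 * y * z + (s : ℝ)⁻¹ * z ^ 2 := by
      field_simp
      ring
    nlinarith
  simp only [enorm_eq_nnnorm]
  exact_mod_cast h

lemma energy_add_le (s : ℝ≥0) (hs : s ≠ 0) {f : Lattice d → Ω → ℝ} (g : Lattice d → Ω → ℝ)
    (hf : ∀ x, AEMeasurable (f x) P) :
    energy μ P (fun x ω => f x ω + g x ω) ≤
      (1 + s : ℝ≥0) * energy μ P f + (1 + s⁻¹ : ℝ≥0) * energy μ P g := by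
  simp only [energy]
  rw [← ENNReal.tsum_mul_left, ← ENNReal.tsum_mul_left, ← ENNReal.tsum_add]
  refine ENNReal.tsum_le_tsum fun x => ?_
  rw [mul_left_comm, mul_left_comm _ (ENNReal.ofReal (μ x)), ← mul_add]
  gcongr
  calc ∫⁻ ω, ‖f x ω + g x ω‖ₑ ^ 2 ∂P
      ≤ ∫⁻ ω, ((1 + s : ℝ≥0) * ‖f x ω‖ₑ ^ 2 + (1 + s⁻¹ : ℝ≥0) * ‖g x ω‖ₑ ^ 2) ∂P :=
        lintegral_mono fun ω => enorm_add_sq_le s hs _ _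
    _ = _ := by
      rw [lintegral_add_left' (((hf x).enorm.pow_const 2).const_mul _),
        lintegral_const_mul' _ _ ENNReal.coe_ne_top, lintegral_const_mul' _ _ ENNReal.coe_ne_top]

lemma lintegral_sq_le_liminf {f : ℕ → Ω → ℝ} {g : Ω → ℝ} (hf : ∀ n, AEMeasurable (f n) P)
    (h : TendstoInMeasure P f atTop g) :
    ∫⁻ ω, ‖g ω‖ₑ ^ 2 ∂P ≤ liminf (fun n => ∫⁻ ω, ‖f n ω‖ₑ ^ 2 ∂P) atTop := by
  by_contra! hlt
  obtain ⟨c, hc1, hc2⟩ := exists_between hlt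
  -- Choose first a subsequence along which the integrals stay below c, then a further one
  -- converging almost everywhere; Fatou then contradicts the choice of c.
  have hfreq := frequently_lt_of_liminf_lt (by isBoundedDefault) hc1
  obtain ⟨φ, hφ, hφc⟩ := extraction_of_frequently_atTop hfreq
  obtain ⟨ψ, hψ, hae⟩ := (h.comp hφ.tendsto_atTop).exists_seq_tendsto_ae
  refine hc2.not_ge ?_
  calc ∫⁻ ω, ‖g ω‖ₑ ^ 2 ∂P = ∫⁻ ω, liminf (fun k => ‖f (φ (ψ k)) ω‖ₑ ^ 2) atTop ∂P := by
        refine lintegral_congr_ae ?_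
        filter_upwards [hae] with ω hω
        have : Continuous fun y : ℝ => ‖y‖ₑ ^ 2 := by fun_prop
        exact (((this.tendsto _).comp hω).liminf_eq).symm
    _ ≤ liminf (fun k => ∫⁻ ω, ‖f (φ (ψ k)) ω‖ₑ ^ 2 ∂P) atTop :=
        lintegral_liminf_le' fun k => (hf _).enorm.pow_const 2
    _ ≤ liminf (fun _ : ℕ => c) atTop :=
        liminf_le_liminf (Eventually.of_forall fun k => (hφc _).le)
    _ = c := by simp

/-- Fatou is used twice, in ω and for the counting measure on sites. It carries every mean square
bound from Riemann sums to stochastic integrals known only as limits in probability. -/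
lemma energy_le_of_tendstoInMeasure {f : ℕ → Lattice d → Ω → ℝ} {g : Lattice d → Ω → ℝ}
    {c : ℝ≥0∞} (hf : ∀ n x, AEMeasurable (f n x) P)
    (h : ∀ x, TendstoInMeasure P (fun n => f n x) atTop (g x))
    (hc : ∀ n, energy μ P (f n) ≤ c) : energy μ P g ≤ c := by
  calc energy μ P g
      ≤ ∑' x, liminf (fun n => ENNReal.ofReal (μ x) * ∫⁻ ω, ‖f n x ω‖ₑ ^ 2 ∂P) atTop := by
        refine ENNReal.tsum_le_tsum fun x => ?_
        have hmono : Monotone fun y : ℝ≥0∞ => ENNReal.ofReal (μ x) * y :=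
          fun y z hyz => mul_le_mul' le_rfl hyz
        refine (hmono (lintegral_sq_le_liminf (fun n => hf n x) (h x))).trans_eq ?_
        exact hmono.map_liminf_of_continuousAt _
          (ENNReal.continuous_const_mul ENNReal.ofReal_ne_top).continuousAt
    _ ≤ liminf (fun n => energy μ P (f n)) atTop := by
        have := lintegral_liminf_le (μ := Measure.count) (u := atTop)
          (f := fun (n : ℕ) (x : Lattice d) => ENNReal.ofReal (μ x) * ∫⁻ ω, ‖f n x ω‖ₑ ^ 2 ∂P)
          fun n => Measurable.of_discrete
        simpa only [lintegral_count, energy] using this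
    _ ≤ liminf (fun _ : ℕ => c) atTop := liminf_le_liminf (Eventually.of_forall hc)
    _ = c := by simp

/-! ### Bounds for the averaging operators -/

/-- `C` bounds the convolution operator with kernel `a` on the weighted space. -/
def IsConvBound (a μ : Lattice d → ℝ) (C : ℝ≥0) : Prop :=
  ∀ y, ∑' z, ENNReal.ofReal (a z) * ENNReal.ofReal (μ (y - z)) ≤ C * ENNReal.ofReal (μ y)

lemma IsAdmissibleWeight.exists_convBound (ha : IsJumpKernel a) (hμ : IsAdmissibleWeight a μ) :
    ∃ C, IsConvBound a μ C := by
  obtain ⟨C, hC⟩ := hμ.conv_le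
  refine ⟨C.toNNReal, fun y => ?_⟩
  -- Since μ is bounded by its total sum, the series a * μ converges, so the real `tsum` in
  -- `conv_le` is its genuine value.
  have hs : Summable fun z => a z * μ (y - z) :=
    summable_mul_of_bounded ha.hasSum_one.summable ha.nonneg (M := ∑' z, μ z)
      (fun x => by
        rw [abs_of_pos (hμ.pos x)]
        exact hμ.summable.le_tsum x fun _ _ => (hμ.pos _).le) (fun z => y - z)
  simp only [← ENNReal.ofReal_mul (ha.nonneg _)]
  rw [← ENNReal.ofReal_tsum_of_nonneg (fun z => mul_nonneg (ha.nonneg z) (hμ.pos _).le) hs]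
  refine (ENNReal.ofReal_le_ofReal ((hC y).trans
    (mul_le_mul_of_nonneg_right (Real.le_coe_toNNReal C) (hμ.pos y).le))).trans_eq ?_
  rw [ENNReal.ofReal_mul (NNReal.coe_nonneg _), ENNReal.ofReal_coe_nnreal]

/-- Moving the average onto the weight, where the convolution bound applies. -/
lemma tsum_weight_avg (μ : Lattice d → ℝ) (K F : Lattice d → ℝ≥0∞) :
    ∑' x, ENNReal.ofReal (μ x) * avg K F x =
      ∑' y, (∑' z, K z * ENNReal.ofReal (μ (y - z))) * F y := by
  simp only [avg, ← ENNReal.tsum_mul_left, ← ENNReal.tsum_mul_right]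
  rw [ENNReal.tsum_comm]
  conv_rhs => rw [ENNReal.tsum_comm]
  refine tsum_congr fun z => ?_
  rw [← (Equiv.addRight z).tsum_eq (fun y => K z * ENNReal.ofReal (μ (y - z)) * F y)]
  refine tsum_congr fun x => ?_
  simp only [Equiv.coe_addRight, add_sub_cancel_right]
  ring

lemma tsum_weight_avg_stepKernel_le {C : ℝ≥0} (hC : IsConvBound a μ C) {τ : ℝ≥0}
    (F : Lattice d → ℝ≥0∞) :
    ∑' x, ENNReal.ofReal (μ x) * avg (stepKernelE a τ) F x ≤
      (1 + τ * C : ℝ≥0) * ∑' x, ENNReal.ofReal (μ x) * F x := by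
  rw [tsum_weight_avg, ← ENNReal.tsum_mul_left]
  refine ENNReal.tsum_le_tsum fun y => ?_
  rw [← mul_assoc]
  gcongr
  calc ∑' z, stepKernelE a τ z * ENNReal.ofReal (μ (y - z))
      ≤ ∑' z, ((if z = 0 then ENNReal.ofReal (μ y) else 0) +
          τ * (ENNReal.ofReal (a z) * ENNReal.ofReal (μ (y - z)))) := by
        refine ENNReal.tsum_le_tsum fun z => ?_
        rw [stepKernelE, stepKernel]
        refine (mul_le_mul' (ENNReal.ofReal_add_le) le_rfl).trans ?_
        rw [add_mul, ENNReal.ofReal_mul (NNReal.coe_nonneg τ)]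
        refine add_le_add ?_ (le_of_eq ?_)
        · split_ifs with hz
          · rw [hz, sub_zero]
            refine mul_le_of_le_one_left' ?_
            rw [ENNReal.ofReal_le_one]
            linarith [τ.2, NNReal.coe_nonneg τ]
          · simp
        · rw [mul_assoc]
          congr 1
          exact ENNReal.ofReal_coe_nnreal
    _ ≤ ENNReal.ofReal (μ y) + τ * (C * ENNReal.ofReal (μ y)) := by
        rw [ENNReal.tsum_add, ENNReal.tsum_mul_left, tsum_ite_eq]
        gcongr
        exact hC y
    _ = _ := by push_cast; ring

lemma enorm_stepAvg_le {τ : ℝ} (ha : IsJumpKernel a) (h0 : 0 ≤ τ) (h1 : τ ≤ 1)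
    (f : Lattice d → ℝ) (x : Lattice d) :
    ‖stepAvg a τ f x‖ₑ ≤ avg (stepKernelE a τ) (fun y => ‖f y‖ₑ) x := by
  refine enorm_tsum_le_tsum_enorm.trans (le_of_eq (tsum_congr fun z => ?_))
  rw [enorm_mul, Real.enorm_of_nonneg (stepKernel_nonneg ha h0 h1 z), stepKernelE]

lemma lintegral_avg (K : Lattice d → ℝ≥0∞) {F : Lattice d → Ω → ℝ≥0∞}
    (hF : ∀ x, AEMeasurable (F x) P) (x : Lattice d) :
    ∫⁻ ω, avg K (fun y => F y ω) x ∂P = avg K (fun y => ∫⁻ ω, F y ω ∂P) x := by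
  simp only [avg]
  rw [lintegral_tsum fun z => (hF _).const_mul _]
  exact tsum_congr fun z => lintegral_const_mul'' _ (hF _)

lemma energy_stepAvg_le (ha : IsJumpKernel a) {C : ℝ≥0} (hC : IsConvBound a μ C) {τ : ℝ≥0}
    (h1 : τ ≤ 1) {f : Lattice d → Ω → ℝ} (hf : ∀ x, AEMeasurable (f x) P) :
    energy μ P (fun x ω => stepAvg a τ (fun y => f y ω) x) ≤
      (1 + τ * C : ℝ≥0) * energy μ P f := by
  refine le_trans (ENNReal.tsum_le_tsum fun x => ?_) (tsum_weight_avg_stepKernel_le hC _)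
  gcongr
  have h1' : (τ : ℝ) ≤ 1 := by exact_mod_cast h1
  have hτ0 := NNReal.coe_nonneg τ
  calc ∫⁻ ω, ‖stepAvg a τ (fun y => f y ω) x‖ₑ ^ 2 ∂P
      ≤ ∫⁻ ω, avg (stepKernelE a τ) (fun y => ‖f y ω‖ₑ ^ 2) x ∂P := by
        refine lintegral_mono fun ω => ?_
        refine (pow_le_pow_left₀ zero_le (enorm_stepAvg_le ha hτ0 h1' _ x) 2).trans ?_
        exact sq_avg_le (tsum_stepKernelE ha hτ0 h1') _ _
    _ = _ := lintegral_avg _ (fun y => (hf y).enorm.pow_const 2) x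

lemma nonlocalLaplacian_enorm_sq_le (ha : IsJumpKernel a) (f : Lattice d → ℝ) (x : Lattice d) :
    ‖nonlocalLaplacian a f x‖ₑ ^ 2 ≤
      2 * avg (fun z => ENNReal.ofReal (a z)) (fun y => ‖f y‖ₑ ^ 2) x + 2 * ‖f x‖ₑ ^ 2 := by
  have hK : ∑' z, ENNReal.ofReal (a z) = 1 := by
    rw [← ENNReal.ofReal_tsum_of_nonneg ha.nonneg ha.hasSum_one.summable, ha.hasSum_one.tsum_eq,
      ENNReal.ofReal_one]
  have h1 : ‖nonlocalLaplacian a f x‖ₑ ≤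
      avg (fun z => ENNReal.ofReal (a z)) (fun y => ‖f y - f x‖ₑ) x := by
    refine enorm_tsum_le_tsum_enorm.trans (ENNReal.tsum_le_tsum fun z => ?_)
    rw [enorm_mul, Real.enorm_of_nonneg (ha.nonneg z)]
  refine (pow_le_pow_left₀ zero_le h1 2).trans ((sq_avg_le hK _ _).trans ?_)
  have h2 : ∀ y, ‖f y - f x‖ₑ ^ 2 ≤ 2 * ‖f y‖ₑ ^ 2 + 2 * ‖f x‖ₑ ^ 2 := by
    intro y
    have := enorm_add_sq_le 1 one_ne_zero (f y) (-f x)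
    rw [enorm_neg, ← sub_eq_add_neg, inv_one, one_add_one_eq_two] at this
    exact_mod_cast this
  refine (avg_mono h2 x).trans_eq ?_
  simp only [avg, mul_add, ENNReal.tsum_add]
  congr 1
  · rw [← ENNReal.tsum_mul_left]
    exact tsum_congr fun z => by ring
  · rw [ENNReal.tsum_mul_right, hK, one_mul]

lemma energy_nonlocalLaplacian_le (ha : IsJumpKernel a) {C : ℝ≥0} (hC : IsConvBound a μ C)
    {f : Lattice d → Ω → ℝ} (hf : ∀ x, AEMeasurable (f x) P) :
    energy μ P (fun x ω => nonlocalLaplacian a (fun y => f y ω) x) ≤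
      (2 * (C + 1) : ℝ≥0) * energy μ P f := by
  calc energy μ P (fun x ω => nonlocalLaplacian a (fun y => f y ω) x)
      ≤ ∑' x, ENNReal.ofReal (μ x) *
        (2 * avg (fun z => ENNReal.ofReal (a z)) (fun y => ∫⁻ ω, ‖f y ω‖ₑ ^ 2 ∂P) x +
          2 * ∫⁻ ω, ‖f x ω‖ₑ ^ 2 ∂P) := by
        refine ENNReal.tsum_le_tsum fun x => ?_
        gcongr
        refine (lintegral_mono fun ω => nonlocalLaplacian_enorm_sq_le ha _ x).trans_eq ?_
        rw [lintegral_add_right' _ (((hf x).enorm.pow_const 2).const_mul _),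
          lintegral_const_mul' _ _ ENNReal.ofNat_ne_top,
          lintegral_const_mul' _ _ ENNReal.ofNat_ne_top,
          lintegral_avg _ fun y => (hf y).enorm.pow_const 2]
    _ = 2 * ∑' y, (∑' z, ENNReal.ofReal (a z) * ENNReal.ofReal (μ (y - z))) *
          ∫⁻ ω, ‖f y ω‖ₑ ^ 2 ∂P + 2 * energy μ P f := by
        simp only [mul_add, ENNReal.tsum_add, mul_left_comm _ (2 : ℝ≥0∞), ENNReal.tsum_mul_left,
          tsum_weight_avg]
        rfl
    _ ≤ 2 * ∑' y, (C * ENNReal.ofReal (μ y)) * ∫⁻ ω, ‖f y ω‖ₑ ^ 2 ∂P + 2 * energy μ P f := by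
        gcongr
        exact hC _
    _ = _ := by
        simp only [mul_assoc, ENNReal.tsum_mul_left]
        rw [← energy]
        push_cast
        ring

/-! ### Time integrals -/

/-- Tonelli gives the first bound; Cauchy–Schwarz in time contributes the second factor t - r. -/
lemma energy_integral_le {f : ℝ → Lattice d → Ω → ℝ} [SFinite P]
    (hf : ∀ x, Measurable fun q : ℝ × Ω => f q.1 x q.2) {r t : ℝ} (hrt : r ≤ t) {K : ℝ≥0∞}
    (hK : ∀ s ∈ Set.Ioc r t, energy μ P (f s) ≤ K) :
    ∑' x, ENNReal.ofReal (μ x) * ∫⁻ ω, (∫⁻ s in Set.Ioc r t, ‖f s x ω‖ₑ ^ 2) ∂P ≤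
      ENNReal.ofReal (t - r) * K ∧
    energy μ P (fun x ω => ∫ s in r..t, f s x ω) ≤ ENNReal.ofReal (t - r) ^ 2 * K := by
  have h1 : ∑' x, ENNReal.ofReal (μ x) * ∫⁻ ω, (∫⁻ s in Set.Ioc r t, ‖f s x ω‖ₑ ^ 2) ∂P ≤
      ENNReal.ofReal (t - r) * K := by
    calc ∑' x, ENNReal.ofReal (μ x) * ∫⁻ ω, (∫⁻ s in Set.Ioc r t, ‖f s x ω‖ₑ ^ 2) ∂P
        = ∑' x, ∫⁻ s in Set.Ioc r t, ENNReal.ofReal (μ x) * ∫⁻ ω, ‖f s x ω‖ₑ ^ 2 ∂P := by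
          refine tsum_congr fun x => ?_
          rw [lintegral_const_mul' _ _ ENNReal.ofReal_ne_top, lintegral_lintegral_swap]
          exact ((hf x).comp measurable_swap).enorm.pow_const 2 |>.aemeasurable
      _ = ∫⁻ s in Set.Ioc r t, energy μ P (f s) := by
          rw [← lintegral_tsum fun x => ?_]
          · rfl
          · exact ((((hf x).enorm.pow_const 2).lintegral_prod_right').const_mul _).aemeasurable
      _ ≤ ∫⁻ _s in Set.Ioc r t, K := setLIntegral_mono measurable_const hK
      _ = _ := by rw [setLIntegral_const, Real.volume_Ioc, mul_comm]
  refine ⟨h1, ?_⟩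
  rw [sq, mul_assoc]
  refine le_trans ?_ (mul_le_mul' le_rfl h1)
  rw [← ENNReal.tsum_mul_left]
  refine ENNReal.tsum_le_tsum fun x => ?_
  rw [mul_left_comm]
  gcongr
  rw [← lintegral_const_mul' _ _ ENNReal.ofReal_ne_top]
  refine lintegral_mono fun ω => ?_
  simp only
  rw [intervalIntegral.integral_of_le hrt]
  refine (pow_le_pow_left₀ zero_le (enorm_integral_le_lintegral_enorm _) 2).trans ?_
  refine (sq_lintegral_le _ ((hf x).comp measurable_prodMk_right).enorm.aemeasurable).trans ?_
  rw [Measure.restrict_apply_univ, Real.volume_Ioc]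
  exact le_rfl

lemma ae_intervalIntegrable_of_energy_le {f : ℝ → Lattice d → Ω → ℝ} [SFinite P]
    (hμ : ∀ x, 0 < μ x)
    (hf : ∀ x, Measurable fun q : ℝ × Ω => f q.1 x q.2) {r t : ℝ} (hrt : r ≤ t) {K : ℝ≥0∞}
    (hKt : K ≠ ∞) (hK : ∀ s ∈ Set.Ioc r t, energy μ P (f s) ≤ K) (x : Lattice d) :
    ∀ᵐ ω ∂P, IntervalIntegrable (fun s => f s x ω) volume r t := by
  have h1 := (energy_integral_le hf hrt hK).1
  have h2 : ∫⁻ ω, (∫⁻ s in Set.Ioc r t, ‖f s x ω‖ₑ ^ 2) ∂P ≠ ∞ := by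
    have h3 := ((ENNReal.le_tsum x).trans h1).trans_lt
      (ENNReal.mul_lt_top ENNReal.ofReal_lt_top hKt.lt_top)
    intro h4
    rw [h4, ENNReal.mul_top (by simpa using hμ x)] at h3
    exact lt_irrefl _ h3
  have hm : Measurable fun ω => ∫⁻ s in Set.Ioc r t, ‖f s x ω‖ₑ ^ 2 := by
    have : Measurable fun q : Ω × ℝ => ‖f q.2 x q.1‖ₑ ^ 2 :=
      ((hf x).comp measurable_swap).enorm.pow_const 2
    exact this.lintegral_prod_right'
  filter_upwards [ae_lt_top hm h2] with ω hω
  rw [intervalIntegrable_iff_integrableOn_Ioc_of_le hrt]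
  have hms : Measurable fun s => f s x ω := (hf x).comp measurable_prodMk_right
  refine ⟨hms.aestronglyMeasurable, ?_⟩
  rw [HasFiniteIntegral]
  by_contra hn
  rw [not_lt, top_le_iff] at hn
  have := sq_lintegral_le (volume.restrict (Set.Ioc r t)) hms.enorm.aemeasurable
  rw [hn, Measure.restrict_apply_univ, Real.volume_Ioc] at this
  exact absurd (this.trans_lt (ENNReal.mul_lt_top ENNReal.ofReal_lt_top hω)) (by simp)

end Energy

/-! ### Centered square-integrable variables -/

section Centered

set_option linter.unusedSectionVars false

variable {Ω : Type*} {mΩ : MeasurableSpace Ω} {P : Measure Ω}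

/-- `A` is square integrable and orthogonal to the square-integrable `m`-measurable variables. -/
structure IsCentered (P : Measure Ω) (m : MeasurableSpace Ω) (A : Ω → ℝ) : Prop where
  memLp : MemLp A 2 P
  orth : ∀ Z : Ω → ℝ, MemLp Z 2 P → Measurable[m] Z → ∫ ω, Z ω * A ω ∂P = 0

lemma IsCentered.zero (m : MeasurableSpace Ω) : IsCentered P m (fun _ => 0) :=
  ⟨MemLp.zero' , fun Z _ _ => by simp⟩

lemma IsCentered.add {m : MeasurableSpace Ω} {A B : Ω → ℝ} (hA : IsCentered P m A)
    (hB : IsCentered P m B) : IsCentered P m (fun ω => A ω + B ω) := by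
  refine ⟨hA.memLp.add hB.memLp, fun Z hZ hZm => ?_⟩
  simp only [mul_add]
  have i1 : Integrable (fun ω => Z ω * A ω) P := hZ.integrable_mul hA.memLp
  have i2 : Integrable (fun ω => Z ω * B ω) P := hZ.integrable_mul hB.memLp
  rw [integral_add i1 i2, hA.orth Z hZ hZm,
    hB.orth Z hZ hZm, add_zero]

lemma IsCentered.sub {m : MeasurableSpace Ω} {A B : Ω → ℝ} (hA : IsCentered P m A)
    (hB : IsCentered P m B) : IsCentered P m (fun ω => A ω - B ω) := by
  refine ⟨hA.memLp.sub hB.memLp, fun Z hZ hZm => ?_⟩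
  simp only [mul_sub]
  have i1 : Integrable (fun ω => Z ω * A ω) P := hZ.integrable_mul hA.memLp
  have i2 : Integrable (fun ω => Z ω * B ω) P := hZ.integrable_mul hB.memLp
  rw [integral_sub i1 i2, hA.orth Z hZ hZm,
    hB.orth Z hZ hZm, sub_zero]

lemma IsCentered.mono {m m' : MeasurableSpace Ω} {A : Ω → ℝ} (hA : IsCentered P m A)
    (h : m' ≤ m) : IsCentered P m' A :=
  ⟨hA.memLp, fun Z hZ hZm => hA.orth Z hZ (hZm.mono h le_rfl)⟩

lemma ofReal_integral_sq {f : Ω → ℝ} (hf : MemLp f 2 P) :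
    ∫⁻ ω, ‖f ω‖ₑ ^ 2 ∂P = ENNReal.ofReal (∫ ω, f ω ^ 2 ∂P) := by
  rw [ofReal_integral_eq_lintegral_ofReal hf.integrable_sq (Eventually.of_forall fun ω => sq_nonneg _)]
  refine lintegral_congr fun ω => ?_
  rw [← sq_abs, ENNReal.ofReal_pow (abs_nonneg _), ← Real.norm_eq_abs, ofReal_norm]

lemma memLp_two_of_lintegral {f : Ω → ℝ} (hf : AEStronglyMeasurable f P)
    (h : ∫⁻ ω, ‖f ω‖ₑ ^ 2 ∂P ≠ ∞) : MemLp f 2 P := by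
  refine ⟨hf, ?_⟩
  rw [eLpNorm_lt_top_iff_lintegral_rpow_enorm_lt_top (by simp) (by simp)]
  simpa using h.lt_top

lemma MemLp.lintegral_sq_ne_top {f : Ω → ℝ} (hf : MemLp f 2 P) : ∫⁻ ω, ‖f ω‖ₑ ^ 2 ∂P ≠ ∞ := by
  rw [ofReal_integral_sq hf]
  exact ENNReal.ofReal_ne_top

/-- Pythagoras. -/
lemma IsCentered.lintegral_add_sq {m : MeasurableSpace Ω} {A Z : Ω → ℝ} (hA : IsCentered P m A)
    (hZ : MemLp Z 2 P) (hZm : Measurable[m] Z) :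
    ∫⁻ ω, ‖Z ω + A ω‖ₑ ^ 2 ∂P = ∫⁻ ω, ‖Z ω‖ₑ ^ 2 ∂P + ∫⁻ ω, ‖A ω‖ₑ ^ 2 ∂P := by
  have h1 := hA.orth Z hZ hZm
  have i1 : Integrable (fun ω => Z ω * A ω) P := hZ.integrable_mul hA.memLp
  rw [ofReal_integral_sq (f := fun ω => Z ω + A ω) (hZ.add hA.memLp), ofReal_integral_sq hZ,
    ofReal_integral_sq hA.memLp, ← ENNReal.ofReal_add (integral_nonneg fun ω => sq_nonneg _)
      (integral_nonneg fun ω => sq_nonneg _)]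
  congr 1
  have : ∀ ω, (Z ω + A ω) ^ 2 = Z ω ^ 2 + 2 * (Z ω * A ω) + A ω ^ 2 := fun ω => by ring
  simp only [this]
  have i2 : Integrable (fun ω => Z ω ^ 2 + 2 * (Z ω * A ω)) P :=
    hZ.integrable_sq.add (i1.const_mul 2)
  rw [integral_add i2 hA.memLp.integrable_sq,
    integral_add hZ.integrable_sq (i1.const_mul 2), integral_const_mul, h1]
  ring

variable [IsProbabilityMeasure P]

/-- Multiplying a centered independent variable with an `m`-measurable one. -/
lemma isCentered_mul {m m' : MeasurableSpace Ω} (hm : m ≤ mΩ) (hm' : m' ≤ mΩ)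
    (hind : Indep m' m P) {Y ξ : Ω → ℝ} (hY : MemLp Y 2 P) (hYm : Measurable[m] Y)
    (hξ : MemLp ξ 2 P) (hξm : Measurable[m'] ξ) (h0 : ∫ ω, ξ ω ∂P = 0) :
    IsCentered P m (fun ω => Y ω * ξ ω) ∧
      ∫⁻ ω, ‖Y ω * ξ ω‖ₑ ^ 2 ∂P = (∫⁻ ω, ‖ξ ω‖ₑ ^ 2 ∂P) * ∫⁻ ω, ‖Y ω‖ₑ ^ 2 ∂P := by
  have h1 : ∫⁻ ω, ‖Y ω * ξ ω‖ₑ ^ 2 ∂P = (∫⁻ ω, ‖ξ ω‖ₑ ^ 2 ∂P) * ∫⁻ ω, ‖Y ω‖ₑ ^ 2 ∂P := by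
    have e : ∫⁻ ω, ‖ξ ω‖ₑ ^ 2 * ‖Y ω‖ₑ ^ 2 ∂P =
        (∫⁻ ω, ‖ξ ω‖ₑ ^ 2 ∂P) * ∫⁻ ω, ‖Y ω‖ₑ ^ 2 ∂P :=
      lintegral_mul_eq_lintegral_mul_lintegral_of_independent_measurableSpace hm' hm hind
        ((measurable_enorm.comp hξm).pow_const 2) ((measurable_enorm.comp hYm).pow_const 2)
    rw [← e]
    refine lintegral_congr fun ω => ?_
    rw [enorm_mul, mul_pow, mul_comm]
  refine ⟨⟨?_, fun Z hZ hZm => ?_⟩, h1⟩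
  · refine memLp_two_of_lintegral
      (hY.aestronglyMeasurable.mul hξ.aestronglyMeasurable) ?_
    rw [h1]
    exact ENNReal.mul_ne_top (MemLp.lintegral_sq_ne_top hξ) (MemLp.lintegral_sq_ne_top hY)
  · have hindf : IndepFun (fun ω => Z ω * Y ω) ξ P := by
      rw [IndepFun_iff_Indep]
      refine indep_of_indep_of_le_left (indep_of_indep_of_le_right hind.symm ?_) ?_
      · exact hξm.comap_le
      · exact (hZm.mul hYm).comap_le
    have := hindf.integral_fun_mul_eq_mul_integral
      (hZ.aestronglyMeasurable.mul hY.aestronglyMeasurable) hξ.aestronglyMeasurable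
    simp only [← mul_assoc]
    rw [this, h0, mul_zero]

end Centered

/-! ### Orthogonality and isometry for sums against the noise. -/

section NoiseIsometry

set_option linter.unusedSectionVars false

variable {Ω : Type*} {mΩ : MeasurableSpace Ω} {d : ℕ} {P : Measure Ω} [IsProbabilityMeasure P]
  {ℱ : Filtration ℝ≥0 mΩ} {w : Lattice d → ℝ≥0 → Ω → ℝ} {b : Lattice d → ℝ}

/-- The variance `B(0)` of the noise. -/
def noiseVar (b : Lattice d → ℝ) : ℝ≥0 := (corr b 0).toNNReal

lemma coe_noiseVar (b : Lattice d → ℝ) : (noiseVar b : ℝ) = corr b 0 :=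
  Real.coe_toNNReal _ (corr_zero_nonneg b)

lemma lintegral_noise_sq (hw : IsBrownianFamily P ℱ w) (hb : Summable fun z => |b z|)
    {s t : ℝ≥0} (hst : s ≤ t) (x : Lattice d) :
    ∫⁻ ω, ‖noise b w s t x ω‖ₑ ^ 2 ∂P = ((t - s) * noiseVar b : ℝ≥0) := by
  have h := hasLaw_noise hw hb hst x
  rw [ofReal_integral_sq (memLp_gaussian h 2), integral_sq_gaussian h, ENNReal.ofReal_coe_nnreal]
  rfl

lemma isCentered_mul_noise (hw : IsBrownianFamily P ℱ w) (hb : Summable fun z => |b z|)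
    {s t : ℝ≥0} (hst : s ≤ t) (x : Lattice d) {Y : Ω → ℝ} (hY : MemLp Y 2 P)
    (hYm : Measurable[ℱ s] Y) :
    IsCentered P (ℱ s) (fun ω => Y ω * noise b w s t x ω) ∧
      ∫⁻ ω, ‖Y ω * noise b w s t x ω‖ₑ ^ 2 ∂P =
        ((t - s) * noiseVar b : ℝ≥0) * ∫⁻ ω, ‖Y ω‖ₑ ^ 2 ∂P := by
  have h := hasLaw_noise hw hb hst x
  have := isCentered_mul (ℱ.le s) (noiseSigma_le hw hst) (indep_noise hw hst) hY hYm
    (memLp_gaussian h 2) (measurable_noise_noiseSigma b w s t x) (integral_gaussian h)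
  rwa [lintegral_noise_sq hw hb hst] at this

/-- The nonlinear part of the multiplicative noise increment. -/
def expRemainder (b : Lattice d → ℝ) (w : Lattice d → ℝ≥0 → Ω → ℝ) (s t : ℝ≥0) (x : Lattice d)
    (ω : Ω) : ℝ :=
  Real.exp (noise b w s t x ω - (t - s : ℝ≥0) * corr b 0 / 2) - 1 - noise b w s t x ω

/-- The compensated exponential has mean 1, so the remainder is centered. Its variance is of second
order in the step, whereas that of the noise is of first order. -/
lemma isCentered_mul_expRemainder (hw : IsBrownianFamily P ℱ w) (hb : Summable fun z => |b z|)
    {s t : ℝ≥0} (hst : s ≤ t) (hsmall : (t - s) * noiseVar b ≤ 1) (x : Lattice d) {Y : Ω → ℝ}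
    (hY : MemLp Y 2 P) (hYm : Measurable[ℱ s] Y) :
    IsCentered P (ℱ s) (fun ω => Y ω * expRemainder b w s t x ω) ∧
      ∫⁻ ω, ‖Y ω * expRemainder b w s t x ω‖ₑ ^ 2 ∂P ≤
        (((t - s) * noiseVar b) ^ 2 : ℝ≥0) * ∫⁻ ω, ‖Y ω‖ₑ ^ 2 ∂P := by
  have h := hasLaw_noise hw hb hst x
  have hv : (((t - s) * noiseVar b : ℝ≥0) : ℝ) / 2 = (t - s : ℝ≥0) * corr b 0 / 2 := by
    rw [NNReal.coe_mul, coe_noiseVar]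
  obtain ⟨h1, h2⟩ := integral_exp_remainder_sq h hsmall
  have hm : Measurable[noiseSigma b w s t] (expRemainder b w s t x) := by
    have := measurable_noise_noiseSigma b w s t x
    exact (((this.sub_const _).exp).sub_const _).sub this
  have hm' : Measurable (expRemainder b w s t x) := hm.mono (noiseSigma_le hw hst) le_rfl
  change Integrable (fun ω => (Real.exp (noise b w s t x ω -
    (((t - s) * noiseVar b : ℝ≥0) : ℝ) / 2) - 1 - noise b w s t x ω) ^ 2) P at h1
  change ∫ ω, (Real.exp (noise b w s t x ω -
    (((t - s) * noiseVar b : ℝ≥0) : ℝ) / 2) - 1 - noise b w s t x ω) ^ 2 ∂P ≤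
      (((t - s) * noiseVar b : ℝ≥0) : ℝ) ^ 2 at h2
  rw [hv] at h1 h2
  have hL : MemLp (expRemainder b w s t x) 2 P :=
    (memLp_two_iff_integrable_sq hm'.aestronglyMeasurable).mpr h1
  have h0 : ∫ ω, expRemainder b w s t x ω ∂P = 0 := by
    have e1 := mgf_gaussianReal h.map_eq 1
    have i1 := integrable_exp_gaussian h 1
    have i2 : Integrable (noise b w s t x) P := (memLp_gaussian h 1).integrable (by simp)
    simp only [mgf, one_mul, one_pow, zero_add, mul_one] at e1 i1
    simp only [expRemainder, Real.exp_sub]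
    have i3 : Integrable (fun ω => Real.exp (noise b w s t x ω) /
        Real.exp ((t - s : ℝ≥0) * corr b 0 / 2) - 1) P :=
      (i1.div_const _).sub (integrable_const _)
    rw [integral_sub i3 i2,
      integral_sub (i1.div_const _) (integrable_const _), integral_div, e1, integral_gaussian h]
    rw [show ((t - s) * (corr b 0).toNNReal : ℝ≥0) = (t - s) * noiseVar b from rfl, hv,
      div_self (Real.exp_pos _).ne']
    simp
  obtain ⟨h3, h4⟩ := isCentered_mul (ℱ.le s) (noiseSigma_le hw hst) (indep_noise hw hst) hY hYm hL
    hm h0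
  refine ⟨h3, h4.trans_le ?_⟩
  gcongr
  rw [ofReal_integral_sq hL]
  refine (ENNReal.ofReal_le_ofReal h2).trans_eq ?_
  rw [ENNReal.ofReal_pow (NNReal.coe_nonneg _), ENNReal.ofReal_coe_nnreal]
  push_cast
  rfl

/-- Discrete Itô isometry. -/
lemma isCentered_sum_noise (hw : IsBrownianFamily P ℱ w) (hb : Summable fun z => |b z|) (h : ℝ≥0)
    (x : Lattice d) {Y : ℕ → Ω → ℝ} {i j : ℕ} (hij : i ≤ j)
    (hY : ∀ k, i ≤ k → k < j → MemLp (Y k) 2 P)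
    (hYm : ∀ k, i ≤ k → k < j → Measurable[ℱ (grid h k)] (Y k)) :
    (Measurable[ℱ (grid h j)] fun ω =>
      ∑ k ∈ Finset.Ico i j, Y k ω * noise b w (grid h k) (grid h (k + 1)) x ω) ∧
    IsCentered P (ℱ (grid h i)) (fun ω =>
      ∑ k ∈ Finset.Ico i j, Y k ω * noise b w (grid h k) (grid h (k + 1)) x ω) ∧
    ∫⁻ ω, ‖∑ k ∈ Finset.Ico i j, Y k ω * noise b w (grid h k) (grid h (k + 1)) x ω‖ₑ ^ 2 ∂P =
      (h * noiseVar b : ℝ≥0) * ∑ k ∈ Finset.Ico i j, ∫⁻ ω, ‖Y k ω‖ₑ ^ 2 ∂P := by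
  revert hY hYm
  induction j, hij using Nat.le_induction with
  | base =>
    intro _ _
    simp only [Finset.Ico_self, Finset.sum_empty]
    exact ⟨measurable_const, IsCentered.zero _, by simp⟩
  | succ j hij ih =>
    intro hY hYm
    obtain ⟨h1, h2, h3⟩ := ih (fun k hk hkj => hY k hk (hkj.trans j.lt_succ_self))
      (fun k hk hkj => hYm k hk (hkj.trans j.lt_succ_self))
    have hYj := hYm j hij j.lt_succ_self
    obtain ⟨h4, h5⟩ := isCentered_mul_noise hw hb (grid_mono h j.le_succ) x
      (hY j hij j.lt_succ_self) hYj
    have hsub := grid_succ_sub h j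
    rw [hsub] at h5
    have hmono : ℱ (grid h j) ≤ ℱ (grid h (j + 1)) := ℱ.mono (grid_mono h j.le_succ)
    simp only [Finset.sum_Ico_succ_top hij]
    refine ⟨?_, ?_, ?_⟩
    · exact (h1.mono hmono le_rfl).add
        ((hYj.mono hmono le_rfl).mul
          (measurable_noise_filtration hw (grid_mono h j.le_succ) x))
    · exact h2.add (h4.mono (ℱ.mono (grid_mono h hij)))
    · rw [h4.lintegral_add_sq h2.memLp h1, h3, h5, mul_add]

lemma energy_sum_noise (hw : IsBrownianFamily P ℱ w) (hb : Summable fun z => |b z|) (h : ℝ≥0)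
    (μ : Lattice d → ℝ) {Y : ℕ → Lattice d → Ω → ℝ} {i j : ℕ} (hij : i ≤ j)
    (hY : ∀ k, i ≤ k → k < j → ∀ x, MemLp (Y k x) 2 P)
    (hYm : ∀ k, i ≤ k → k < j → ∀ x, Measurable[ℱ (grid h k)] (Y k x)) :
    energy μ P (fun x ω =>
      ∑ k ∈ Finset.Ico i j, Y k x ω * noise b w (grid h k) (grid h (k + 1)) x ω) =
      (h * noiseVar b : ℝ≥0) * ∑ k ∈ Finset.Ico i j, energy μ P (Y k) := by
  simp only [energy]
  rw [← Summable.tsum_finsetSum fun _ _ => ENNReal.summable, ← ENNReal.tsum_mul_left]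
  refine tsum_congr fun x => ?_
  rw [(isCentered_sum_noise hw hb h x (Y := fun k => Y k x) hij (fun k h1 h2 => hY k h1 h2 x)
    (fun k h1 h2 => hYm k h1 h2 x)).2.2, ← Finset.mul_sum]
  ring

lemma ae_sum_noise (hw : IsBrownianFamily P ℱ w) (hb : Summable fun z => |b z|) (h : ℝ≥0)
    (x : Lattice d) {i j : ℕ} (hij : i ≤ j) :
    ∀ᵐ ω ∂P, ∑ k ∈ Finset.Ico i j, noise b w (grid h k) (grid h (k + 1)) x ω =
      noise b w (grid h i) (grid h j) x ω := by
  have h1 := fun k => ae_corrWiener_sub hw hb (grid h k) (grid h (k + 1)) x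
  filter_upwards [ae_all_iff.mpr h1, ae_corrWiener_sub hw hb (grid h i) (grid h j) x] with ω h2 h3
  rw [← h3, ← Finset.sum_Ico_sub (fun k => corrWiener b w x (grid h k) ω) hij]
  exact Finset.sum_congr rfl fun k _ => (h2 k).symm

end NoiseIsometry

/-! ### Regularity of solutions -/

section Regularity

set_option linter.unusedSectionVars false

variable {Ω : Type*} {mΩ : MeasurableSpace Ω} {P : Measure Ω}

lemma tendstoInMeasure_add {f g : ℕ → Ω → ℝ} {F G : Ω → ℝ}
    (hf : TendstoInMeasure P f atTop F) (hg : TendstoInMeasure P g atTop G) :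
    TendstoInMeasure P (fun n ω => f n ω + g n ω) atTop (fun ω => F ω + G ω) := by
  rw [tendstoInMeasure_iff_norm] at *
  intro ε hε
  have h := (hf (ε / 2) (by positivity)).add (hg (ε / 2) (by positivity))
  rw [add_zero] at h
  refine tendsto_of_tendsto_of_tendsto_of_le_of_le tendsto_const_nhds h (fun _ => zero_le)
    fun n => (measure_mono fun ω hω => ?_).trans (measure_union_le _ _)
  by_contra hn
  simp only [Set.mem_union, Set.mem_ofPred_eq, not_or, not_le] at hn hω
  have : ‖f n ω + g n ω - (F ω + G ω)‖ ≤ ‖f n ω - F ω‖ + ‖g n ω - G ω‖ := by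
    rw [add_sub_add_comm]
    exact norm_add_le _ _
  linarith [hn.1, hn.2]

lemma tendstoInMeasure_neg {f : ℕ → Ω → ℝ} {F : Ω → ℝ} (hf : TendstoInMeasure P f atTop F) :
    TendstoInMeasure P (fun n ω => -f n ω) atTop (fun ω => -F ω) := by
  rw [tendstoInMeasure_iff_norm] at *
  intro ε hε
  convert hf ε hε using 5 with n ω
  rw [← neg_sub', norm_neg]

lemma tendstoInMeasure_sub {f g : ℕ → Ω → ℝ} {F G : Ω → ℝ}
    (hf : TendstoInMeasure P f atTop F) (hg : TendstoInMeasure P g atTop G) :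
    TendstoInMeasure P (fun n ω => f n ω - g n ω) atTop (fun ω => F ω - G ω) := by
  simpa only [sub_eq_add_neg] using tendstoInMeasure_add hf (tendstoInMeasure_neg hg)

lemma tendstoInMeasure_const (F : Ω → ℝ) : TendstoInMeasure P (fun _ : ℕ => F) atTop F := by
  rw [tendstoInMeasure_iff_norm]
  intro ε hε
  simp [hε.not_ge]

variable {d : ℕ} [IsProbabilityMeasure P]
  {ℱ : Filtration ℝ≥0 mΩ} {w : Lattice d → ℝ≥0 → Ω → ℝ} {a b μ : Lattice d → ℝ} {κ : ℝ≥0}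
  {u : ℝ≥0 → Lattice d → Ω → ℝ}

lemma IsSolution.measurable (hu : IsSolution a b κ P ℱ w u) (t : ℝ≥0) (x : Lattice d) :
    Measurable (u t x) :=
  (hu.adapted x t).mono (ℱ.le t) le_rfl

/-- Setting the paths to 0 on a measurable null set makes them all continuous, which yields the
joint measurability needed for Fubini. Adaptedness may be lost, so `u` itself is kept in the
martingale arguments. -/
lemma IsSolution.exists_modification (hu : IsSolution a b κ P ℱ w u) :
    ∃ v : ℝ≥0 → Lattice d → Ω → ℝ, (∀ t x, Measurable (v t x)) ∧
      (∀ x ω, Continuous fun t => v t x ω) ∧ ∀ᵐ ω ∂P, ∀ t x, u t x ω = v t x ω := by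
  have h := ae_all_iff.mpr hu.continuous_paths
  obtain ⟨N, hN, hNm, hN0⟩ := exists_measurable_superset_of_null (ae_iff.mp h)
  refine ⟨fun t x => Nᶜ.indicator (u t x), fun t x => (hu.measurable t x).indicator hNm.compl,
    fun x ω => ?_, ?_⟩
  · by_cases hω : ω ∈ N
    · simpa [hω] using continuous_const
    · have : ∀ x, Continuous fun t => u t x ω := by
        by_contra hc
        exact hω (hN hc)
      simpa [hω] using this x
  · have : ∀ᵐ ω ∂P, ω ∉ N := measure_eq_zero_iff_ae_notMem.mp hN0
    filter_upwards [this] with ω hω t x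
    simp [hω]

/-- The drift `∫_r^t ϰ ℒ u(s, x) ds`. -/
def drift (a : Lattice d → ℝ) (κ : ℝ≥0) (u : ℝ≥0 → Lattice d → Ω → ℝ) (r t : ℝ≥0)
    (x : Lattice d) (ω : Ω) : ℝ :=
  ∫ s in (r : ℝ)..t, κ * nonlocalLaplacian a (fun y => u s.toNNReal y ω) x

lemma measurable_nonlocalLaplacian {α : Type*} {mα : MeasurableSpace α} {f : Lattice d → α → ℝ}
    (hf : ∀ x, Measurable (f x)) (x : Lattice d) :
    Measurable fun q => nonlocalLaplacian a (fun y => f y q) x :=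
  Measurable.tsum fun _ => ((hf _).sub (hf _)).const_mul _

lemma energy_const_mul_le (c : ℝ≥0) (f : Lattice d → Ω → ℝ) :
    energy μ P (fun x ω => c * f x ω) ≤ (c ^ 2 : ℝ≥0) * energy μ P f := by
  refine energy_le_of_le fun x => ?_
  simp only [enorm_mul, mul_pow]
  rw [lintegral_const_mul' _ _ (by simp)]
  simp [Real.enorm_of_nonneg (NNReal.coe_nonneg c)]

lemma energy_drift_integrand_le (ha : IsJumpKernel a) {C : ℝ≥0} (hC : IsConvBound a μ C)
    (κ : ℝ≥0) {f : Lattice d → Ω → ℝ} (hf : ∀ x, AEMeasurable (f x) P) :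
    energy μ P (fun x ω => κ * nonlocalLaplacian a (fun y => f y ω) x) ≤
      (κ ^ 2 * (2 * (C + 1)) : ℝ≥0) * energy μ P f := by
  refine (energy_const_mul_le _ _).trans ?_
  rw [ENNReal.coe_mul, mul_assoc]
  gcongr
  exact energy_nonlocalLaplacian_le ha hC hf

lemma measurable_modification {v : ℝ≥0 → Lattice d → Ω → ℝ} (hv : ∀ t x, Measurable (v t x))
    (hvc : ∀ x ω, Continuous fun t => v t x ω) (x : Lattice d) :
    Measurable fun q : ℝ × Ω => v q.1.toNNReal x q.2 := by
  have h := measurable_uncurry_of_continuous_of_measurable (u := fun t ω => v t x ω) (hvc x)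
    (fun t => hv t x)
  exact h.comp ((measurable_fst.real_toNNReal).prodMk measurable_snd)

/-- The standing assumptions on a solution on the time interval `[0, T]`. -/
structure IsRegularSolution (a b μ : Lattice d → ℝ) (κ : ℝ≥0) (P : Measure Ω)
    (ℱ : Filtration ℝ≥0 mΩ) (w : Lattice d → ℝ≥0 → Ω → ℝ) (u : ℝ≥0 → Lattice d → Ω → ℝ)
    (T C K : ℝ≥0) : Prop where
  kernel : IsJumpKernel a
  summable : Summable fun z => |b z|
  brownian : IsBrownianFamily P ℱ w
  solution : IsSolution a b κ P ℱ w u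
  weight_pos : ∀ x, 0 < μ x
  weight_summable : Summable μ
  conv : IsConvBound a μ C
  bound : ∀ t ≤ T, energy μ P (u t) ≤ K

lemma IsSolution.exists_isRegularSolution (ha : IsJumpKernel a) (hb : Summable fun z => |b z|)
    (hw : IsBrownianFamily P ℱ w) (hu : IsSolution a b κ P ℱ w u) (T : ℝ≥0) :
    ∃ μ C K, IsRegularSolution a b μ κ P ℱ w u T C K := by
  obtain ⟨μ, hμ, h⟩ := hu.bounded
  obtain ⟨C, hC⟩ := hμ.exists_convBound ha
  obtain ⟨K, hK⟩ := h T
  exact ⟨μ, C, K, ha, hb, hw, hu, hμ.pos, hμ.summable, hC, hK⟩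

variable {T C K : ℝ≥0}

lemma lintegral_sq_ne_top_of_energy {f : Lattice d → Ω → ℝ} (hμ : ∀ x, 0 < μ x)
    (h : energy μ P f ≠ ∞) (x : Lattice d) : ∫⁻ ω, ‖f x ω‖ₑ ^ 2 ∂P ≠ ∞ := by
  intro h4
  have := (ENNReal.le_tsum (f := fun x => ENNReal.ofReal (μ x) * ∫⁻ ω, ‖f x ω‖ₑ ^ 2 ∂P) x).trans_lt
    (show energy μ P f < ∞ from h.lt_top)
  simp only [h4] at this
  rw [ENNReal.mul_top (by simpa using hμ x)] at this
  exact lt_irrefl _ this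

lemma IsRegularSolution.memLp (H : IsRegularSolution a b μ κ P ℱ w u T C K) {t : ℝ≥0}
    (ht : t ≤ T) (x : Lattice d) : MemLp (u t x) 2 P := by
  refine memLp_two_of_lintegral (H.solution.measurable t x).aestronglyMeasurable ?_
  exact lintegral_sq_ne_top_of_energy H.weight_pos
    ((H.bound t ht).trans_lt ENNReal.coe_lt_top).ne x

/-- The drift of a shifted process, with bounds. -/
lemma IsRegularSolution.drift_bounds (H : IsRegularSolution a b μ κ P ℱ w u T C K) {r t : ℝ≥0}
    (hrt : r ≤ t) (c : Lattice d → Ω → ℝ) (hc : ∀ x, Measurable (c x)) {K' : ℝ≥0}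
    (hK' : ∀ s : ℝ≥0, r ≤ s → s ≤ t → energy μ P (fun x ω => u s x ω - c x ω) ≤ K') :
    (∀ x, ∀ᵐ ω ∂P, IntervalIntegrable (fun s : ℝ => κ *
      nonlocalLaplacian a (fun y => u s.toNNReal y ω - c y ω) x) volume r t) ∧
    energy μ P (fun x ω => ∫ s in (r : ℝ)..t, κ *
      nonlocalLaplacian a (fun y => u s.toNNReal y ω - c y ω) x) ≤
      ((t - r) ^ 2 * (κ ^ 2 * (2 * (C + 1)) * K') : ℝ≥0) := by
  obtain ⟨v, hvm, hvc, hvu⟩ := H.solution.exists_modification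
  set f : ℝ → Lattice d → Ω → ℝ := fun s x ω => κ *
      nonlocalLaplacian a (fun y => v s.toNNReal y ω - c y ω) x with hf
  have hfm : ∀ x, Measurable fun q : ℝ × Ω => f q.1 x q.2 := fun x =>
    (measurable_nonlocalLaplacian (f := fun y (q : ℝ × Ω) => v q.1.toNNReal y q.2 - c y q.2)
      (fun y => (measurable_modification hvm hvc y).sub ((hc y).comp measurable_snd)) x).const_mul _
  have hrt' : (r : ℝ) ≤ t := by exact_mod_cast hrt
  have hfK : ∀ s ∈ Set.Ioc (r : ℝ) t,
      energy μ P (f s) ≤ (κ ^ 2 * (2 * (C + 1)) * K' : ℝ≥0) := by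
    intro s hs
    have hs0 : 0 ≤ s := r.2.trans hs.1.le
    refine (energy_drift_integrand_le H.kernel H.conv κ
      (f := fun y ω => v s.toNNReal y ω - c y ω)
      fun x => ((hvm _ x).sub (hc x)).aemeasurable).trans ?_
    rw [ENNReal.coe_mul _ K']
    gcongr
    rw [energy_congr (g := fun x ω => u s.toNNReal x ω - c x ω)]
    · exact hK' _ (by rw [Real.le_toNNReal_iff_coe_le hs0]; exact hs.1.le)
        (by rw [Real.toNNReal_le_iff_le_coe]; exact hs.2)
    · intro x
      filter_upwards [hvu] with ω hω
      rw [hω]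
  have hae : ∀ᵐ ω ∂P, ∀ x, (fun s : ℝ => κ *
      nonlocalLaplacian a (fun y => u s.toNNReal y ω - c y ω) x) = fun s => f s x ω := by
    filter_upwards [hvu] with ω hω x
    ext s
    simp only [hf, hω]
  constructor
  · intro x
    filter_upwards [hae, ae_intervalIntegrable_of_energy_le H.weight_pos hfm hrt'
      ENNReal.coe_ne_top hfK x] with ω h1 h2
    rw [h1 x]
    exact h2
  · rw [energy_congr (g := fun x ω => ∫ s in (r : ℝ)..t, f s x ω)]
    · refine (energy_integral_le hfm hrt' hfK).2.trans_eq ?_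
      rw [← NNReal.coe_sub hrt, ENNReal.ofReal_coe_nnreal]
      push_cast
      rfl
    · intro x
      filter_upwards [hae] with ω h1
      rw [h1 x]

lemma IsRegularSolution.energy_drift_le (H : IsRegularSolution a b μ κ P ℱ w u T C K)
    {r t : ℝ≥0} (hrt : r ≤ t) (ht : t ≤ T) :
    (∀ x, ∀ᵐ ω ∂P, IntervalIntegrable (fun s : ℝ => κ *
      nonlocalLaplacian a (fun y => u s.toNNReal y ω) x) volume r t) ∧
    energy μ P (drift a κ u r t) ≤ ((t - r) ^ 2 * (κ ^ 2 * (2 * (C + 1)) * K) : ℝ≥0) := by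
  have := H.drift_bounds hrt (fun _ _ => 0) (fun _ => measurable_const) (K' := K)
    (fun s _ hs => by simpa using H.bound s (hs.trans ht))
  simp only [sub_zero] at this
  exact this

/-- The increment `u(t) - u(r) - ∫_r^t ϰ ℒ u ds` of the martingale part. -/
def martIncr (a : Lattice d → ℝ) (κ : ℝ≥0) (u : ℝ≥0 → Lattice d → Ω → ℝ) (r t : ℝ≥0)
    (x : Lattice d) (ω : Ω) : ℝ :=
  u t x ω - u r x ω - drift a κ u r t x ω

/-- The Riemann sums for the stochastic integral over `[i h, j h]`, on the grid of mesh `h / m`. -/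
def riemannSum (b : Lattice d → ℝ) (w : Lattice d → ℝ≥0 → Ω → ℝ) (u : ℝ≥0 → Lattice d → Ω → ℝ)
    (h : ℝ≥0) (i j m : ℕ) (x : Lattice d) (ω : Ω) : ℝ :=
  ∑ k ∈ Finset.Ico (i * m) (j * m), u (grid (h / m) k) x ω *
    noise b w (grid (h / m) k) (grid (h / m) (k + 1)) x ω

lemma grid_div (h : ℝ≥0) {m : ℕ} (hm : m ≠ 0) (k : ℕ) : grid (h / m) (k * m) = grid h k := by
  have : (m : ℝ≥0) ≠ 0 := by exact_mod_cast hm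
  simp only [grid]
  push_cast
  field_simp

/-- Using only j m subintervals of [0, j h] makes every multiple of h a partition point, so sums
over different intervals can later be subtracted. -/
lemma IsRegularSolution.tendsto_riemannSum_zero (H : IsRegularSolution a b μ κ P ℱ w u T C K)
    (h : ℝ≥0) (j : ℕ) (x : Lattice d) :
    TendstoInMeasure P (fun m => riemannSum b w u h 0 j m x) atTop
      (fun ω => u (grid h j) x ω - 1 - drift a κ u 0 (grid h j) x ω) := by
  have h1 := H.solution.equation (grid h j) x
  have hlim : TendstoInMeasure P
      (fun m => itoSum (fun s => u s x) (corrWiener b w x) (grid h j) (j * m)) atTop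
      (fun ω => u (grid h j) x ω - 1 - drift a κ u 0 (grid h j) x ω) := by
    -- For j = 0 the number j m of subintervals does not tend to infinity, but all the sums vanish.
    rcases Nat.eq_zero_or_pos j with rfl | hj
    · have e : ∀ n, itoSum (fun s => u s x) (corrWiener b w x) (grid h 0) n = fun _ => 0 := by
        intro n
        ext ω
        simp [itoSum, grid]
      have h2 : TendstoInMeasure P (fun n : ℕ =>
        itoSum (fun s => u s x) (corrWiener b w x) (grid h 0) n) atTop _ := h1
      simp only [e] at h2 ⊢
      simpa [drift] using h2
    · have h2 : Tendsto (fun m => j * m) atTop atTop :=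
        tendsto_id.const_mul_atTop' hj
      have h3 : TendstoInMeasure P (fun n : ℕ =>
        itoSum (fun s => u s x) (corrWiener b w x) (grid h j) n) atTop _ := h1
      have h4 := h3.comp h2
      simpa [drift, Function.comp_def] using h4
  refine hlim.congr' ?_ (Eventually.of_forall fun _ => rfl)
  filter_upwards [eventually_ne_atTop 0] with m hm
  have hm' : (m : ℝ≥0) ≠ 0 := by exact_mod_cast hm
  filter_upwards [ae_all_iff.mpr fun k => ae_corrWiener_sub H.brownian H.summable
    (grid (h / m) k) (grid (h / m) (k + 1)) x] with ω hω
  rw [riemannSum, zero_mul, ← Finset.range_eq_Ico, itoSum]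
  refine Finset.sum_congr rfl fun k hk => ?_
  have hj : (j : ℝ≥0) ≠ 0 := by
    rintro hj
    have : j = 0 := by exact_mod_cast hj
    simp [this] at hk
  have e : ∀ y : ℝ≥0, y / ((j * m : ℕ) : ℝ≥0) * grid h j = y * (h / m) := by
    intro y
    simp only [grid]
    push_cast
    field_simp
  rw [e, e, ← hω k]
  simp only [grid]
  push_cast
  rfl

lemma IsRegularSolution.drift_sub (H : IsRegularSolution a b μ κ P ℱ w u T C K) {r t : ℝ≥0}
    (hrt : r ≤ t) (ht : t ≤ T) (x : Lattice d) :
    ∀ᵐ ω ∂P, drift a κ u 0 t x ω - drift a κ u 0 r x ω = drift a κ u r t x ω := by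
  filter_upwards [(H.energy_drift_le (zero_le (a := r)) (hrt.trans ht)).1 x,
    (H.energy_drift_le hrt ht).1 x] with ω h1 h2
  rw [drift, drift, drift, ← intervalIntegral.integral_add_adjacent_intervals h1 h2]
  simp

lemma IsRegularSolution.tendsto_riemannSum (H : IsRegularSolution a b μ κ P ℱ w u T C K)
    (h : ℝ≥0) {i j : ℕ} (hij : i ≤ j) (hj : grid h j ≤ T) (x : Lattice d) :
    TendstoInMeasure P (fun m => riemannSum b w u h i j m x) atTop
      (martIncr a κ u (grid h i) (grid h j) x) := by
  have h1 := tendstoInMeasure_sub (H.tendsto_riemannSum_zero h j x)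
    (H.tendsto_riemannSum_zero h i x)
  refine h1.congr (fun m => Eventually.of_forall fun ω => ?_) ?_
  · simp only [riemannSum, zero_mul, ← Finset.range_eq_Ico]
    rw [Finset.sum_Ico_eq_sub _ (Nat.mul_le_mul_right m hij)]
  · filter_upwards [H.drift_sub (grid_mono h hij) hj x] with ω hω
    rw [martIncr, ← hω]
    ring

/-- At time 0 all Riemann sums and the drift vanish, so the equation itself forces the initial
value. -/
lemma IsRegularSolution.u_zero (H : IsRegularSolution a b μ κ P ℱ w u T C K) (x : Lattice d) :
    u 0 x =ᵐ[P] fun _ => 1 := by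
  have h1 := H.tendsto_riemannSum_zero 0 0 x
  have h2 : TendstoInMeasure P (fun m => riemannSum b w u 0 0 0 m x) atTop (fun _ => (0 : ℝ)) := by
    have : (fun m => riemannSum b w u 0 0 0 m x) = fun _ _ => 0 := by
      ext m ω
      simp [riemannSum]
    rw [this]
    exact tendstoInMeasure_const _
  filter_upwards [tendstoInMeasure_ae_unique h1 h2] with ω hω
  simp [grid, drift] at hω
  linarith

lemma grid_div_le {h : ℝ≥0} {j m k : ℕ} (hk : k ≤ j * m) : grid (h / m) k ≤ grid h j := by
  rcases Nat.eq_zero_or_pos m with rfl | hm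
  · simp [grid]
  · rw [← grid_div h hm.ne' j]
    exact grid_mono _ hk

/-- The discrete isometry bounds every Riemann sum uniformly, and Fatou passes the bound to the
limit. -/
lemma IsRegularSolution.energy_martIncr_le (H : IsRegularSolution a b μ κ P ℱ w u T C K)
    (h : ℝ≥0) {i j : ℕ} (hij : i ≤ j) (hj : grid h j ≤ T) :
    energy μ P (martIncr a κ u (grid h i) (grid h j)) ≤
      ((grid h j - grid h i) * (noiseVar b * K) : ℝ≥0) := by
  have hle : ∀ m k, k < j * m → grid (h / m) k ≤ T := fun m k hk => (grid_div_le hk.le).trans hj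
  refine energy_le_of_tendstoInMeasure (f := fun m => riemannSum b w u h i j m)
    (fun m x => ?_) (fun x => H.tendsto_riemannSum h hij hj x) fun m => ?_
  · exact (Finset.measurable_fun_sum _ fun k _ => (H.solution.measurable _ x).mul
      ((measurable_noise_filtration H.brownian (grid_mono _ k.le_succ) x).mono
        (ℱ.le _) le_rfl)).aemeasurable
  · have e := energy_sum_noise H.brownian H.summable (h / m) μ
      (Y := fun k => u (grid (h / m) k)) (Nat.mul_le_mul_right m hij)
      (fun k _ hk x => H.memLp (hle m k hk) x) (fun k _ _ x => H.solution.adapted x _)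
    refine e.trans_le ?_
    calc ((h / m * noiseVar b : ℝ≥0) : ℝ≥0∞) *
          ∑ k ∈ Finset.Ico (i * m) (j * m), energy μ P (u (grid (h / m) k))
        ≤ (h / m * noiseVar b : ℝ≥0) * ∑ _k ∈ Finset.Ico (i * m) (j * m), (K : ℝ≥0∞) := by
          gcongr with k hk
          exact H.bound _ (hle m k (Finset.mem_Ico.mp hk).2)
      _ = (((grid (h / m) (j * m) - grid (h / m) (i * m)) * (noiseVar b * K) : ℝ≥0) : ℝ≥0∞) := by
          rw [Finset.sum_const, Nat.card_Ico, nsmul_eq_mul]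
          norm_cast
          simp only [grid]
          rw [← tsub_mul ((j * m : ℕ) : ℝ≥0), ← Nat.cast_tsub]
          ring
      _ ≤ _ := by
          rcases Nat.eq_zero_or_pos m with rfl | hm
          · simp [grid]
          · rw [grid_div h hm.ne', grid_div h hm.ne']

/-- A Hölder constant for the solution. -/
def holderConst (b : Lattice d → ℝ) (κ T C K : ℝ≥0) : ℝ≥0 :=
  2 * (noiseVar b * K) + 2 * (T * (κ ^ 2 * (2 * (C + 1)) * K))

lemma aemeasurable_martIncr (H : IsRegularSolution a b μ κ P ℱ w u T C K)
    (h : ℝ≥0) {i j : ℕ} (hij : i ≤ j) (hj : grid h j ≤ T) (x : Lattice d) :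
    AEMeasurable (martIncr a κ u (grid h i) (grid h j) x) P := by
  refine TendstoInMeasure.aemeasurable (fun m => ?_) (H.tendsto_riemannSum h hij hj x)
  exact (Finset.measurable_fun_sum _ fun k _ => (H.solution.measurable _ x).mul
      ((measurable_noise_filtration H.brownian (grid_mono _ k.le_succ) x).mono
        (ℱ.le _) le_rfl)).aemeasurable

lemma IsRegularSolution.energy_sub_grid_le (H : IsRegularSolution a b μ κ P ℱ w u T C K)
    (h : ℝ≥0) {i j : ℕ} (hij : i ≤ j) (hj : grid h j ≤ T) :
    energy μ P (fun x ω => u (grid h j) x ω - u (grid h i) x ω) ≤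
      ((grid h j - grid h i) * holderConst b κ T C K : ℝ≥0) := by
  have e1 := H.energy_martIncr_le h hij hj
  have e2 := (H.energy_drift_le (grid_mono h hij) hj).2
  have e3 := energy_add_le (μ := μ) 1 one_ne_zero (drift a κ u (grid h i) (grid h j))
    (fun x => aemeasurable_martIncr H h hij hj x)
  have e4 : (fun x ω => u (grid h j) x ω - u (grid h i) x ω) =
      fun x ω => martIncr a κ u (grid h i) (grid h j) x ω +
        drift a κ u (grid h i) (grid h j) x ω := by
    ext x ω
    simp [martIncr]
  rw [e4]
  refine e3.trans ?_
  rw [inv_one]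
  refine (add_le_add (mul_le_mul' le_rfl e1) (mul_le_mul' le_rfl e2)).trans ?_
  rw [← ENNReal.coe_mul, ← ENNReal.coe_mul, ← ENNReal.coe_add, ENNReal.coe_le_coe]
  set δ := grid h j - grid h i
  -- The drift contributes order δ²; one factor δ is bounded by T to get a bound linear in δ.
  have hδ : δ ≤ T := tsub_le_self.trans hj
  calc (1 + 1) * (δ * (noiseVar b * K)) + (1 + 1) * (δ ^ 2 * (κ ^ 2 * (2 * (C + 1)) * K))
      = δ * (2 * (noiseVar b * K) + 2 * (δ * (κ ^ 2 * (2 * (C + 1)) * K))) := by ring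
    _ ≤ _ := by
      unfold holderConst
      gcongr

/-- The grid estimate covers commensurable times. A general `s` is approached from below by grid
points, using path continuity and Fatou. -/
lemma IsRegularSolution.energy_sub_le (H : IsRegularSolution a b μ κ P ℱ w u T C K)
    {r s : ℝ≥0} (hrs : r ≤ s) (hs : s ≤ T) :
    energy μ P (fun x ω => u s x ω - u r x ω) ≤
      ((s - r) * holderConst b κ T C K : ℝ≥0) := by
  rcases eq_or_ne r 0 with rfl | hr
  · have := H.energy_sub_grid_le s (Nat.zero_le 1) (by simpa [grid] using hs)
    simpa [grid] using this
  -- The mesh r/(m+1) puts `r` at index m + 1, and `q m` is the index of the last grid point not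
  -- exceeding `s`.
  · set q : ℕ → ℕ := fun m => ⌊s / r * (m + 1 : ℕ)⌋₊ with hq
    have hgr : ∀ m : ℕ, grid (r / (m + 1 : ℕ)) (m + 1) = r := fun m => by
      have := grid_div r (Nat.succ_ne_zero m) 1
      simpa [grid] using this
    have hgs : ∀ m : ℕ, grid (r / (m + 1 : ℕ)) (q m) ≤ s := fun m => by
      have h1 : ((q m : ℕ) : ℝ≥0) ≤ s / r * (m + 1 : ℕ) := Nat.floor_le zero_le
      calc grid (r / (m + 1 : ℕ)) (q m) ≤ s / r * (m + 1 : ℕ) * (r / (m + 1 : ℕ)) := by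
            unfold grid; gcongr
        _ = s := by field_simp
    have hqm : ∀ m, m + 1 ≤ q m := fun m => by
      refine Nat.le_floor ?_
      refine le_mul_of_one_le_left zero_le ?_
      rwa [one_le_div₀ (pos_iff_ne_zero.mpr hr)]
    have hlim : Tendsto (fun m : ℕ => grid (r / (m + 1 : ℕ)) (q m)) atTop (𝓝 s) := by
      have h1 : Tendsto (fun n : ℕ => (⌊s / r * (n : ℝ≥0)⌋₊ : ℝ≥0) / n) atTop (𝓝 (s / r)) := by
        rw [← NNReal.tendsto_coe]
        refine ((tendsto_nat_floor_mul_div_atTop (NNReal.coe_nonneg (s / r))).comp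
          (tendsto_natCast_atTop_atTop (R := ℝ))).congr fun n => ?_
        have hfl : ⌊((s / r : ℝ≥0) : ℝ) * n⌋₊ = ⌊s / r * (n : ℝ≥0)⌋₊ :=
          Nonneg.nat_floor_coe (s / r * (n : ℝ≥0))
        rw [Function.comp_apply, hfl]
        push_cast
        rfl
      have h2 := ((h1.comp (tendsto_add_atTop_nat 1)).mul_const r)
      rw [div_mul_cancel₀ _ hr] at h2
      refine h2.congr fun m => ?_
      simp only [grid, hq, Function.comp]
      ring
    refine energy_le_of_tendstoInMeasure
      (f := fun m x ω => u (grid (r / (m + 1 : ℕ)) (q m)) x ω - u r x ω)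
      (fun m x => ((H.solution.measurable _ x).sub (H.solution.measurable _ x)).aemeasurable)
      (fun x => ?_) fun m => ?_
    · refine tendstoInMeasure_of_tendsto_ae
        (fun m => ((H.solution.measurable _ x).sub
          (H.solution.measurable _ x)).aestronglyMeasurable) ?_
      filter_upwards [H.solution.continuous_paths x] with ω hω
      exact ((hω.tendsto s).comp hlim).sub_const _
    · have := H.energy_sub_grid_le (r / (m + 1 : ℕ)) (hqm m) ((hgs m).trans hs)
      rw [hgr] at this
      refine this.trans ?_
      gcongr
      exact hgs m

end Regularity

/-! ### Convergence of the scheme -/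

section Summability

set_option linter.unusedSectionVars false

variable {Ω : Type*} {mΩ : MeasurableSpace Ω} {P : Measure Ω} {d : ℕ} {a μ : Lattice d → ℝ}

lemma stepAvg_eq_of_summable (ha : IsJumpKernel a) {f : Lattice d → ℝ} {x : Lattice d}
    (hf : Summable fun z => a z * f (x + z)) (τ : ℝ) :
    stepAvg a τ f x = f x + τ * nonlocalLaplacian a f x := by
  have h2 := (hasSum_ite_eq (0 : Lattice d) ((1 - τ) * f x)).add (hf.hasSum.mul_left τ)
  have h3 : nonlocalLaplacian a f x = ∑' z, a z * f (x + z) - f x := by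
    have e : ∑' z, a z * f x = f x := by rw [(ha.hasSum_one.mul_right (f x)).tsum_eq, one_mul]
    rw [nonlocalLaplacian]
    simp only [mul_sub]
    rw [hf.tsum_sub (ha.hasSum_one.mul_right (f x)).summable, e]
  rw [h3, stepAvg]
  have h4 : ∑' z, stepKernel a τ z * f (x + z) = (1 - τ) * f x + τ * ∑' z, a z * f (x + z) := by
    rw [← h2.tsum_eq]
    refine tsum_congr fun z => ?_
    by_cases hz : z = 0
    · simp [hz, stepKernel]; ring
    · simp [hz, stepKernel]; ring
  rw [h4]
  ring

lemma nonlocalLaplacian_sub (ha : IsJumpKernel a) {f g : Lattice d → ℝ} {x : Lattice d}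
    (hf : Summable fun z => a z * f (x + z)) (hg : Summable fun z => a z * g (x + z)) :
    nonlocalLaplacian a (fun y => f y - g y) x =
      nonlocalLaplacian a f x - nonlocalLaplacian a g x := by
  have h1 := (ha.hasSum_one.mul_right (f x)).summable
  have h2 := (ha.hasSum_one.mul_right (g x)).summable
  simp only [nonlocalLaplacian]
  rw [← Summable.tsum_sub (by simpa only [mul_sub] using hf.sub h1)
    (by simpa only [mul_sub] using hg.sub h2)]
  exact tsum_congr fun z => by ring

lemma summable_of_avg_sq_ne_top (ha : IsJumpKernel a) {f : Lattice d → ℝ} {x : Lattice d}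
    (h : avg (fun z => ENNReal.ofReal (a z)) (fun y => ‖f y‖ₑ ^ 2) x ≠ ∞) :
    Summable fun z => a z * f (x + z) := by
  have hK : ∑' z, ENNReal.ofReal (a z) = 1 := by
    rw [← ENNReal.ofReal_tsum_of_nonneg ha.nonneg ha.hasSum_one.summable, ha.hasSum_one.tsum_eq,
      ENNReal.ofReal_one]
  refine summable_of_tsum_enorm_ne_top ?_
  have e : ∑' z, ‖a z * f (x + z)‖ₑ =
      avg (fun z => ENNReal.ofReal (a z)) (fun y => ‖f y‖ₑ) x :=
    tsum_congr fun z => by rw [enorm_mul, Real.enorm_of_nonneg (ha.nonneg z)]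
  rw [e]
  intro hn
  have := sq_avg_le hK (fun y => ‖f y‖ₑ) x
  rw [hn] at this
  exact h (top_le_iff.mp (by simpa using this))

lemma ae_avg_sq_ne_top {C : ℝ≥0} (hC : IsConvBound a μ C)
    (hμ : ∀ x, 0 < μ x) {f : Lattice d → Ω → ℝ} (hf : ∀ x, AEMeasurable (f x) P)
    (hfe : energy μ P f ≠ ∞) (x : Lattice d) :
    ∀ᵐ ω ∂P, avg (fun z => ENNReal.ofReal (a z)) (fun y => ‖f y ω‖ₑ ^ 2) x ≠ ∞ := by
  have h1 : ∑' x, ENNReal.ofReal (μ x) *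
      avg (fun z => ENNReal.ofReal (a z)) (fun y => ∫⁻ ω, ‖f y ω‖ₑ ^ 2 ∂P) x < ∞ := by
    rw [tsum_weight_avg]
    calc _ ≤ ∑' y, (C * ENNReal.ofReal (μ y)) * ∫⁻ ω, ‖f y ω‖ₑ ^ 2 ∂P := by
          gcongr
          exact hC _
      _ = C * energy μ P f := by
          simp only [mul_assoc, ENNReal.tsum_mul_left]
          rfl
      _ < ∞ := ENNReal.mul_lt_top ENNReal.coe_lt_top hfe.lt_top
  have h2 : ∫⁻ ω, avg (fun z => ENNReal.ofReal (a z)) (fun y => ‖f y ω‖ₑ ^ 2) x ∂P ≠ ∞ := by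
    rw [lintegral_avg _ fun y => (hf y).enorm.pow_const 2]
    intro hn
    have h3 := (ENNReal.le_tsum x).trans_lt h1
    rw [hn, ENNReal.mul_top (by simpa using hμ x)] at h3
    exact lt_irrefl _ h3
  have hm : AEMeasurable
      (fun ω => avg (fun z => ENNReal.ofReal (a z)) (fun y => ‖f y ω‖ₑ ^ 2) x) P :=
    AEMeasurable.tsum fun z => ((hf _).enorm.pow_const 2).const_mul _
  filter_upwards [ae_lt_top' hm h2] with ω hω using hω.ne

lemma ae_summable_shift (ha : IsJumpKernel a) {C : ℝ≥0} (hC : IsConvBound a μ C)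
    (hμ : ∀ x, 0 < μ x) {f : Lattice d → Ω → ℝ} (hf : ∀ x, AEMeasurable (f x) P)
    (hfe : energy μ P f ≠ ∞) (x : Lattice d) :
    ∀ᵐ ω ∂P, Summable fun z => a z * f (x + z) ω := by
  filter_upwards [ae_avg_sq_ne_top hC hμ hf hfe x] with ω hω
  exact summable_of_avg_sq_ne_top ha (f := fun y => f y ω) hω

end Summability

/-! ### Freezing the drift and the real-valued scheme. -/

section Convergence

set_option linter.unusedSectionVars false

variable {Ω : Type*} {mΩ : MeasurableSpace Ω} {P : Measure Ω} {d : ℕ} [IsProbabilityMeasure P]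
  {ℱ : Filtration ℝ≥0 mΩ} {w : Lattice d → ℝ≥0 → Ω → ℝ} {a b μ : Lattice d → ℝ} {κ : ℝ≥0}
  {u : ℝ≥0 → Lattice d → Ω → ℝ} {T C K : ℝ≥0}

/-- The deviation of the drift over `[r, t]` from its value for the solution frozen at time `r`. -/
def driftError (a : Lattice d → ℝ) (κ : ℝ≥0) (u : ℝ≥0 → Lattice d → Ω → ℝ) (r t : ℝ≥0)
    (x : Lattice d) (ω : Ω) : ℝ :=
  ∫ s in (r : ℝ)..t, κ * nonlocalLaplacian a (fun y => u s.toNNReal y ω - u r y ω) x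

lemma IsRegularSolution.energy_driftError_le (H : IsRegularSolution a b μ κ P ℱ w u T C K)
    {r t : ℝ≥0} (hrt : r ≤ t) (ht : t ≤ T) :
    energy μ P (driftError a κ u r t) ≤
      ((t - r) ^ 2 * (κ ^ 2 * (2 * (C + 1)) * ((t - r) * holderConst b κ T C K)) : ℝ≥0) := by
  refine (H.drift_bounds hrt (u r) (fun x => H.solution.measurable r x) fun s hs hst => ?_).2
  refine (H.energy_sub_le hs (hst.trans ht)).trans ?_
  gcongr

lemma IsRegularSolution.energy_ne_top (H : IsRegularSolution a b μ κ P ℱ w u T C K)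
    {t : ℝ≥0} (ht : t ≤ T) : energy μ P (u t) ≠ ∞ :=
  ((H.bound t ht).trans_lt ENNReal.coe_lt_top).ne

lemma IsRegularSolution.ae_summable (H : IsRegularSolution a b μ κ P ℱ w u T C K)
    {t : ℝ≥0} (ht : t ≤ T) (x : Lattice d) :
    ∀ᵐ ω ∂P, Summable fun z => a z * u t (x + z) ω :=
  ae_summable_shift H.kernel H.conv H.weight_pos
    (fun y => (H.solution.measurable t y).aemeasurable) (H.energy_ne_top ht) x

/-- For each fixed time summability holds almost surely; Fubini, applied to the jointly measurable
modification, exchanges the order of the two quantifiers. -/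
lemma IsRegularSolution.ae_ae_summable (H : IsRegularSolution a b μ κ P ℱ w u T C K)
    {r t : ℝ≥0} (ht : t ≤ T) (x : Lattice d) :
    ∀ᵐ ω ∂P, ∀ᵐ s ∂(volume.restrict (Set.Ioc (r : ℝ) t)),
      Summable fun z => a z * u s.toNNReal (x + z) ω := by
  obtain ⟨v, hvm, hvc, hvu⟩ := H.solution.exists_modification
  have hm : Measurable fun q : Ω × ℝ =>
      avg (fun z => ENNReal.ofReal (a z)) (fun y => ‖v q.2.toNNReal y q.1‖ₑ ^ 2) x :=
    Measurable.tsum fun z => ((((measurable_modification hvm hvc _).comp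
      measurable_swap).enorm).pow_const 2).const_mul _
  have h1 : ∀ᵐ ω ∂P, ∀ᵐ s ∂(volume.restrict (Set.Ioc (r : ℝ) t)),
      avg (fun z => ENNReal.ofReal (a z)) (fun y => ‖v s.toNNReal y ω‖ₑ ^ 2) x ≠ ∞ := by
    rw [Measure.ae_ae_comm]
    · filter_upwards [ae_restrict_mem measurableSet_Ioc] with s hs
      have hsT : s.toNNReal ≤ T :=
        (Real.toNNReal_le_iff_le_coe.mpr hs.2).trans ht
      filter_upwards [hvu, ae_avg_sq_ne_top H.conv H.weight_pos
        (fun y => (H.solution.measurable s.toNNReal y).aemeasurable)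
        (H.energy_ne_top hsT) x] with ω h1 h2
      simpa only [h1] using h2
    · exact hm (measurableSet_singleton ∞).compl
  filter_upwards [h1, hvu] with ω h2 h3
  filter_upwards [h2] with s hs
  refine summable_of_avg_sq_ne_top H.kernel (f := fun y => u s.toNNReal y ω) ?_
  simpa only [h3] using hs

lemma IsRegularSolution.ae_drift_eq (H : IsRegularSolution a b μ κ P ℱ w u T C K)
    {r t : ℝ≥0} (hrt : r ≤ t) (ht : t ≤ T) (x : Lattice d) :
    ∀ᵐ ω ∂P, drift a κ u r t x ω = driftError a κ u r t x ω +
      (t - r : ℝ≥0) * κ * nonlocalLaplacian a (fun y => u r y ω) x := by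
  have hK' : ∀ s : ℝ≥0, r ≤ s → s ≤ t → energy μ P (fun x ω => u s x ω - u r x ω) ≤
      (((t - r) * holderConst b κ T C K : ℝ≥0) : ℝ≥0∞) := fun s hs hst => by
    refine (H.energy_sub_le hs (hst.trans ht)).trans ?_
    gcongr
  have hi := (H.drift_bounds hrt (u r) (fun x => H.solution.measurable r x) hK').1 x
  filter_upwards [hi, H.ae_ae_summable ht x, H.ae_summable (hrt.trans ht) x] with ω h1 h2 h3
  have hrt' : (r : ℝ) ≤ t := by exact_mod_cast hrt
  have e : drift a κ u r t x ω = ∫ s in (r : ℝ)..t,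
      (κ * nonlocalLaplacian a (fun y => u s.toNNReal y ω - u r y ω) x +
        κ * nonlocalLaplacian a (fun y => u r y ω) x) := by
    rw [drift, intervalIntegral.integral_of_le hrt', intervalIntegral.integral_of_le hrt']
    refine integral_congr_ae ?_
    filter_upwards [h2] with s hs
    rw [nonlocalLaplacian_sub H.kernel (f := fun y => u s.toNNReal y ω) (g := fun y => u r y ω)
      hs h3]
    ring
  have e2 := intervalIntegral.integral_add h1 (intervalIntegrable_const
    (c := κ * nonlocalLaplacian a (fun y => u r y ω) x))
  rw [intervalIntegral.integral_const, smul_eq_mul] at e2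
  rw [e, e2, driftError, NNReal.coe_sub hrt, mul_assoc]

/-- The real-valued Euler scheme. -/
def realScheme (a b : Lattice d → ℝ) (κ : ℝ≥0) (w : Lattice d → ℝ≥0 → Ω → ℝ) (h : ℝ≥0) (k : ℕ)
    (x : Lattice d) (ω : Ω) : ℝ :=
  (scheme a b κ w h k x ω).toReal

lemma measurable_realScheme (hw : IsBrownianFamily P ℱ w) (κ h : ℝ≥0) (k : ℕ) (x : Lattice d) :
    Measurable[ℱ (grid h k)] (realScheme a b κ w h k x) :=
  (measurable_scheme_filtration hw (κ : ℝ) h k x).ennreal_toReal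

lemma lintegral_realScheme_pow_le (ha : IsJumpKernel a) (hb : Summable fun z => |b z|)
    (hw : IsBrownianFamily P ℱ w) {κ h : ℝ≥0} (h1 : h * κ ≤ 1) (k q : ℕ) (x : Lattice d) :
    ∫⁻ ω, ‖realScheme a b κ w h k x ω‖ₑ ^ q ∂P ≤
      ENNReal.ofReal (Real.exp (grid h k * momentRate b q)) := by
  have e := lintegral_scheme_pow (a := a) hw hb κ h k q x
  have h1' : (h : ℝ) * κ ≤ 1 := by exact_mod_cast h1
  have e2 := discreteMoment_le ha hb (NNReal.coe_nonneg κ) (NNReal.coe_nonneg h) h1' q k 0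
  calc ∫⁻ ω, ‖realScheme a b κ w h k x ω‖ₑ ^ q ∂P ≤ ∫⁻ ω, scheme a b κ w h k x ω ^ q ∂P := by
        refine lintegral_mono fun ω => pow_le_pow_left₀ zero_le ?_ q
        rw [realScheme, Real.enorm_of_nonneg ENNReal.toReal_nonneg]
        exact ENNReal.ofReal_toReal_le
    _ ≤ _ := by
        rw [e]
        refine e2.trans_eq ?_
        simp [grid]

lemma energy_realScheme_le (H : IsRegularSolution a b μ κ P ℱ w u T C K) {h : ℝ≥0}
    (h1 : h * κ ≤ 1) {k : ℕ} (hk : grid h k ≤ T) :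
    energy μ P (realScheme a b κ w h k) ≤
      ((∑' x, μ x).toNNReal * (Real.exp (T * momentRate b 2)).toNNReal : ℝ≥0) := by
  calc energy μ P (realScheme a b κ w h k)
      ≤ ∑' x, ENNReal.ofReal (μ x) * ENNReal.ofReal (Real.exp (T * momentRate b 2)) := by
        refine ENNReal.tsum_le_tsum fun x => ?_
        gcongr
        refine (lintegral_realScheme_pow_le H.kernel H.summable H.brownian h1 k 2 x).trans ?_
        have := momentRate_nonneg b 2
        gcongr
    _ = _ := by
        rw [ENNReal.tsum_mul_right, ENNReal.coe_mul,
          ← ENNReal.ofReal_tsum_of_nonneg (fun x => (H.weight_pos x).le) H.weight_summable]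
        rfl

lemma ae_scheme_ne_top (ha : IsJumpKernel a) (hb : Summable fun z => |b z|)
    (hw : IsBrownianFamily P ℱ w) {κ h : ℝ≥0} (h1 : h * κ ≤ 1) (k : ℕ) :
    ∀ᵐ ω ∂P, ∀ x, scheme a b κ w h k x ω ≠ ∞ := by
  rw [ae_all_iff]
  intro x
  have e := lintegral_scheme_pow (a := a) hw hb κ h k 1 x
  have h1' : (h : ℝ) * κ ≤ 1 := by exact_mod_cast h1
  have e2 := discreteMoment_le ha hb κ.2 h.2 h1' 1 k 0
  simp only [pow_one] at e
  filter_upwards [ae_lt_top (measurable_scheme hw κ h k x)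
    (by rw [e]; exact (e2.trans_lt ENNReal.ofReal_lt_top).ne)] with ω hω using hω.ne

/-- The multiplicative noise factor is split as 1 + noise + remainder, matching the additive Itô
increment of the solution. -/
lemma ae_realScheme_succ (ha : IsJumpKernel a) (hb : Summable fun z => |b z|)
    (hw : IsBrownianFamily P ℱ w) {κ h : ℝ≥0} (h1 : h * κ ≤ 1) (k : ℕ) (x : Lattice d) :
    ∀ᵐ ω ∂P, realScheme a b κ w h (k + 1) x ω =
      (expRemainder b w (grid h k) (grid h (k + 1)) x ω + 1 +
        noise b w (grid h k) (grid h (k + 1)) x ω) *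
          stepAvg a ((h * κ : ℝ≥0) : ℝ) (fun y => realScheme a b κ w h k y ω) x := by
  filter_upwards [ae_scheme_ne_top ha hb hw h1 k] with ω hω
  have h1' : (h : ℝ) * κ ≤ 1 := by exact_mod_cast h1
  rw [realScheme, scheme, ENNReal.toReal_mul, ENNReal.toReal_ofReal (Real.exp_pos _).le,
    expRemainder, grid_succ_sub, avg, ENNReal.tsum_toReal_eq
      (fun z => ENNReal.mul_ne_top (by simp [stepKernelE]) (hω _))]
  have e : ∀ y z : ℝ, y - 1 - z + 1 + z = y := fun y z => by ring
  rw [e, stepAvg]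
  congr 1
  refine tsum_congr fun z => ?_
  rw [ENNReal.toReal_mul, stepKernelE, realScheme, NNReal.coe_mul, ENNReal.toReal_ofReal
    (stepKernel_nonneg ha (mul_nonneg (NNReal.coe_nonneg h) (NNReal.coe_nonneg κ)) h1' z)]

/-- The error of the Euler scheme. -/
def schemeError (a b : Lattice d → ℝ) (κ : ℝ≥0) (w : Lattice d → ℝ≥0 → Ω → ℝ)
    (u : ℝ≥0 → Lattice d → Ω → ℝ) (h : ℝ≥0) (k : ℕ) (x : Lattice d) (ω : Ω) : ℝ :=
  u (grid h k) x ω - realScheme a b κ w h k x ω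

end Convergence

/-! ### Error of one step of the scheme. -/

section OneStep

set_option linter.unusedSectionVars false

variable {Ω : Type*} {mΩ : MeasurableSpace Ω} {P : Measure Ω} {d : ℕ} [IsProbabilityMeasure P]
  {ℱ : Filtration ℝ≥0 mΩ} {w : Lattice d → ℝ≥0 → Ω → ℝ} {a b μ : Lattice d → ℝ} {κ : ℝ≥0}
  {u : ℝ≥0 → Lattice d → Ω → ℝ} {T C K : ℝ≥0}

lemma measurable_stepAvg {m : MeasurableSpace Ω} {f : Lattice d → Ω → ℝ}
    (hf : ∀ x, Measurable[m] (f x)) (τ : ℝ) (x : Lattice d) :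
    Measurable[m] fun ω => stepAvg a τ (fun y => f y ω) x :=
  Measurable.tsum fun _ => (hf _).const_mul _

/-- The Riemann sums of `∫ (u(s) - u(grid h k)) dW(s)` over one step of the grid. -/
def frozenSum (b : Lattice d → ℝ) (w : Lattice d → ℝ≥0 → Ω → ℝ) (u : ℝ≥0 → Lattice d → Ω → ℝ)
    (h : ℝ≥0) (k m : ℕ) (x : Lattice d) (ω : Ω) : ℝ :=
  ∑ j ∈ Finset.Ico (k * m) ((k + 1) * m), (u (grid (h / m) j) x ω - u (grid h k) x ω) *
    noise b w (grid (h / m) j) (grid (h / m) (j + 1)) x ω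

lemma le_grid_div {h : ℝ≥0} {k m j : ℕ} (hm : m ≠ 0) (hj : k * m ≤ j) :
    grid h k ≤ grid (h / m) j := by
  rw [← grid_div h hm k]
  exact grid_mono _ hj

lemma IsRegularSolution.isCentered_frozenSum (H : IsRegularSolution a b μ κ P ℱ w u T C K)
    {h : ℝ≥0} {k : ℕ} (hk : grid h (k + 1) ≤ T) (m : ℕ) (x : Lattice d) :
    IsCentered P (ℱ (grid h k)) (frozenSum b w u h k m x) := by
  rcases eq_or_ne m 0 with rfl | hm
  · have : frozenSum b w u h k 0 x = fun _ => 0 := by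
      ext ω
      simp [frozenSum]
    rw [this]
    exact IsCentered.zero _
  · have hkT : grid h k ≤ T := (grid_mono h k.le_succ).trans hk
    have := (isCentered_sum_noise H.brownian H.summable (h / m) x
      (Y := fun j ω => u (grid (h / m) j) x ω - u (grid h k) x ω)
      (Nat.mul_le_mul_right m k.le_succ)
      (fun j _ hj => (H.memLp ((grid_div_le hj.le).trans hk) x).sub (H.memLp hkT x))
      (fun j hj _ => (H.solution.adapted x _).sub
        ((H.solution.adapted x _).mono (ℱ.mono (le_grid_div hm hj)) le_rfl))).2.1
    rwa [grid_div h hm] at this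

/-- The integrand u(s) - u(k h) has energy O(h), and the isometry over a step of length h
contributes another factor h. -/
lemma IsRegularSolution.energy_frozenSum_le (H : IsRegularSolution a b μ κ P ℱ w u T C K)
    {h : ℝ≥0} {k : ℕ} (hk : grid h (k + 1) ≤ T) (m : ℕ) :
    energy μ P (frozenSum b w u h k m) ≤
      (h ^ 2 * (noiseVar b * holderConst b κ T C K) : ℝ≥0) := by
  rcases eq_or_ne m 0 with rfl | hm
  · have : frozenSum b w u h k 0 = fun _ _ => 0 := by
      ext x ω
      simp [frozenSum]
    rw [this]
    simp [energy]
  · have hkT : grid h k ≤ T := (grid_mono h k.le_succ).trans hk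
    have e := energy_sum_noise H.brownian H.summable (h / m) μ
      (Y := fun j x ω => u (grid (h / m) j) x ω - u (grid h k) x ω)
      (Nat.mul_le_mul_right m k.le_succ)
      (fun j _ hj x => (H.memLp ((grid_div_le hj.le).trans hk) x).sub (H.memLp hkT x))
      (fun j hj _ x => (H.solution.adapted x _).sub
        ((H.solution.adapted x _).mono (ℱ.mono (le_grid_div hm hj)) le_rfl))
    refine e.trans_le ?_
    calc _ ≤ ((h / m * noiseVar b : ℝ≥0) : ℝ≥0∞) *
          ∑ j ∈ Finset.Ico (k * m) ((k + 1) * m), ((h * holderConst b κ T C K : ℝ≥0) : ℝ≥0∞) := by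
          gcongr with j hj
          rw [Finset.mem_Ico] at hj
          have h1 : grid (h / m) j ≤ grid h (k + 1) := grid_div_le hj.2.le
          refine (H.energy_sub_le (le_grid_div hm hj.1) (h1.trans hk)).trans ?_
          gcongr
          exact (tsub_le_tsub_right h1 _).trans (grid_succ_sub h k).le
      _ = _ := by
          have hm' : (m : ℝ≥0) ≠ 0 := by exact_mod_cast hm
          rw [Finset.sum_const, Nat.card_Ico, ← Nat.sub_mul, Nat.add_sub_cancel_left, one_mul,
            nsmul_eq_mul, ← ENNReal.coe_natCast, ← ENNReal.coe_mul, ← ENNReal.coe_mul]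
          congr 1
          field_simp

/-- A bound for the energy of the scheme up to time `T`. -/
def schemeBound (b μ : Lattice d → ℝ) (T : ℝ≥0) : ℝ≥0 :=
  (∑' x, μ x).toNNReal * (Real.exp (T * momentRate b 2)).toNNReal

lemma measurable_realScheme' (hw : IsBrownianFamily P ℱ w) (κ h : ℝ≥0) (k : ℕ) (x : Lattice d) :
    Measurable (realScheme a b κ w h k x) :=
  (measurable_realScheme hw κ h k x).mono (ℱ.le _) le_rfl

lemma ae_summable_realScheme (H : IsRegularSolution a b μ κ P ℱ w u T C K) {h : ℝ≥0}
    (h1 : h * κ ≤ 1) {k : ℕ} (hk : grid h k ≤ T) (x : Lattice d) :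
    ∀ᵐ ω ∂P, Summable fun z => a z * realScheme a b κ w h k (x + z) ω :=
  ae_summable_shift H.kernel H.conv H.weight_pos
    (fun y => (measurable_realScheme' H.brownian κ h k y).aemeasurable)
    ((energy_realScheme_le H h1 hk).trans_lt ENNReal.coe_lt_top).ne x

lemma energy_stepAvg_realScheme_le (H : IsRegularSolution a b μ κ P ℱ w u T C K) {h : ℝ≥0}
    (h1 : h * κ ≤ 1) {k : ℕ} (hk : grid h k ≤ T) :
    energy μ P (fun x ω => stepAvg a ((h * κ : ℝ≥0) : ℝ) (fun y => realScheme a b κ w h k y ω) x) ≤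
      ((1 + C) * schemeBound b μ T : ℝ≥0) := by
  refine (energy_stepAvg_le H.kernel H.conv h1
    fun y => (measurable_realScheme' H.brownian κ h k y).aemeasurable).trans ?_
  rw [ENNReal.coe_mul]
  gcongr
  · exact mul_le_of_le_one_left zero_le h1
  · exact energy_realScheme_le H h1 hk

/-- The quantity is the current error minus hϰℒ applied to the scheme; the latter has energy O(h²).
-/
lemma energy_sub_stepAvg_realScheme_le (H : IsRegularSolution a b μ κ P ℱ w u T C K) {h : ℝ≥0}
    (h1 : h * κ ≤ 1) {k : ℕ} (hk : grid h k ≤ T) :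
    energy μ P (fun x ω => u (grid h k) x ω -
      stepAvg a ((h * κ : ℝ≥0) : ℝ) (fun y => realScheme a b κ w h k y ω) x) ≤
      2 * energy μ P (schemeError a b κ w u h k) +
        (2 * ((h * κ) ^ 2 * (2 * (C + 1)) * schemeBound b μ T) : ℝ≥0) := by
  have hm := fun y => (measurable_realScheme' (a := a) (b := b) H.brownian κ h k y)
  have e : energy μ P (fun x ω => u (grid h k) x ω -
      stepAvg a ((h * κ : ℝ≥0) : ℝ) (fun y => realScheme a b κ w h k y ω) x) =
      energy μ P (fun x ω => schemeError a b κ w u h k x ω + -(((h * κ : ℝ≥0) : ℝ) *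
        nonlocalLaplacian a (fun y => realScheme a b κ w h k y ω) x)) := by
    refine energy_congr fun x => ?_
    filter_upwards [ae_summable_realScheme H h1 hk x] with ω hω
    rw [stepAvg_eq_of_summable H.kernel (f := fun y => realScheme a b κ w h k y ω) hω, schemeError]
    ring
  rw [e]
  refine (energy_add_le 1 one_ne_zero _ (f := schemeError a b κ w u h k) fun x =>
    ((H.solution.measurable _ x).sub (hm x)).aemeasurable).trans ?_
  have e2 : (1 + 1 : ℝ≥0) = 2 := by norm_num
  rw [inv_one, e2, ENNReal.coe_ofNat, ENNReal.coe_mul, ENNReal.coe_ofNat]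
  gcongr
  have e3 : energy μ P (fun x ω => -(((h * κ : ℝ≥0) : ℝ) *
        nonlocalLaplacian a (fun y => realScheme a b κ w h k y ω) x)) =
      energy μ P (fun x ω => ((h * κ : ℝ≥0) : ℝ) *
        nonlocalLaplacian a (fun y => realScheme a b κ w h k y ω) x) := by
    simp only [energy, enorm_neg]
  rw [e3]
  refine (energy_const_mul_le _ _).trans ?_
  rw [mul_assoc, ENNReal.coe_mul]
  gcongr
  refine (energy_nonlocalLaplacian_le H.kernel H.conv fun y => (hm y).aemeasurable).trans ?_
  rw [ENNReal.coe_mul (2 * (C + 1))]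
  gcongr
  exact energy_realScheme_le H h1 hk

/-- The part of the martingale increment of the error that comes from freezing the coefficients
at time `grid h k`. -/
def frozenPart (a b : Lattice d → ℝ) (κ : ℝ≥0) (w : Lattice d → ℝ≥0 → Ω → ℝ)
    (u : ℝ≥0 → Lattice d → Ω → ℝ) (h : ℝ≥0) (k : ℕ) (x : Lattice d) (ω : Ω) : ℝ :=
  (u (grid h k) x ω - stepAvg a ((h * κ : ℝ≥0) : ℝ) (fun y => realScheme a b κ w h k y ω) x) *
      noise b w (grid h k) (grid h (k + 1)) x ω -
    stepAvg a ((h * κ : ℝ≥0) : ℝ) (fun y => realScheme a b κ w h k y ω) x *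
      expRemainder b w (grid h k) (grid h (k + 1)) x ω

lemma memLp_stepAvg {f : Lattice d → Ω → ℝ} (H : IsRegularSolution a b μ κ P ℱ w u T C K)
    {τ : ℝ≥0} (hτ : τ ≤ 1) (hf : ∀ x, Measurable (f x)) (hfe : energy μ P f ≠ ∞) (x : Lattice d) :
    MemLp (fun ω => stepAvg a τ (fun y => f y ω) x) 2 P := by
  refine memLp_two_of_lintegral (measurable_stepAvg hf τ x).aestronglyMeasurable ?_
  refine lintegral_sq_ne_top_of_energy (f := fun x ω => stepAvg a τ (fun y => f y ω) x)
    H.weight_pos ?_ x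
  exact ((energy_stepAvg_le H.kernel H.conv hτ fun y => (hf y).aemeasurable).trans_lt
    (ENNReal.mul_lt_top ENNReal.coe_lt_top hfe.lt_top)).ne

lemma memLp_stepAvg_realScheme (H : IsRegularSolution a b μ κ P ℱ w u T C K) {h : ℝ≥0}
    (h1 : h * κ ≤ 1) {k : ℕ} (hk : grid h k ≤ T) (x : Lattice d) :
    MemLp (fun ω => stepAvg a ((h * κ : ℝ≥0) : ℝ) (fun y => realScheme a b κ w h k y ω) x) 2 P :=
  memLp_stepAvg H h1 (fun y => measurable_realScheme' H.brownian κ h k y)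
    ((energy_realScheme_le H h1 hk).trans_lt ENNReal.coe_lt_top).ne x

lemma isCentered_frozenPart (H : IsRegularSolution a b μ κ P ℱ w u T C K) {h : ℝ≥0}
    (h1 : h * κ ≤ 1) (h2 : h * noiseVar b ≤ 1) {k : ℕ} (hk : grid h (k + 1) ≤ T) (x : Lattice d) :
    IsCentered P (ℱ (grid h k)) (frozenPart a b κ w u h k x) ∧
      ∫⁻ ω, ‖frozenPart a b κ w u h k x ω‖ₑ ^ 2 ∂P ≤
        (2 * (h * noiseVar b) : ℝ≥0) * ∫⁻ ω, ‖u (grid h k) x ω -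
          stepAvg a ((h * κ : ℝ≥0) : ℝ) (fun y => realScheme a b κ w h k y ω) x‖ₑ ^ 2 ∂P +
        (2 * (h * noiseVar b) ^ 2 : ℝ≥0) * ∫⁻ ω,
          ‖stepAvg a ((h * κ : ℝ≥0) : ℝ) (fun y => realScheme a b κ w h k y ω) x‖ₑ ^ 2 ∂P := by
  have hle := grid_mono h k.le_succ
  have hkT : grid h k ≤ T := hle.trans hk
  have hVm := measurable_stepAvg (a := a)
    (measurable_realScheme (a := a) (b := b) H.brownian κ h k) ((h * κ : ℝ≥0) : ℝ) x
  have hV := memLp_stepAvg_realScheme H h1 hkT x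
  obtain ⟨c1, e1⟩ := isCentered_mul_noise H.brownian H.summable hle x
    ((H.memLp hkT x).sub hV) ((H.solution.adapted x _).sub hVm)
  obtain ⟨c2, e2⟩ := isCentered_mul_expRemainder H.brownian H.summable hle
    (by rwa [grid_succ_sub]) x hV hVm
  rw [grid_succ_sub] at e1 e2
  refine ⟨c1.sub c2, ?_⟩
  have h3 : ∀ ω, ‖frozenPart a b κ w u h k x ω‖ₑ ^ 2 ≤
      2 * ‖(u (grid h k) x ω - stepAvg a ((h * κ : ℝ≥0) : ℝ)
        (fun y => realScheme a b κ w h k y ω) x) *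
        noise b w (grid h k) (grid h (k + 1)) x ω‖ₑ ^ 2 +
      2 * ‖stepAvg a ((h * κ : ℝ≥0) : ℝ) (fun y => realScheme a b κ w h k y ω) x *
        expRemainder b w (grid h k) (grid h (k + 1)) x ω‖ₑ ^ 2 := fun ω => by
    have := enorm_add_sq_le 1 one_ne_zero ((u (grid h k) x ω - stepAvg a ((h * κ : ℝ≥0) : ℝ)
        (fun y => realScheme a b κ w h k y ω) x) *
        noise b w (grid h k) (grid h (k + 1)) x ω)
      (-(stepAvg a ((h * κ : ℝ≥0) : ℝ) (fun y => realScheme a b κ w h k y ω) x *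
        expRemainder b w (grid h k) (grid h (k + 1)) x ω))
    have e2 : (1 + 1 : ℝ≥0) = 2 := by norm_num
    rwa [inv_one, e2, ENNReal.coe_ofNat, enorm_neg, ← sub_eq_add_neg] at this
  refine (lintegral_mono h3).trans ?_
  rw [lintegral_add_left', lintegral_const_mul' _ _ (by simp), lintegral_const_mul' _ _ (by simp)]
  · simp only [Pi.sub_apply] at e1
    rw [ENNReal.coe_mul 2 (h * noiseVar b), ENNReal.coe_mul 2 ((h * noiseVar b) ^ 2),
      ENNReal.coe_ofNat, mul_assoc, mul_assoc]
    exact add_le_add (mul_le_mul_right e1.le 2) (mul_le_mul_right e2 2)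
  · exact (c1.memLp.aestronglyMeasurable.aemeasurable.enorm.pow_const 2).const_mul 2

lemma energy_frozenPart_le (H : IsRegularSolution a b μ κ P ℱ w u T C K) {h : ℝ≥0} (hh : h ≤ 1)
    (h1 : h * κ ≤ 1) (h2 : h * noiseVar b ≤ 1) {k : ℕ} (hk : grid h (k + 1) ≤ T) {ε : ℝ≥0}
    (hε : energy μ P (schemeError a b κ w u h k) ≤ ε) :
    energy μ P (frozenPart a b κ w u h k) ≤
      (h * (4 * noiseVar b * ε) + h ^ 2 * (schemeBound b μ T * (1 + C) *
        (8 * noiseVar b * κ ^ 2 + 2 * noiseVar b ^ 2)) : ℝ≥0) := by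
  have hkT : grid h k ≤ T := (grid_mono h k.le_succ).trans hk
  have e1 := energy_sub_stepAvg_realScheme_le H h1 hkT
  have e2 := energy_stepAvg_realScheme_le H h1 hkT
  calc energy μ P (frozenPart a b κ w u h k) ≤
      (2 * (h * noiseVar b) : ℝ≥0) * energy μ P (fun x ω => u (grid h k) x ω -
          stepAvg a ((h * κ : ℝ≥0) : ℝ) (fun y => realScheme a b κ w h k y ω) x) +
      (2 * (h * noiseVar b) ^ 2 : ℝ≥0) * energy μ P (fun x ω =>
          stepAvg a ((h * κ : ℝ≥0) : ℝ) (fun y => realScheme a b κ w h k y ω) x) := by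
        simp only [energy]
        rw [← ENNReal.tsum_mul_left, ← ENNReal.tsum_mul_left, ← ENNReal.tsum_add]
        refine ENNReal.tsum_le_tsum fun x => ?_
        rw [mul_left_comm, mul_left_comm _ (ENNReal.ofReal (μ x)), ← mul_add]
        gcongr
        exact (isCentered_frozenPart H h1 h2 hk x).2
    _ ≤ (2 * (h * noiseVar b) : ℝ≥0) * (2 * (ε : ℝ≥0∞) +
          (2 * ((h * κ) ^ 2 * (2 * (C + 1)) * schemeBound b μ T) : ℝ≥0)) +
      (2 * (h * noiseVar b) ^ 2 : ℝ≥0) * ((1 + C) * schemeBound b μ T : ℝ≥0) := by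
        gcongr
        exact e1.trans (by gcongr)
    _ = ((2 * (h * noiseVar b)) * (2 * ε + 2 * ((h * κ) ^ 2 * (2 * (C + 1)) * schemeBound b μ T)) +
          (2 * (h * noiseVar b) ^ 2) * ((1 + C) * schemeBound b μ T) : ℝ≥0) := by
        push_cast
        rfl
    _ ≤ _ := by
        rw [ENNReal.coe_le_coe]
        have h3 : h ^ 3 ≤ h ^ 2 := pow_le_pow_of_le_one zero_le hh (by norm_num)
        calc _ = h * (4 * noiseVar b * ε) + (h ^ 3 * (schemeBound b μ T * (1 + C) *
                (8 * noiseVar b * κ ^ 2)) + h ^ 2 * (schemeBound b μ T * (1 + C) *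
                (2 * noiseVar b ^ 2))) := by ring
          _ ≤ h * (4 * noiseVar b * ε) + (h ^ 2 * (schemeBound b μ T * (1 + C) *
                (8 * noiseVar b * κ ^ 2)) + h ^ 2 * (schemeBound b μ T * (1 + C) *
                (2 * noiseVar b ^ 2))) := by gcongr
          _ = _ := by ring

/-- The martingale part of one step of the error, with the drift frozen. -/
def errorStep (a b : Lattice d → ℝ) (κ : ℝ≥0) (w : Lattice d → ℝ≥0 → Ω → ℝ)
    (u : ℝ≥0 → Lattice d → Ω → ℝ) (h : ℝ≥0) (k : ℕ) (x : Lattice d) (ω : Ω) : ℝ :=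
  stepAvg a ((h * κ : ℝ≥0) : ℝ) (fun y => schemeError a b κ w u h k y ω) x +
    (martIncr a κ u (grid h k) (grid h (k + 1)) x ω -
      stepAvg a ((h * κ : ℝ≥0) : ℝ) (fun y => realScheme a b κ w h k y ω) x *
        noise b w (grid h k) (grid h (k + 1)) x ω -
      stepAvg a ((h * κ : ℝ≥0) : ℝ) (fun y => realScheme a b κ w h k y ω) x *
        expRemainder b w (grid h k) (grid h (k + 1)) x ω)

lemma IsRegularSolution.ae_schemeError_succ (H : IsRegularSolution a b μ κ P ℱ w u T C K)
    {h : ℝ≥0} (h1 : h * κ ≤ 1) {k : ℕ} (hk : grid h (k + 1) ≤ T) (x : Lattice d) :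
    ∀ᵐ ω ∂P, schemeError a b κ w u h (k + 1) x ω =
      errorStep a b κ w u h k x ω + driftError a κ u (grid h k) (grid h (k + 1)) x ω := by
  have hle := grid_mono h k.le_succ
  have hkT : grid h k ≤ T := hle.trans hk
  filter_upwards [ae_realScheme_succ H.kernel H.summable H.brownian h1 k x, H.ae_drift_eq hle hk x,
    H.ae_summable hkT x, ae_summable_realScheme H h1 hkT x] with ω e1 e2 s1 s2
  have s3 : Summable fun z => a z * schemeError a b κ w u h k (x + z) ω := by
    simpa only [schemeError, mul_sub] using s1.sub s2
  rw [Nat.succ_eq_add_one, grid_succ_sub] at e2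
  rw [schemeError, e1, errorStep, martIncr, e2,
    stepAvg_eq_of_summable H.kernel (f := fun y => schemeError a b κ w u h k y ω) s3,
    stepAvg_eq_of_summable H.kernel (f := fun y => realScheme a b κ w h k y ω) s2]
  have e3 : nonlocalLaplacian a (fun y => schemeError a b κ w u h k y ω) x =
      nonlocalLaplacian a (fun y => u (grid h k) y ω) x -
        nonlocalLaplacian a (fun y => realScheme a b κ w h k y ω) x :=
    nonlocalLaplacian_sub H.kernel (f := fun y => u (grid h k) y ω)
      (g := fun y => realScheme a b κ w h k y ω) s1 s2
  rw [e3, schemeError, NNReal.coe_mul]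
  ring

/-- In the Riemann sum of `u` over one step split u(s) = (u(s) - u(k h)) + u(k h). The frozen part
telescopes to u(k h) times the total noise increment and joins `frozenPart`. -/
lemma IsRegularSolution.tendsto_errorStep (H : IsRegularSolution a b μ κ P ℱ w u T C K)
    {h : ℝ≥0} {k : ℕ} (hk : grid h (k + 1) ≤ T) (x : Lattice d) :
    TendstoInMeasure P (fun m ω => stepAvg a ((h * κ : ℝ≥0) : ℝ)
      (fun y => schemeError a b κ w u h k y ω) x +
        (frozenSum b w u h k m x ω + frozenPart a b κ w u h k x ω)) atTop
      (errorStep a b κ w u h k x) := by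
  set V : Ω → ℝ := fun ω =>
    stepAvg a ((h * κ : ℝ≥0) : ℝ) (fun y => realScheme a b κ w h k y ω) x
  have h1 := H.tendsto_riemannSum h k.le_succ hk x
  have h2 := tendstoInMeasure_add (tendstoInMeasure_const (P := P) fun ω =>
    stepAvg a ((h * κ : ℝ≥0) : ℝ) (fun y => schemeError a b κ w u h k y ω) x)
    (tendstoInMeasure_sub (tendstoInMeasure_sub h1
      (tendstoInMeasure_const fun ω => V ω * noise b w (grid h k) (grid h (k + 1)) x ω))
      (tendstoInMeasure_const fun ω => V ω * expRemainder b w (grid h k) (grid h (k + 1)) x ω))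
  refine h2.congr' ?_ (Eventually.of_forall fun ω => rfl)
  filter_upwards [eventually_ne_atTop 0] with m hm
  filter_upwards [ae_sum_noise H.brownian H.summable (h / m) x
    (Nat.mul_le_mul_right m k.le_succ)] with ω hω
  rw [grid_div h hm, grid_div h hm] at hω
  have e : riemannSum b w u h k k.succ m x ω = frozenSum b w u h k m x ω +
      u (grid h k) x ω * noise b w (grid h k) (grid h (k + 1)) x ω := by
    rw [← hω, Finset.mul_sum, frozenSum, riemannSum, ← Finset.sum_add_distrib]
    exact Finset.sum_congr rfl fun j _ => by ring
  simp only [e, frozenPart, V]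
  ring

lemma measurable_schemeError (H : IsRegularSolution a b μ κ P ℱ w u T C K) (h : ℝ≥0) (k : ℕ)
    (x : Lattice d) : Measurable[ℱ (grid h k)] (schemeError a b κ w u h k x) :=
  (H.solution.adapted x _).sub (measurable_realScheme H.brownian κ h k x)

/-- The averaged old error is measurable at time k h and the noise terms are centered given that
time, so their energies add without a cross term. Hence the coefficient of ε is 1 + O(h), as a
discrete Gronwall argument needs. Orthogonality is used for the Riemann approximations, and the
bound is then passed to the limit. -/
lemma IsRegularSolution.energy_errorStep_le (H : IsRegularSolution a b μ κ P ℱ w u T C K)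
    {h : ℝ≥0} (hh : h ≤ 1) (h1 : h * κ ≤ 1) (h2 : h * noiseVar b ≤ 1) {k : ℕ}
    (hk : grid h (k + 1) ≤ T) {ε : ℝ≥0} (hε : energy μ P (schemeError a b κ w u h k) ≤ ε) :
    energy μ P (errorStep a b κ w u h k) ≤ ((1 + h * (κ * C + 8 * noiseVar b)) * ε + h ^ 2 *
      (2 * (noiseVar b * holderConst b κ T C K) + schemeBound b μ T * (1 + C) *
        (16 * noiseVar b * κ ^ 2 + 4 * noiseVar b ^ 2)) : ℝ≥0) := by
  have hm := fun x => measurable_schemeError H h k x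
  have hm' := fun x => (hm x).mono (ℱ.le _) le_rfl
  have hεt : energy μ P (schemeError a b κ w u h k) ≠ ∞ := (hε.trans_lt ENNReal.coe_lt_top).ne
  have hS := fun x => memLp_stepAvg H h1 hm' hεt x
  have hc := fun m x => (H.isCentered_frozenSum hk m x).add (isCentered_frozenPart H h1 h2 hk x).1
  refine energy_le_of_tendstoInMeasure (f := fun m x ω => stepAvg a ((h * κ : ℝ≥0) : ℝ)
      (fun y => schemeError a b κ w u h k y ω) x +
        (frozenSum b w u h k m x ω + frozenPart a b κ w u h k x ω))
    (fun m x => ((hS x).add (hc m x).memLp).aestronglyMeasurable.aemeasurable)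
    (fun x => H.tendsto_errorStep hk x) fun m => ?_
  have e1 := energy_stepAvg_le (P := P) H.kernel H.conv h1 fun y => (hm' y).aemeasurable
  have e2 := H.energy_frozenSum_le hk m
  have e3 := energy_frozenPart_le H hh h1 h2 hk hε
  have e4 := energy_add_le (μ := μ) 1 one_ne_zero (frozenPart a b κ w u h k)
    (fun x => (H.isCentered_frozenSum hk m x).memLp.aestronglyMeasurable.aemeasurable)
  have e5 : (1 + 1 : ℝ≥0) = 2 := by norm_num
  rw [inv_one, e5] at e4
  calc _ = energy μ P (fun x ω => stepAvg a ((h * κ : ℝ≥0) : ℝ)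
          (fun y => schemeError a b κ w u h k y ω) x) +
        energy μ P (fun x ω => frozenSum b w u h k m x ω + frozenPart a b κ w u h k x ω) := by
        simp only [energy]
        rw [← ENNReal.tsum_add]
        refine tsum_congr fun x => ?_
        rw [← mul_add]
        congr 1
        exact (hc m x).lintegral_add_sq (hS x) (measurable_stepAvg hm _ x)
    _ ≤ (1 + (h * κ) * C : ℝ≥0) * (ε : ℝ≥0∞) +
        ((2 : ℝ≥0) * (h ^ 2 * (noiseVar b * holderConst b κ T C K) : ℝ≥0) +
        (2 : ℝ≥0) * (h * (4 * noiseVar b * ε) + h ^ 2 * (schemeBound b μ T * (1 + C) *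
        (8 * noiseVar b * κ ^ 2 + 2 * noiseVar b ^ 2)) : ℝ≥0)) := by
        refine add_le_add (e1.trans ?_) (e4.trans ?_) <;> gcongr
    _ = _ := by
        rw [← ENNReal.coe_mul, ← ENNReal.coe_mul, ← ENNReal.coe_mul, ← ENNReal.coe_add,
          ← ENNReal.coe_add]
        congr 1
        ring

lemma IsRegularSolution.exists_energy_schemeError_succ_le
    (H : IsRegularSolution a b μ κ P ℱ w u T C K) :
    ∃ c c' : ℝ≥0, ∀ h : ℝ≥0, h ≠ 0 → h ≤ 1 → h * κ ≤ 1 → h * noiseVar b ≤ 1 → ∀ k : ℕ,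
      grid h (k + 1) ≤ T → ∀ ε : ℝ≥0, energy μ P (schemeError a b κ w u h k) ≤ ε →
      energy μ P (schemeError a b κ w u h (k + 1)) ≤ ((1 + h * c) * ε + h ^ 2 * c' : ℝ≥0) := by
  obtain ⟨c₀, hc₀⟩ : ∃ c, c = κ * C + 8 * noiseVar b := ⟨_, rfl⟩
  obtain ⟨c₁, hc₁⟩ : ∃ c, c = 2 * (noiseVar b * holderConst b κ T C K) + schemeBound b μ T *
    (1 + C) * (16 * noiseVar b * κ ^ 2 + 4 * noiseVar b ^ 2) := ⟨_, rfl⟩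
  obtain ⟨c₂, hc₂⟩ : ∃ c, c = κ ^ 2 * (2 * (C + 1)) * holderConst b κ T C K := ⟨_, rfl⟩
  refine ⟨1 + 2 * c₀, 2 * c₁ + 2 * c₂, fun h h0 hh h1 h2 k hk ε hε => ?_⟩
  have e1 := H.energy_errorStep_le hh h1 h2 hk hε
  have e2 := H.energy_driftError_le (grid_mono h k.le_succ) hk
  rw [Nat.succ_eq_add_one, grid_succ_sub] at e2
  rw [← hc₀, ← hc₁] at e1
  have hkT : grid h k ≤ T := (grid_mono h k.le_succ).trans hk
  have hm : ∀ x, AEMeasurable (errorStep a b κ w u h k x) P := fun x =>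
    TendstoInMeasure.aemeasurable (fun m =>
      ((memLp_stepAvg H h1 (fun x => (measurable_schemeError H h k x).mono (ℱ.le _) le_rfl)
        (hε.trans_lt ENNReal.coe_lt_top).ne x).add ((H.isCentered_frozenSum hk m x).add
        (isCentered_frozenPart H h1 h2 hk x).1).memLp).aestronglyMeasurable.aemeasurable)
      (H.tendsto_errorStep hk x)
  rw [energy_congr fun x => H.ae_schemeError_succ h1 hk x]
  -- The drift error has energy O(h³). Splitting with parameter h multiplies it by 1 + 1/h, leaving
  -- O(h²), and costs the main term only a factor 1 + h.
  refine (energy_add_le h h0 _ hm).trans ?_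
  calc _ ≤ ((1 + h : ℝ≥0) : ℝ≥0∞) * ((1 + h * c₀) * ε + h ^ 2 * c₁ : ℝ≥0) +
        (1 + h⁻¹ : ℝ≥0) * (h ^ 2 * (κ ^ 2 * (2 * (C + 1)) * (h * holderConst b κ T C K)) : ℝ≥0) := by
        gcongr
    _ = ((1 + h) * ((1 + h * c₀) * ε + h ^ 2 * c₁) +
        (1 + h⁻¹) * (h ^ 2 * (κ ^ 2 * (2 * (C + 1)) * (h * holderConst b κ T C K))) : ℝ≥0) := by
        push_cast
        rfl
    _ = ((1 + h) * (1 + h * c₀) * ε + (1 + h) * h ^ 2 * c₁ + (h + 1) * h ^ 2 * c₂ : ℝ≥0) := by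
        rw [hc₂]
        congr 1
        field_simp
    _ ≤ _ := by
        rw [ENNReal.coe_le_coe]
        have e3 : 1 + h ≤ 2 := by
          calc 1 + h ≤ 1 + 1 := by gcongr
            _ = 2 := by norm_num
        have e4 : (1 + h) * (1 + h * c₀) ≤ 1 + h * (1 + 2 * c₀) := by
          calc (1 + h) * (1 + h * c₀) = 1 + h * (1 + (1 + h) * c₀) := by ring
            _ ≤ _ := by gcongr
        calc _ ≤ (1 + h * (1 + 2 * c₀)) * ε + 2 * h ^ 2 * c₁ + 2 * h ^ 2 * c₂ := by
              rw [add_comm h 1]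
              gcongr
          _ = _ := by ring

end OneStep

/-! ### Convergence of the moments of the scheme. -/

section Moments

set_option linter.unusedSectionVars false

variable {Ω : Type*} {mΩ : MeasurableSpace Ω} {P : Measure Ω}

lemma tendstoInMeasure_of_lintegral_sq {ι : Type*} {l : Filter ι} {f : ι → Ω → ℝ} {g : Ω → ℝ}
    (hf : ∀ n, AEMeasurable (f n) P) (hg : AEMeasurable g P)
    (h : Tendsto (fun n => ∫⁻ ω, ‖f n ω - g ω‖ₑ ^ 2 ∂P) l (𝓝 0)) : TendstoInMeasure P f l g := by
  refine tendstoInMeasure_of_tendsto_eLpNorm two_ne_zero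
    (fun n => (hf n).aestronglyMeasurable) hg.aestronglyMeasurable ?_
  have h2 := (ENNReal.continuous_rpow_const (y := 1 / 2)).tendsto 0 |>.comp h
  rw [ENNReal.zero_rpow_of_pos (by norm_num)] at h2
  refine h2.congr fun n => ?_
  rw [eLpNorm_eq_lintegral_rpow_enorm_toReal (by norm_num) (by norm_num)]
  simp

lemma lintegral_pow_le_of_tendstoInMeasure {f : ℕ → Ω → ℝ} {g : Ω → ℝ} {c : ℝ≥0∞} (q : ℕ)
    (hf : ∀ n, AEMeasurable (f n) P) (h : TendstoInMeasure P f atTop g)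
    (hc : ∀ᶠ n in atTop, ∫⁻ ω, ‖f n ω‖ₑ ^ q ∂P ≤ c) : ∫⁻ ω, ‖g ω‖ₑ ^ q ∂P ≤ c := by
  obtain ⟨φ, hφ, hae⟩ := h.exists_seq_tendsto_ae
  calc ∫⁻ ω, ‖g ω‖ₑ ^ q ∂P = ∫⁻ ω, liminf (fun k => ‖f (φ k) ω‖ₑ ^ q) atTop ∂P := by
        refine lintegral_congr_ae ?_
        filter_upwards [hae] with ω hω
        have : Continuous fun y : ℝ => ‖y‖ₑ ^ q := by fun_prop
        exact (((this.tendsto _).comp hω).liminf_eq).symm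
    _ ≤ liminf (fun k => ∫⁻ ω, ‖f (φ k) ω‖ₑ ^ q ∂P) atTop :=
        lintegral_liminf_le' fun k => (hf _).enorm.pow_const q
    _ ≤ liminf (fun _ : ℕ => c) atTop :=
        liminf_le_liminf (hφ.tendsto_atTop.eventually hc)
    _ = c := by simp

lemma enorm_pow_succ_sub_le (q : ℕ) (x y : ℝ) :
    ‖x ^ (q + 1) - y ^ (q + 1)‖ₑ ≤
      ‖x - y‖ₑ * (((q + 1 : ℕ) : ℝ≥0∞) * (‖x‖ₑ ^ q + ‖y‖ₑ ^ q)) := by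
  have h1 : |x ^ (q + 1) - y ^ (q + 1)| ≤ |x - y| * (((q + 1 : ℕ) : ℝ) * (|x| ^ q + |y| ^ q)) := by
    refine (abs_pow_sub_pow_le x y (q + 1)).trans ?_
    rw [mul_assoc, Nat.add_sub_cancel]
    gcongr
    rcases max_cases |x| |y| with h | h <;> rw [h.1]
    · exact le_add_of_nonneg_right (by positivity)
    · exact le_add_of_nonneg_left (by positivity)
  have h2 : ‖x ^ (q + 1) - y ^ (q + 1)‖₊ ≤
      ‖x - y‖₊ * (((q + 1 : ℕ) : ℝ≥0) * (‖x‖₊ ^ q + ‖y‖₊ ^ q)) := by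
    rw [← NNReal.coe_le_coe]
    simpa using h1
  have h3 := ENNReal.coe_le_coe.mpr h2
  simpa [enorm_eq_nnnorm] using h3

/-- By the mean value bound for powers and Cauchy–Schwarz, the L¹ distance of the (q+1)-st powers is
at most the L² distance times a uniformly bounded factor built from the moments of order 2q. -/
lemma tendsto_integral_pow {ι : Type*} {l : Filter ι} {f : ι → Ω → ℝ} {g : Ω → ℝ} (q : ℕ)
    (hf : ∀ n, AEMeasurable (f n) P) (hg : AEMeasurable g P) {M : ℝ≥0∞} (hM : M ≠ ∞)
    (hfM : ∀ᶠ n in l, ∫⁻ ω, ‖f n ω‖ₑ ^ (2 * q) ∂P ≤ M) (hgM : ∫⁻ ω, ‖g ω‖ₑ ^ (2 * q) ∂P ≤ M)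
    (hfi : ∀ᶠ n in l, Integrable (fun ω => f n ω ^ (q + 1)) P)
    (hgi : Integrable (fun ω => g ω ^ (q + 1)) P)
    (h : Tendsto (fun n => ∫⁻ ω, ‖f n ω - g ω‖ₑ ^ 2 ∂P) l (𝓝 0)) :
    Tendsto (fun n => ∫ ω, f n ω ^ (q + 1) ∂P) l (𝓝 (∫ ω, g ω ^ (q + 1) ∂P)) := by
  refine tendsto_integral_of_L1 _ hgi.1 hfi ?_
  set M' : ℝ≥0∞ := ((q + 1 : ℕ) : ℝ≥0∞) ^ 2 * (2 * M + 2 * M) with hM'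
  have h2 := (ENNReal.continuous_rpow_const (y := 1 / 2)).tendsto 0 |>.comp h
  rw [ENNReal.zero_rpow_of_pos (by norm_num)] at h2
  have h3 := ENNReal.Tendsto.mul_const (b := M' ^ (1 / 2 : ℝ)) h2
    (Or.inr (ENNReal.rpow_ne_top_of_nonneg (by norm_num)
      (ENNReal.mul_ne_top (by simp) (by simp [hM, ENNReal.mul_eq_top]))))
  rw [zero_mul] at h3
  refine tendsto_of_tendsto_of_tendsto_of_le_of_le' tendsto_const_nhds h3
    (Eventually.of_forall fun _ => zero_le) ?_
  filter_upwards [hfM] with n hn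
  have hm1 : AEMeasurable (fun ω => ‖f n ω - g ω‖ₑ) P := ((hf n).sub hg).enorm
  have hm2 : AEMeasurable (fun ω => ((q + 1 : ℕ) : ℝ≥0∞) * (‖f n ω‖ₑ ^ q + ‖g ω‖ₑ ^ q)) P :=
    (((hf n).enorm.pow_const q).add (hg.enorm.pow_const q)).const_mul _
  have h4 := ENNReal.lintegral_mul_le_Lp_mul_Lq P Real.HolderConjugate.two_two hm1 hm2
  refine (lintegral_mono fun ω => enorm_pow_succ_sub_le q (f n ω) (g ω)).trans (h4.trans ?_)
  simp only [ENNReal.rpow_two, Function.comp_apply]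
  gcongr
  calc ∫⁻ ω, (((q + 1 : ℕ) : ℝ≥0∞) * (‖f n ω‖ₑ ^ q + ‖g ω‖ₑ ^ q)) ^ 2 ∂P ≤
      ∫⁻ ω, ((q + 1 : ℕ) : ℝ≥0∞) ^ 2 *
        (2 * ‖f n ω‖ₑ ^ (2 * q) + 2 * ‖g ω‖ₑ ^ (2 * q)) ∂P := by
        refine lintegral_mono fun ω => ?_
        rw [mul_pow]
        gcongr
        have h5 : (‖f n ω‖₊ ^ q + ‖g ω‖₊ ^ q) ^ 2 ≤
            2 * ‖f n ω‖₊ ^ (2 * q) + 2 * ‖g ω‖₊ ^ (2 * q) := by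
          rw [mul_comm 2 q, pow_mul, pow_mul, ← mul_add]
          exact add_sq_le
        have h6 := ENNReal.coe_le_coe.mpr h5
        simpa [enorm_eq_nnnorm] using h6
    _ = ((q + 1 : ℕ) : ℝ≥0∞) ^ 2 * (2 * ∫⁻ ω, ‖f n ω‖ₑ ^ (2 * q) ∂P +
          2 * ∫⁻ ω, ‖g ω‖ₑ ^ (2 * q) ∂P) := by
        rw [lintegral_const_mul' _ _ (by simp), lintegral_add_left'
          (((hf n).enorm.pow_const _).const_mul _), lintegral_const_mul' _ _ (by simp),
          lintegral_const_mul' _ _ (by simp)]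
    _ ≤ M' := by
        rw [hM']
        gcongr

variable {d : ℕ} [IsProbabilityMeasure P]
  {ℱ : Filtration ℝ≥0 mΩ} {w : Lattice d → ℝ≥0 → Ω → ℝ} {a b μ : Lattice d → ℝ} {κ : ℝ≥0}
  {u : ℝ≥0 → Lattice d → Ω → ℝ} {T C K : ℝ≥0}

/-- Discrete Gronwall, starting from zero error at time 0. -/
lemma IsRegularSolution.exists_energy_schemeError_le (H : IsRegularSolution a b μ κ P ℱ w u T C K) :
    ∃ c c' : ℝ≥0, ∀ h : ℝ≥0, h ≠ 0 → h ≤ 1 → h * κ ≤ 1 → h * noiseVar b ≤ 1 → ∀ k : ℕ,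
      grid h k ≤ T → energy μ P (schemeError a b κ w u h k) ≤
        (k * (h ^ 2 * c') * (1 + h * c) ^ k : ℝ≥0) := by
  obtain ⟨c, c', hc⟩ := H.exists_energy_schemeError_succ_le
  refine ⟨c, c', fun h h0 hh h1 h2 k => ?_⟩
  induction k with
  | zero =>
    intro _
    have e : energy μ P (schemeError a b κ w u h 0) = energy μ P (fun _ _ => 0) := by
      refine energy_congr fun x => ?_
      filter_upwards [H.u_zero x] with ω hω
      simp [schemeError, realScheme, scheme, grid, hω]
    rw [e]
    simp [energy]
  | succ k ih =>
    intro hk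
    refine (hc h h0 hh h1 h2 k hk _ (ih ((grid_mono h k.le_succ).trans hk))).trans ?_
    rw [ENNReal.coe_le_coe]
    have h3 : 1 ≤ (1 + h * c) ^ (k + 1) := one_le_pow₀ (le_add_of_nonneg_right zero_le)
    calc (1 + h * c) * (k * (h ^ 2 * c') * (1 + h * c) ^ k) + h ^ 2 * c'
        = k * (h ^ 2 * c') * (1 + h * c) ^ (k + 1) + h ^ 2 * c' * 1 := by ring
      _ ≤ k * (h ^ 2 * c') * (1 + h * c) ^ (k + 1) + h ^ 2 * c' * (1 + h * c) ^ (k + 1) := by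
        gcongr
      _ = _ := by push_cast; ring

lemma tendsto_div_natCast (h : ℝ≥0) : Tendsto (fun m : ℕ => h / m) atTop (𝓝 0) := by
  rw [← NNReal.tendsto_coe]
  simpa using tendsto_const_div_atTop_nhds_zero_nat (h : ℝ)

lemma eventually_div_mul_le_one (h c : ℝ≥0) : ∀ᶠ m : ℕ in atTop, h / m * c ≤ 1 := by
  have h1 := (tendsto_div_natCast h).mul_const c
  rw [zero_mul] at h1
  exact (h1.eventually_lt_const zero_lt_one).mono fun m hm => hm.le

lemma one_add_pow_le_exp (y : ℝ≥0) (n : ℕ) : (1 + y) ^ n ≤ (Real.exp (n * y)).toNNReal := by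
  rw [← NNReal.coe_le_coe, Real.coe_toNNReal _ (Real.exp_pos _).le, Real.exp_nat_mul]
  push_cast
  gcongr
  rw [add_comm]
  exact Real.add_one_le_exp _

/-- The Euler scheme converges in mean square. -/
lemma IsRegularSolution.tendsto_realScheme (H : IsRegularSolution a b μ κ P ℱ w u T C K)
    {h : ℝ≥0} (h0 : h ≠ 0) {i : ℕ} (hi : grid h i ≤ T) (x : Lattice d) :
    Tendsto (fun m : ℕ => ∫⁻ ω,
      ‖realScheme a b κ w (h / m) (i * m) x ω - u (grid h i) x ω‖ₑ ^ 2 ∂P) atTop (𝓝 0) := by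
  obtain ⟨c, c', hc⟩ := H.exists_energy_schemeError_le
  -- There are i m steps of length h/m, so the accumulated error is at most i m (h/m)² c' exp(i h c)
  -- = D/m.
  set D : ℝ≥0 := i * h ^ 2 * c' * (Real.exp (i * h * c)).toNNReal with hD
  have hμ : ENNReal.ofReal (μ x) ≠ 0 := by simpa using H.weight_pos x
  have hlim : Tendsto (fun m : ℕ => (ENNReal.ofReal (μ x))⁻¹ * ((D / m : ℝ≥0) : ℝ≥0∞)) atTop
      (𝓝 0) := by
    have := ENNReal.Tendsto.const_mul (a := (ENNReal.ofReal (μ x))⁻¹)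
      (ENNReal.tendsto_coe.mpr (tendsto_div_natCast D)) (Or.inr (by simpa using H.weight_pos x))
    simpa using this
  refine tendsto_of_tendsto_of_tendsto_of_le_of_le' tendsto_const_nhds hlim
    (Eventually.of_forall fun _ => zero_le) ?_
  filter_upwards [eventually_ne_atTop 0, eventually_div_mul_le_one h 1,
    eventually_div_mul_le_one h κ, eventually_div_mul_le_one h (noiseVar b)] with m hm h1 h2 h3
  have hm' : (m : ℝ≥0) ≠ 0 := by exact_mod_cast hm
  rw [mul_one] at h1
  have e1 := hc (h / m) (div_ne_zero h0 hm') h1 h2 h3 (i * m) (by rwa [grid_div h hm])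
  have e2 := (ENNReal.le_tsum (f := fun x => ENNReal.ofReal (μ x) *
    ∫⁻ ω, ‖schemeError a b κ w u (h / m) (i * m) x ω‖ₑ ^ 2 ∂P) x).trans e1
  have e3 : (((i * m : ℕ) : ℝ≥0) * ((h / m) ^ 2 * c') * (1 + h / m * c) ^ (i * m)) ≤ D / m := by
    calc _ ≤ ((i * m : ℕ) : ℝ≥0) * ((h / m) ^ 2 * c') *
          (Real.exp ((i * m : ℕ) * ((h / m * c : ℝ≥0) : ℝ))).toNNReal := by
          gcongr
          exact one_add_pow_le_exp _ _
      _ = D / m := by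
          have hm2 : (m : ℝ) ≠ 0 := by exact_mod_cast hm
          have e : ((i * m : ℕ) : ℝ) * ((h / m * c : ℝ≥0) : ℝ) = i * h * c := by
            push_cast
            field_simp
          rw [e, hD]
          push_cast
          field_simp
  have e4 := e2.trans (ENNReal.coe_le_coe.mpr e3)
  rw [← ENNReal.mul_le_iff_le_inv hμ ENNReal.ofReal_ne_top]
  refine le_trans (le_of_eq ?_) e4
  simp only [schemeError, grid_div h hm]
  congr 1
  refine lintegral_congr fun ω => ?_
  rw [enorm_sub_rev]

lemma integral_realScheme_pow (ha : IsJumpKernel a) (hb : Summable fun z => |b z|)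
    (hw : IsBrownianFamily P ℱ w) {κ h : ℝ≥0} (h1 : h * κ ≤ 1) (k p : ℕ) (x : Lattice d) :
    Integrable (fun ω => realScheme a b κ w h k x ω ^ p) P ∧
      ∫ ω, realScheme a b κ w h k x ω ^ p ∂P = (discreteMoment a b κ p h k 0).toReal := by
  have e := lintegral_scheme_pow (a := a) hw hb κ h k p x
  have h1' : (h : ℝ) * κ ≤ 1 := by exact_mod_cast h1
  have e2 := (discreteMoment_le ha hb (NNReal.coe_nonneg κ) (NNReal.coe_nonneg h) h1' p k 0).trans_lt ENNReal.ofReal_lt_top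
  simp only [realScheme, ← ENNReal.toReal_pow]
  rw [← e]
  rw [← e] at e2
  have hm : AEMeasurable (fun ω => scheme a b κ w h k x ω ^ p) P :=
    ((measurable_scheme hw κ h k x).pow_const p).aemeasurable
  exact ⟨integrable_toReal_of_lintegral_ne_top hm e2.ne,
    integral_toReal hm (ae_lt_top' hm e2.ne)⟩

/-- Nonnegativity and all moment bounds pass from the scheme to `u` along an almost surely
convergent subsequence, although only second moments of `u` are assumed. -/
lemma IsSolution.lintegral_pow_le (ha : IsJumpKernel a) (hb : Summable fun z => |b z|)
    (hw : IsBrownianFamily P ℱ w) (hu : IsSolution a b κ P ℱ w u) (t : ℝ≥0) (x : Lattice d) :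
    (0 ≤ᵐ[P] u t x) ∧ ∀ q, ∫⁻ ω, ‖u t x ω‖ₑ ^ q ∂P ≤
      ENNReal.ofReal (Real.exp (t * momentRate b q)) := by
  obtain ⟨μ, C, K, H⟩ := hu.exists_isRegularSolution ha hb hw t
  rcases eq_or_ne t 0 with rfl | ht
  · refine ⟨?_, fun q => ?_⟩
    · filter_upwards [H.u_zero x] with ω hω
      simp [hω]
    · have : ∫⁻ ω, ‖u 0 x ω‖ₑ ^ q ∂P = ∫⁻ ω, 1 ∂P := by
        refine lintegral_congr_ae ?_
        filter_upwards [H.u_zero x] with ω hω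
        simp [hω]
      rw [this]
      simp
  · have h1 := H.tendsto_realScheme ht (i := 1) (by simp [grid]) x
    have hm : ∀ n : ℕ, AEMeasurable (realScheme a b κ w (t / n) (1 * n) x) P := fun n =>
      (measurable_realScheme' hw κ _ _ x).aemeasurable
    have h2 := tendstoInMeasure_of_lintegral_sq hm (hu.measurable _ x).aemeasurable h1
    have hg : grid t 1 = t := by simp [grid]
    rw [hg] at h2
    refine ⟨?_, fun q => ?_⟩
    · obtain ⟨φ, -, hφ⟩ := h2.exists_seq_tendsto_ae
      filter_upwards [hφ] with ω hω
      exact ge_of_tendsto' hω fun n => ENNReal.toReal_nonneg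
    · refine lintegral_pow_le_of_tendstoInMeasure q hm h2 ?_
      filter_upwards [eventually_div_mul_le_one t κ, eventually_ne_atTop 0] with n hn hn0
      have := lintegral_realScheme_pow_le (a := a) ha hb hw hn (1 * n) q x
      rwa [grid_div t hn0, hg] at this

lemma IsSolution.integrable_pow (ha : IsJumpKernel a) (hb : Summable fun z => |b z|)
    (hw : IsBrownianFamily P ℱ w) (hu : IsSolution a b κ P ℱ w u) (t : ℝ≥0) (x : Lattice d)
    (q : ℕ) : Integrable (fun ω => u t x ω ^ q) P := by
  refine ⟨((hu.measurable t x).pow_const q).aestronglyMeasurable, ?_⟩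
  rw [hasFiniteIntegral_iff_enorm]
  simp only [enorm_pow]
  exact ((hu.lintegral_pow_le ha hb hw t x).2 q).trans_lt ENNReal.ofReal_lt_top

/-- The moments of the Euler scheme converge to the moments of the solution. -/
lemma IsSolution.tendsto_discreteMoment (ha : IsJumpKernel a) (hb : Summable fun z => |b z|)
    (hw : IsBrownianFamily P ℱ w) (hu : IsSolution a b κ P ℱ w u) {h : ℝ≥0} (h0 : h ≠ 0) (i : ℕ)
    (q : ℕ) (x : Lattice d) :
    Tendsto (fun m : ℕ => (discreteMoment a b κ (q + 1) ((h / m : ℝ≥0) : ℝ) (i * m) 0).toReal)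
      atTop (𝓝 (∫ ω, u (grid h i) x ω ^ (q + 1) ∂P)) := by
  obtain ⟨μ, C, K, H⟩ := hu.exists_isRegularSolution ha hb hw (grid h i)
  have h1 := H.tendsto_realScheme h0 le_rfl x
  have ev := eventually_div_mul_le_one h κ
  refine (tendsto_integral_pow q (fun m => (measurable_realScheme' hw κ _ _ x).aemeasurable)
    (hu.measurable _ x).aemeasurable (ENNReal.ofReal_ne_top (r := Real.exp (grid h i *
      momentRate b (2 * q)))) ?_ ((hu.lintegral_pow_le ha hb hw _ x).2 _) ?_
      (hu.integrable_pow ha hb hw _ x _) h1).congr' ?_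
  · filter_upwards [ev, eventually_ne_atTop 0] with m hm hm0
    have := lintegral_realScheme_pow_le (a := a) ha hb hw hm (i * m) (2 * q) x
    rwa [grid_div h hm0] at this
  · filter_upwards [ev] with m hm using (integral_realScheme_pow ha hb hw hm _ _ x).1
  · filter_upwards [ev] with m hm using (integral_realScheme_pow ha hb hw hm _ _ x).2

end Moments

/-- Fekete's lemma in continuous time. -/
lemma exists_tendsto_div_of_subadditive {f : ℝ≥0 → ℝ} {c : ℝ} (hf : ∀ s t, f (s + t) ≤ f s + f t)
    (hc : ∀ t, |f t| ≤ t * c) :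
    ∃ γ, Tendsto (fun t : ℝ≥0 => f t / t) atTop (𝓝 γ) := by
  have hc0 : 0 ≤ c := by simpa using (abs_nonneg _).trans (hc 1)
  have hsub : Subadditive fun n : ℕ => f n := fun m n => by
    push_cast
    exact hf m n
  have hbdd : BddBelow (Set.range fun n : ℕ => f n / n) := by
    refine ⟨-c, ?_⟩
    rintro _ ⟨n, rfl⟩
    rcases Nat.eq_zero_or_pos n with rfl | hn
    · simpa using hc0
    · have hn' : (0 : ℝ) < n := by exact_mod_cast hn
      have := (abs_le.mp (hc n)).1
      simp only [NNReal.coe_natCast] at this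
      rw [le_div_iff₀ hn']
      linarith
  refine ⟨hsub.lim, ?_⟩
  have hlim := hsub.tendsto_lim hbdd
  have hfl : Tendsto (fun t : ℝ≥0 => ⌊t⌋₊) atTop atTop := tendsto_nat_floor_atTop
  have hcoe : Tendsto (fun t : ℝ≥0 => (t : ℝ)) atTop atTop := NNReal.tendsto_coe_atTop.mpr tendsto_id
  have hr : Tendsto (fun t : ℝ≥0 => (⌊t⌋₊ : ℝ) / t) atTop (𝓝 1) := by
    refine ((tendsto_nat_floor_div_atTop (R := ℝ)).comp hcoe).congr fun t => ?_
    have : ⌊(t : ℝ)⌋₊ = ⌊t⌋₊ := Nonneg.nat_floor_coe t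
    simp only [Function.comp_apply, this]
  have hinv : Tendsto (fun t : ℝ≥0 => c / (t : ℝ)) atTop (𝓝 0) :=
    tendsto_const_nhds.div_atTop hcoe
  have hinv1 : Tendsto (fun t : ℝ≥0 => 1 / (t : ℝ)) atTop (𝓝 0) :=
    tendsto_const_nhds.div_atTop hcoe
  have hup : Tendsto (fun t : ℝ≥0 => f ⌊t⌋₊ / ⌊t⌋₊ * ((⌊t⌋₊ : ℝ) / t) + c / t) atTop
      (𝓝 hsub.lim) := by
    simpa using ((hlim.comp hfl).mul hr).add hinv
  have hlow : Tendsto (fun t : ℝ≥0 =>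
      f ((⌊t⌋₊ + 1 : ℕ) : ℝ≥0) / ((⌊t⌋₊ + 1 : ℕ) : ℝ) * ((⌊t⌋₊ : ℝ) / t + 1 / t) - c / t) atTop
      (𝓝 hsub.lim) := by
    simpa using ((hlim.comp ((tendsto_add_atTop_nat 1).comp hfl)).mul (hr.add hinv1)).sub hinv
  have hle1 : ∀ r : ℝ≥0, r ≤ 1 → f r ≤ c := fun r hr =>
    (le_abs_self _).trans ((hc r).trans (mul_le_of_le_one_left hc0 (by exact_mod_cast hr)))
  -- Subadditivity with a remaining time of at most 1 gives f(⌊t⌋ + 1) - c ≤ f(t) ≤ f(⌊t⌋) + c.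
  refine tendsto_of_tendsto_of_tendsto_of_le_of_le' hlow hup ?_ ?_
  · filter_upwards [eventually_gt_atTop 0] with t ht
    have ht' : (0 : ℝ) < t := by exact_mod_cast ht
    have h1 : t ≤ ((⌊t⌋₊ + 1 : ℕ) : ℝ≥0) := by
      push_cast
      exact (Nat.lt_floor_add_one t).le
    have h2 := hf t (((⌊t⌋₊ + 1 : ℕ) : ℝ≥0) - t)
    rw [add_tsub_cancel_of_le h1] at h2
    have h3 := hle1 (((⌊t⌋₊ + 1 : ℕ) : ℝ≥0) - t) (by
      rw [tsub_le_iff_right]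
      push_cast
      rw [add_comm]
      gcongr
      exact Nat.floor_le zero_le)
    have h4 : f ((⌊t⌋₊ + 1 : ℕ) : ℝ≥0) / ((⌊t⌋₊ + 1 : ℕ) : ℝ) * ((⌊t⌋₊ : ℝ) / t + 1 / t) =
        f ((⌊t⌋₊ + 1 : ℕ) : ℝ≥0) / t := by
      push_cast
      field_simp
    rw [h4, ← sub_div]
    gcongr
    linarith
  -- For t ≥ 1 the integer part is nonzero and cancels.
  · filter_upwards [eventually_ge_atTop 1] with t ht
    have ht' : (0 : ℝ) < t := by exact_mod_cast zero_lt_one.trans_le ht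
    have h1 : (⌊t⌋₊ : ℝ≥0) ≤ t := Nat.floor_le zero_le
    have h2 := hf ⌊t⌋₊ (t - ⌊t⌋₊)
    rw [add_tsub_cancel_of_le h1] at h2
    have h3 := hle1 (t - ⌊t⌋₊) (by
      rw [tsub_le_iff_right, add_comm]
      exact (Nat.lt_floor_add_one t).le)
    have h4 : (⌊t⌋₊ : ℝ) ≠ 0 := by
      have : 0 < ⌊t⌋₊ := Nat.floor_pos.mpr ht
      exact_mod_cast this.ne'
    have h5 : f ⌊t⌋₊ / ⌊t⌋₊ * ((⌊t⌋₊ : ℝ) / t) = f ⌊t⌋₊ / t := by field_simp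
    rw [h5, ← add_div]
    gcongr
    linarith

/-! ### Existence of the Lyapunov exponents. -/

section Lyapunov

set_option linter.unusedSectionVars false

variable {Ω : Type*} {mΩ : MeasurableSpace Ω} {P : Measure Ω} {d : ℕ} [IsProbabilityMeasure P]
  {ℱ : Filtration ℝ≥0 mΩ} {w : Lattice d → ℝ≥0 → Ω → ℝ} {a b μ : Lattice d → ℝ} {κ : ℝ≥0}
  {u : ℝ≥0 → Lattice d → Ω → ℝ} {T C K : ℝ≥0}

lemma IsSolution.integral_pow_bounds (ha : IsJumpKernel a) (hb : Summable fun z => |b z|)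
    (hw : IsBrownianFamily P ℱ w) (hu : IsSolution a b κ P ℱ w u) (t : ℝ≥0) (x : Lattice d)
    (q : ℕ) : Real.exp (-(t * momentRate b (q + 1))) ≤ ∫ ω, u t x ω ^ (q + 1) ∂P ∧
      ∫ ω, u t x ω ^ (q + 1) ∂P ≤ Real.exp (t * momentRate b (q + 1)) := by
  rcases eq_or_ne t 0 with rfl | ht
  · obtain ⟨μ, C, K, H⟩ := hu.exists_isRegularSolution ha hb hw 0
    have : ∫ ω, u 0 x ω ^ (q + 1) ∂P = ∫ _, (1 : ℝ) ∂P := by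
      refine integral_congr_ae ?_
      filter_upwards [H.u_zero x] with ω hω
      simp [hω]
    rw [this]
    simp
  · have h1 := hu.tendsto_discreteMoment ha hb hw ht 1 q x
    have hg : grid t 1 = t := by simp [grid]
    rw [hg] at h1
    have ev : ∀ᶠ m : ℕ in atTop, ENNReal.ofReal (Real.exp (-(t * momentRate b (q + 1)))) ≤
          discreteMoment a b κ (q + 1) ((t / m : ℝ≥0) : ℝ) (1 * m) 0 ∧
        discreteMoment a b κ (q + 1) ((t / m : ℝ≥0) : ℝ) (1 * m) 0 ≤
          ENNReal.ofReal (Real.exp (t * momentRate b (q + 1))) := by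
      filter_upwards [eventually_div_mul_le_one t κ, eventually_ne_atTop 0] with m hm hm0
      have h2 : (((t / m : ℝ≥0)) : ℝ) * κ ≤ 1 := by exact_mod_cast hm
      have h3 : ((1 * m : ℕ) : ℝ) * ((t / m : ℝ≥0) : ℝ) = t := by
        have : (m : ℝ) ≠ 0 := by exact_mod_cast hm0
        push_cast
        field_simp
      have h4 := discreteMoment_le ha hb (NNReal.coe_nonneg κ) (NNReal.coe_nonneg (t / m)) h2
        (q + 1) (1 * m) 0
      have h5 := le_discreteMoment ha hb (NNReal.coe_nonneg κ) (NNReal.coe_nonneg (t / m)) h2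
        (q + 1) (1 * m) 0
      rw [h3] at h4 h5
      exact ⟨h5, h4⟩
    constructor
    · refine ge_of_tendsto h1 (ev.mono fun m hm => ?_)
      rw [← ENNReal.ofReal_le_iff_le_toReal (hm.2.trans_lt ENNReal.ofReal_lt_top).ne]
      exact hm.1
    · refine le_of_tendsto h1 (ev.mono fun m hm => ?_)
      exact ENNReal.toReal_le_of_le_ofReal (Real.exp_pos _).le hm.2

lemma IsSolution.integral_pow_pos (ha : IsJumpKernel a) (hb : Summable fun z => |b z|)
    (hw : IsBrownianFamily P ℱ w) (hu : IsSolution a b κ P ℱ w u) (t : ℝ≥0) (x : Lattice d)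
    (q : ℕ) : 0 < ∫ ω, u t x ω ^ (q + 1) ∂P :=
  (Real.exp_pos _).trans_le (hu.integral_pow_bounds ha hb hw t x q).1

/-- The weighted mean square Hölder bound controls the L² distance at each site, and the uniform
higher moments upgrade this to convergence of moments. -/
lemma IsSolution.continuous_integral_pow (ha : IsJumpKernel a) (hb : Summable fun z => |b z|)
    (hw : IsBrownianFamily P ℱ w) (hu : IsSolution a b κ P ℱ w u) (x : Lattice d) (q : ℕ) :
    Continuous fun t => ∫ ω, u t x ω ^ (q + 1) ∂P := by
  rw [continuous_iff_continuousAt]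
  intro t
  obtain ⟨μ, C, K, H⟩ := hu.exists_isRegularSolution ha hb hw (t + 1)
  have ht : t < t + 1 := lt_add_of_pos_right t one_pos
  have ev : ∀ᶠ s in 𝓝 t, s ≤ t + 1 := (eventually_lt_nhds ht).mono fun s hs => hs.le
  set L := holderConst b κ (t + 1) C K
  have hμ : ENNReal.ofReal (μ x) ≠ 0 := by simpa using H.weight_pos x
  refine tendsto_integral_pow q (fun s => (hu.measurable s x).aemeasurable)
    (hu.measurable t x).aemeasurable (ENNReal.ofReal_ne_top (r := Real.exp ((t + 1 : ℝ≥0) *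
      momentRate b (2 * q)))) ?_ ?_
      (Eventually.of_forall fun s => hu.integrable_pow ha hb hw s x _)
      (hu.integrable_pow ha hb hw t x _) ?_
  · filter_upwards [ev] with s hs
    refine ((hu.lintegral_pow_le ha hb hw s x).2 _).trans ?_
    have := momentRate_nonneg b (2 * q)
    gcongr
  · refine ((hu.lintegral_pow_le ha hb hw t x).2 _).trans ?_
    have := momentRate_nonneg b (2 * q)
    gcongr
  · have hd : Tendsto (fun s : ℝ≥0 => (ENNReal.ofReal (μ x))⁻¹ * ((nndist s t * L : ℝ≥0) : ℝ≥0∞))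
        (𝓝 t) (𝓝 0) := by
      have h1 : Tendsto (fun s : ℝ≥0 => nndist s t * L) (𝓝 t) (𝓝 0) := by
        have : Continuous fun s : ℝ≥0 => nndist s t * L := by fun_prop
        simpa using this.tendsto t
      have := ENNReal.Tendsto.const_mul (a := (ENNReal.ofReal (μ x))⁻¹)
        (ENNReal.tendsto_coe.mpr h1) (Or.inr (by simpa using H.weight_pos x))
      simpa using this
    refine tendsto_of_tendsto_of_tendsto_of_le_of_le' tendsto_const_nhds hd
      (Eventually.of_forall fun _ => zero_le) ?_
    filter_upwards [ev] with s hs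
    rw [← ENNReal.mul_le_iff_le_inv hμ ENNReal.ofReal_ne_top]
    refine (ENNReal.le_tsum (f := fun x => ENNReal.ofReal (μ x) *
      ∫⁻ ω, ‖u s x ω - u t x ω‖ₑ ^ 2 ∂P) x).trans ?_
    change energy μ P (fun x ω => u s x ω - u t x ω) ≤ _
    rcases le_total s t with hst | hst
    · rw [energy_sub_comm]
      refine (H.energy_sub_le hst ht.le).trans ?_
      rw [ENNReal.coe_le_coe]
      gcongr
      rw [← NNReal.coe_le_coe, NNReal.coe_sub hst, coe_nndist, NNReal.dist_eq, abs_sub_comm]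
      exact le_abs_self _
    · refine (H.energy_sub_le hst hs).trans ?_
      rw [ENNReal.coe_le_coe]
      gcongr
      rw [← NNReal.coe_le_coe, NNReal.coe_sub hst, coe_nndist, NNReal.dist_eq]
      exact le_abs_self _

lemma IsSolution.integral_pow_grid_add_le (ha : IsJumpKernel a) (hb : Summable fun z => |b z|)
    (hw : IsBrownianFamily P ℱ w) (hu : IsSolution a b κ P ℱ w u) {h : ℝ≥0} (h0 : h ≠ 0) (i j : ℕ)
    (x : Lattice d) (q : ℕ) : ∫ ω, u (grid h (i + j)) x ω ^ (q + 1) ∂P ≤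
      (∫ ω, u (grid h i) x ω ^ (q + 1) ∂P) * ∫ ω, u (grid h j) x ω ^ (q + 1) ∂P := by
  refine le_of_tendsto_of_tendsto (hu.tendsto_discreteMoment ha hb hw h0 (i + j) q x)
    ((hu.tendsto_discreteMoment ha hb hw h0 i q x).mul
      (hu.tendsto_discreteMoment ha hb hw h0 j q x)) ?_
  filter_upwards [eventually_div_mul_le_one h κ] with m hm
  have h2 : (((h / m : ℝ≥0)) : ℝ) * κ ≤ 1 := by exact_mod_cast hm
  have hfin : ∀ n, discreteMoment a b κ (q + 1) ((h / m : ℝ≥0) : ℝ) n 0 ≠ ∞ := fun n =>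
    ((discreteMoment_le ha hb (NNReal.coe_nonneg κ) (NNReal.coe_nonneg (h / m)) h2
      (q + 1) n 0).trans_lt ENNReal.ofReal_lt_top).ne
  rw [← ENNReal.toReal_mul, add_mul]
  exact ENNReal.toReal_mono (ENNReal.mul_ne_top (hfin _) (hfin _))
    (discreteMoment_add_le hw hb κ (h / m) q.succ_ne_zero (i * m) (j * m))

/-- The moments are submultiplicative in time. -/
lemma IsSolution.integral_pow_add_le (ha : IsJumpKernel a) (hb : Summable fun z => |b z|)
    (hw : IsBrownianFamily P ℱ w) (hu : IsSolution a b κ P ℱ w u) (s t : ℝ≥0)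
    (x : Lattice d) (q : ℕ) : ∫ ω, u (s + t) x ω ^ (q + 1) ∂P ≤
      (∫ ω, u s x ω ^ (q + 1) ∂P) * ∫ ω, u t x ω ^ (q + 1) ∂P := by
  rcases eq_or_ne s 0 with rfl | hs
  · obtain ⟨μ, C, K, H⟩ := hu.exists_isRegularSolution ha hb hw 0
    have : ∫ ω, u 0 x ω ^ (q + 1) ∂P = ∫ _, (1 : ℝ) ∂P := by
      refine integral_congr_ae ?_
      filter_upwards [H.u_zero x] with ω hω
      simp [hω]
    rw [this]
    simp
  · have hc := hu.continuous_integral_pow ha hb hw x q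
    -- Approximating t by multiples of s/n makes both times lie on one grid, where
    -- submultiplicativity is known; continuity of the moments removes the approximation.
    have hlim : Tendsto (fun n : ℕ => grid (s / n) ⌊t / s * n⌋₊) atTop (𝓝 t) := by
      have h1 := ((tendsto_nat_floor_mul_div_atTop (R := ℝ) (a := ((t / s : ℝ≥0) : ℝ))
        (NNReal.coe_nonneg _)).comp tendsto_natCast_atTop_atTop).mul_const (s : ℝ)
      rw [← NNReal.tendsto_coe]
      have h2 : ((t / s : ℝ≥0) : ℝ) * s = t := by
        have : (s : ℝ) ≠ 0 := by exact_mod_cast hs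
        push_cast
        field_simp
      rw [h2] at h1
      refine h1.congr fun n => ?_
      have h3 : ⌊((t / s : ℝ≥0) : ℝ) * n⌋₊ = ⌊t / s * n⌋₊ :=
        Nonneg.nat_floor_coe (t / s * (n : ℝ≥0))
      simp only [Function.comp_apply, h3, grid]
      push_cast
      ring
    have l1 := (hc.tendsto (s + t)).comp (hlim.const_add s)
    have l2 := ((hc.tendsto t).comp hlim).const_mul (∫ ω, u s x ω ^ (q + 1) ∂P)
    refine le_of_tendsto_of_tendsto l1 l2 ?_
    filter_upwards [eventually_ne_atTop 0] with n hn
    have hn' : (n : ℝ≥0) ≠ 0 := by exact_mod_cast hn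
    have e1 : grid (s / n) n = s := by
      have := grid_div s hn 1
      simpa [grid] using this
    have := hu.integral_pow_grid_add_le ha hb hw (div_ne_zero hs hn') n ⌊t / s * n⌋₊ x q
    have e2 : grid (s / n) (n + ⌊t / s * n⌋₊) = s + grid (s / n) ⌊t / s * n⌋₊ := by
      conv_rhs => rw [← e1]
      rw [e1]
      simp only [grid]
      push_cast
      rw [add_mul, mul_div_cancel₀ _ hn']
    rw [e2, e1] at this
    exact this

theorem IsSolution.exists_hasLyapunovExponent (ha : IsJumpKernel a) (hb : Summable fun z => |b z|)
    (hw : IsBrownianFamily P ℱ w) (hu : IsSolution a b κ P ℱ w u) (q : ℕ) :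
    ∃ γ, HasLyapunovExponent P u (q + 1) γ := by
  have hpos := fun t => hu.integral_pow_pos ha hb hw t 0 q
  obtain ⟨γ, hγ⟩ := exists_tendsto_div_of_subadditive
    (f := fun t => Real.log (∫ ω, u t 0 ω ^ (q + 1) ∂P)) (c := momentRate b (q + 1))
    (fun s t => by
      rw [← Real.log_mul (hpos s).ne' (hpos t).ne']
      exact Real.log_le_log (hpos _) (hu.integral_pow_add_le ha hb hw s t 0 q))
    (fun t => by
      obtain ⟨h1, h2⟩ := hu.integral_pow_bounds ha hb hw t 0 q
      rw [abs_le]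
      exact ⟨(Real.le_log_iff_exp_le (hpos t)).mpr h1, (Real.log_le_iff_le_exp (hpos t)).mpr h2⟩)
  exact ⟨γ, fun t => hu.integrable_pow ha hb hw t 0 _, hpos, hγ⟩

end Lyapunov

/-! ### Comparison of the Lyapunov exponents. -/

section Comparison

variable {d : ℕ} {a b : Lattice d → ℝ} {κ κ' : ℝ≥0}
  {Ω : Type*} {mΩ : MeasurableSpace Ω} {P : Measure Ω} [IsProbabilityMeasure P]
  {ℱ : Filtration ℝ≥0 mΩ} {w : Lattice d → ℝ≥0 → Ω → ℝ} {u : ℝ≥0 → Lattice d → Ω → ℝ}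
  {Ω' : Type*} {mΩ' : MeasurableSpace Ω'} {P' : Measure Ω'} [IsProbabilityMeasure P']
  {ℱ' : Filtration ℝ≥0 mΩ'} {w' : Lattice d → ℝ≥0 → Ω' → ℝ} {v : ℝ≥0 → Lattice d → Ω' → ℝ}

/-- Comparison of the `(q + 1)`-st moment with the second moment for the diffusivity `κ / q`. -/
lemma IsSolution.integral_pow_ge (ha : IsJumpKernel a) (hb : Summable fun z => |b z|)
    (hw : IsBrownianFamily P ℱ w) (hu : IsSolution a b κ P ℱ w u)
    (hw' : IsBrownianFamily P' ℱ' w') (hv : IsSolution a b κ' P' ℱ' w' v)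
    {q : ℕ} (hq : q ≠ 0) (hκ : (κ' : ℝ) = κ / q) {t : ℝ≥0} (ht : t ≠ 0) (x : Lattice d) :
    Real.exp (t * (-(q * κ) + q * (q - 1) / 2 * corr b 0)) *
      ∫ ω, v (q * t) x ω ^ 2 ∂P' ≤ ∫ ω, u t x ω ^ (q + 1) ∂P := by
  have hq' : (q : ℝ≥0) ≠ 0 := by exact_mod_cast hq
  have hg : ∀ s : ℝ≥0, grid s 1 = s := fun s => by simp [grid]
  have l1 := hu.tendsto_discreteMoment ha hb hw ht 1 q x
  -- The second moment is run up to time q t with m steps of length q t/m, as many steps as the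
  -- scheme for `u` makes up to time t.
  have l2 := hv.tendsto_discreteMoment ha hb hw' (mul_ne_zero hq' ht) 1 1 x
  rw [hg] at l1 l2
  -- The holding factor (1 - tϰ/m)^m tends to exp(-tϰ) for each of the q held walkers.
  have l3 := ((Real.tendsto_one_add_div_pow_exp (-(t * κ))).pow q).mul_const
    (Real.exp (t * (q * (q - 1) / 2 * corr b 0)))
  have e3 : Real.exp (-((t : ℝ) * κ)) ^ q * Real.exp (t * (q * (q - 1) / 2 * corr b 0)) =
      Real.exp (t * (-(q * κ) + q * (q - 1) / 2 * corr b 0)) := by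
    rw [← Real.exp_nat_mul, ← Real.exp_add]
    congr 1
    ring
  rw [e3] at l3
  refine le_of_tendsto_of_tendsto (l3.mul l2) l1 ?_
  filter_upwards [eventually_div_mul_le_one t (2 * κ), eventually_ne_atTop 0] with m hm hm0
  have hm' : (m : ℝ) ≠ 0 := by exact_mod_cast hm0
  have h1 : ((t / m : ℝ≥0) : ℝ) * κ ≤ 1 / 2 := by
    have : ((t / m : ℝ≥0) : ℝ) * (2 * κ) ≤ 1 := by exact_mod_cast hm
    linarith
  have h2 := discreteMoment_ge ha hb (NNReal.coe_nonneg κ) (NNReal.coe_nonneg (t / m)) h1 hq (1 * m)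
  have h3 := (discreteMoment_le ha hb (NNReal.coe_nonneg κ) (NNReal.coe_nonneg (t / m))
    (h1.trans (by norm_num)) (q + 1) (1 * m) 0).trans_lt ENNReal.ofReal_lt_top
  have h4 := ENNReal.toReal_mono h3.ne h2
  have h5 : 0 ≤ 1 - ((t / m : ℝ≥0) : ℝ) * κ := by linarith
  rw [ENNReal.toReal_mul, ENNReal.toReal_pow, ENNReal.toReal_ofReal
    (mul_nonneg (pow_nonneg h5 q) (Real.exp_pos _).le)] at h4
  have h6 : ((q * t / m : ℝ≥0) : ℝ) = q * ((t / m : ℝ≥0) : ℝ) := by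
    push_cast
    ring
  rw [h6, hκ]
  refine le_trans (le_of_eq ?_) h4
  congr 1
  rw [one_mul, mul_pow, ← pow_mul, ← pow_mul, mul_comm q m, ← Real.exp_nat_mul]
  congr 2
  · push_cast
    ring
  · push_cast
    field_simp

/-- Take logarithms and divide by t; the second moment is evaluated at time q t, whence the factor q
in front of γ₂. -/
lemma HasLyapunovExponent.comparison (ha : IsJumpKernel a) (hb : Summable fun z => |b z|)
    (hw : IsBrownianFamily P ℱ w) (hu : IsSolution a b κ P ℱ w u)
    (hw' : IsBrownianFamily P' ℱ' w') (hv : IsSolution a b κ' P' ℱ' w' v)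
    {q : ℕ} (hq : q ≠ 0) (hκ : (κ' : ℝ) = κ / q) {γ γ₂ : ℝ}
    (hγ : HasLyapunovExponent P u (q + 1) γ) (hγ₂ : HasLyapunovExponent P' v 2 γ₂) :
    -(q * κ) + q * (q - 1) / 2 * corr b 0 + q * γ₂ ≤ γ := by
  have hq' : (q : ℝ≥0) ≠ 0 := by exact_mod_cast hq
  have hqt : Tendsto (fun t : ℝ≥0 => q * t) atTop atTop :=
    tendsto_id.const_mul_atTop (pos_iff_ne_zero.mpr hq')
  have l1 := ((hγ₂.tendsto.comp hqt).const_mul (q : ℝ)).const_add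
    (-(q * κ) + q * (q - 1) / 2 * corr b 0)
  refine le_of_tendsto_of_tendsto l1 hγ.tendsto ?_
  filter_upwards [eventually_ne_atTop 0] with t ht
  have ht' : (t : ℝ) ≠ 0 := by exact_mod_cast ht
  have ht0 : (0 : ℝ) < t := by positivity
  have hq0 : (q : ℝ) ≠ 0 := by exact_mod_cast hq
  have h1 := hu.integral_pow_ge ha hb hw hw' hv hq hκ ht 0
  have h2 := Real.log_le_log (mul_pos (Real.exp_pos _) (hγ₂.pos _)) h1
  rw [Real.log_mul (Real.exp_pos _).ne' (hγ₂.pos _).ne', Real.log_exp] at h2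
  rw [le_div_iff₀ ht0]
  refine le_trans (le_of_eq ?_) h2
  simp only [Function.comp_apply]
  push_cast
  field_simp

/-- In dimension 0 the origin is the only site, so a(0) = 0 contradicts total mass 1. -/
lemma IsJumpKernel.dim_ne_zero (ha : IsJumpKernel a) : d ≠ 0 := by
  rintro rfl
  have h1 : a = fun _ => 0 := by
    ext z
    rw [Subsingleton.elim z 0, ha.zero]
  have h2 := ha.hasSum_one
  rw [h1] at h2
  exact zero_ne_one (hasSum_zero.unique h2)

end Comparison

end Anderson

end

theorem mainTheorem3 {d : ℕ} (a b : Anderson.Lattice d → ℝ)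
    (ha : Anderson.IsJumpKernel a) (hb : Summable fun z => |b z|)
    (ϰ : ℝ) (hϰ : 0 < ϰ) (p : ℕ) (hp : 2 ≤ p)
    -- `u` is the solution with diffusivity `ϰ`
    {Ω : Type*} {mΩ : MeasurableSpace Ω} (P : Measure Ω) [IsProbabilityMeasure P]
    (ℱ : Filtration ℝ≥0 mΩ) (w : Anderson.Lattice d → ℝ≥0 → Ω → ℝ)
    (hw : Anderson.IsBrownianFamily P ℱ w)
    (u : ℝ≥0 → Anderson.Lattice d → Ω → ℝ)
    (hu : Anderson.IsSolution a b ϰ P ℱ w u)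
    -- `v` is the solution with diffusivity `ϰ / (p - 1)`
    {Ω' : Type*} {mΩ' : MeasurableSpace Ω'} (P' : Measure Ω') [IsProbabilityMeasure P']
    (ℱ' : Filtration ℝ≥0 mΩ') (w' : Anderson.Lattice d → ℝ≥0 → Ω' → ℝ)
    (hw' : Anderson.IsBrownianFamily P' ℱ' w')
    (v : ℝ≥0 → Anderson.Lattice d → Ω' → ℝ)
    (hv : Anderson.IsSolution a b (ϰ / ((p : ℝ) - 1)) P' ℱ' w' v) :
    ∃ γp γ2 : ℝ,
      Anderson.HasLyapunovExponent P u p γp ∧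
      Anderson.HasLyapunovExponent P' v 2 γ2 ∧
      γp / ((p : ℝ) - 1) >
        γ2 + Anderson.corr b 0 * ((p : ℝ) - 2) / 2 - 2 * ϰ * (d : ℝ) := by
  obtain ⟨q, rfl⟩ : ∃ q, p = q + 1 := ⟨p - 1, by omega⟩
  have hq : q ≠ 0 := by omega
  have hq0 : (0 : ℝ) < q := by positivity
  have e1 : (((q + 1 : ℕ) : ℝ)) - 1 = q := by
    push_cast
    ring
  rw [e1] at hv ⊢
  lift ϰ to ℝ≥0 using hϰ.le
  have e2 : ((ϰ / q : ℝ≥0) : ℝ) = ϰ / q := by push_cast; rfl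
  rw [← e2] at hv
  obtain ⟨γ, hγ⟩ := hu.exists_hasLyapunovExponent ha hb hw q
  obtain ⟨γ₂, hγ₂⟩ := hv.exists_hasLyapunovExponent ha hb hw' 1
  refine ⟨γ, γ₂, hγ, hγ₂, ?_⟩
  have h := Anderson.HasLyapunovExponent.comparison ha hb hw hu hw' hv hq e2 hγ hγ₂
  have hd : (1 : ℝ) ≤ d := by exact_mod_cast Nat.one_le_iff_ne_zero.mpr ha.dim_ne_zero
  -- The comparison loses only ϰ; since d ≥ 1 and ϰ > 0, this is strictly less than 2ϰd.
  have hd2 : (ϰ : ℝ) * 1 ≤ ϰ * d := by gcongr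
  have h2 : (-(ϰ : ℝ) + (q - 1) / 2 * Anderson.corr b 0 + γ₂) * q ≤ γ := by linarith
  rw [gt_iff_lt]
  refine lt_of_lt_of_le ?_ ((le_div_iff₀ hq0).mpr h2)
  push_cast
  linarith
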